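/- Let $d\ge 2$ and let $\Omega\subset\mathbb R^d$ be a bounded connected open set with Lipschitz boundary. Let $A_d$ be the area of the unit sphere of $\mathbb R^d$, let $\tau:H^1(\Omega)\to L^2(\partial\Omega)$ be the trace operator, and for $\beta\in[0,\infty)$ and $U,V\in H^1(\Omega)$ put $$(U,V)_\beta = A_d\,\beta\int_\Omega UV\,dx+\int_{\partial\Omega}\tau U\,\tau V\,dA .$$ The dynamical eigenvalue problem $-\Delta U=A_d\beta\Sigma U$ in $\Omega$, $\partial_\nu U=\Sigma U$ on $\partial\Omega$, and the Neumann problem $-\Delta f=\mu f$ in $\Omega$, $\partial_\nu f=0$ on $\partial\Omega$, are understood weakly: $\int_\Omega\nabla U\cdot\nabla V\,dx=\Sigma\,(U,V)_\beta$, respectively $\int_\Omega\nabla f\cdot\nabla V\,dx=\mu\int_\Omega fV\,dx$, for all $V\in H^1(\Omega)$. Their eigenvalues, repeated according to multiplicity, form sequences $$0=\Sigma_{0,\beta}<\Sigma_{1,\beta}\le\Sigma_{2,\beta}\le\dots\nearrow\infty\quad(\beta\ge0),\qquad 0=\mu_0<\mu_1\le\mu_2\le\dots\nearrow\infty ,$$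 with associated eigenfunctions $U_{k,\beta}$, orthonormal with respect to $(\cdot,\cdot)_\beta$, and $f_k$, orthonormal in $L^2(\Omega)$. For every $k\in\{0,1,2,\dots\}$ the function $\beta\mapsto\Sigma_{k,\beta}$ is continuous on $[0,\infty)$, and $$\lim_{\beta\to\infty}A_d\,\beta\,\Sigma_{k,\beta}=\mu_k .$$ Moreover, as $\beta\to\infty$, the functions $\beta^{1/2}U_{k,\beta}$ converge weakly in $H^1(\Omega)$ to $A_d^{-1/2}f_k$ (the $k$-th Neumann eigenfunction, normalised by $A_d\int_\Omega f^2\,dx=1$), in the following sense. Let $\mu_{k-1}<\mu_k=\dots=\mu_{k+m-1}<\mu_{k+m}$ be a Neumann eigenvalue of multiplicity $m$ (the first inequality being void for $k=0$). Then for every choice of the orthonormal eigenfunctions $f_j$ and $U_{j,\beta}$ ($j\ge0$, $\beta>0$) there are orthogonal $m\times m$ matrices $M(\beta)$ such that, for each $i=0,\dots,m-1$, $$\sum_{j=0}^{m-1}M(\beta)_{ij}\,\beta^{1/2}\,U_{k+j,\beta}\;\rightharpoonup\;A_d^{-1/2}f_{k+i}\quad\text{weakly in }H^1(\Omega)\text{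 as }\beta\to\infty .$$ (For $m=1$ the matrix is a sign $\pm1$.) -/

import Mathlib

open MeasureTheory Set Filter Topology
open scoped ContDiff InnerProductSpace

noncomputable section

namespace DynamicalSpectrum

/-- Euclidean space `ℝ^d`. -/
abbrev E (d : ℕ) : Type := EuclideanSpace ℝ (Fin d)

/-- `Ω` has Lipschitz boundary: near every boundary point, in suitable orthogonal coordinates
(`v` is the unit vector of the vertical direction), `Ω` is the region strictly above the graph of
a Lipschitz function of the remaining coordinates. -/
def HasLipschitzBoundary {d : ℕ} (Ω : Set (E d)) : Prop :=
  ∀ p ∈ frontier Ω, ∃ v : E d, ‖v‖ = 1 ∧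
    ∃ (γ : ↥((ℝ ∙ v)ᗮ) → ℝ) (K : NNReal), LipschitzWith K γ ∧
      ∃ U ∈ 𝓝 p, ∀ x ∈ U, (x ∈ Ω ↔ γ ((ℝ ∙ v)ᗮ.orthogonalProjectionOnto x) < ⟪v, x⟫_ℝ)

/-- A bounded connected open set with Lipschitz boundary (`IsConnected` includes
non-emptiness). -/
structure IsLipschitzDomain {d : ℕ} (Ω : Set (E d)) : Prop where
  isOpen : IsOpen Ω
  isConnected : IsConnected Ω
  isBounded : Bornology.IsBounded Ω
  lipschitz : HasLipschitzBoundary Ω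

/-- The area `A_d` of the unit sphere of `ℝ^d`. -/
def sphereArea (d : ℕ) : ℝ := ((volume : Measure (E d)).toSphere).real univ

/-- The surface measure of `∂Ω`: the `(d-1)`-dimensional Hausdorff measure, with the Euclidean
normalisation, on the topological boundary. -/
def surfaceMeasure {d : ℕ} (Ω : Set (E d)) : Measure (E d) :=
  (Measure.euclideanHausdorffMeasure (d - 1) : Measure (E d)).restrict (frontier Ω)

/-- `L²(Ω) × L²(Ω; ℝ^d)` with the Hilbert product norm. -/
abbrev L2Pair {d : ℕ} (Ω : Set (E d)) : Type :=
  WithLp 2 (Lp ℝ 2 (volume.restrict Ω) × Lp (E d) 2 (volume.restrict Ω))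

/-- `g` is the weak gradient of `u` in `Ω`. -/
def IsWeakGradient {d : ℕ} (Ω : Set (E d)) (u : E d → ℝ) (g : E d → E d) : Prop :=
  ∀ φ : E d → ℝ, ContDiff ℝ ∞ φ → HasCompactSupport φ → tsupport φ ⊆ Ω → ∀ v : E d,
    ∫ x in Ω, u x * fderiv ℝ φ x v = -∫ x in Ω, ⟪g x, v⟫_ℝ * φ x

lemma integrable_mul_fderiv {d : ℕ} (Ω : Set (E d)) (u : Lp ℝ 2 (volume.restrict Ω))
    {φ : E d → ℝ} (h : ContDiff ℝ ∞ φ) (hc : HasCompactSupport φ) (v : E d) :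
    Integrable (fun x => u x * fderiv ℝ φ x v) (volume.restrict Ω) := by
  have h1 : Continuous (fun x => fderiv ℝ φ x v) :=
    (h.continuous_fderiv (by simp)).clm_apply continuous_const
  have h2 : HasCompactSupport (fun x => fderiv ℝ φ x v) := hc.fderiv_apply ℝ v
  exact (Lp.memLp u).integrable_mul (q := 2) ((h1.memLp_of_hasCompactSupport h2).restrict Ω)

lemma integrable_inner_mul {d : ℕ} (Ω : Set (E d)) (g : Lp (E d) 2 (volume.restrict Ω))
    {φ : E d → ℝ} (h : ContDiff ℝ ∞ φ) (hc : HasCompactSupport φ) (v : E d) :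
    Integrable (fun x => ⟪g x, v⟫_ℝ * φ x) (volume.restrict Ω) := by
  have h1 : MemLp (fun x => ⟪g x, v⟫_ℝ) 2 (volume.restrict Ω) := (Lp.memLp g).inner_const v
  exact h1.integrable_mul (q := 2) ((h.continuous.memLp_of_hasCompactSupport hc).restrict Ω)

/-- The Sobolev space `H¹(Ω)`: pairs `(u, g)` of square integrable functions (modulo equality
almost everywhere) such that `g` is the weak gradient of `u`, with the norm
`‖u‖² = ∫ u² + ∫ |∇u|²`. -/
def H1 {d : ℕ} (Ω : Set (E d)) : Submodule ℝ (L2Pair Ω) where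
  carrier := {p | IsWeakGradient Ω p.fst p.snd}
  zero_mem' := by
    intro φ _ _ _ v
    have h1 : ∫ x in Ω, ((0 : L2Pair Ω).fst : E d → ℝ) x * fderiv ℝ φ x v = 0 := by
      refine integral_eq_zero_of_ae ?_
      filter_upwards [Lp.coeFn_zero ℝ 2 (volume.restrict Ω)] with x hx
      rw [WithLp.zero_fst, hx]
      simp
    have h2 : ∫ x in Ω, ⟪((0 : L2Pair Ω).snd : E d → E d) x, v⟫_ℝ * φ x = 0 := by
      refine integral_eq_zero_of_ae ?_
      filter_upwards [Lp.coeFn_zero (E d) 2 (volume.restrict Ω)] with x hx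
      rw [WithLp.zero_snd, hx]
      simp
    rw [h1, h2, neg_zero]
  add_mem' := by
    intro p q hp hq φ h hc hs v
    have h1 : ∫ x in Ω, ((p + q).fst : E d → ℝ) x * fderiv ℝ φ x v
        = (∫ x in Ω, (p.fst : E d → ℝ) x * fderiv ℝ φ x v)
          + ∫ x in Ω, (q.fst : E d → ℝ) x * fderiv ℝ φ x v := by
      rw [← integral_add (integrable_mul_fderiv Ω p.fst h hc v)
        (integrable_mul_fderiv Ω q.fst h hc v)]
      refine integral_congr_ae ?_
      filter_upwards [Lp.coeFn_add p.fst q.fst] with x hx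
      simp only [WithLp.add_fst, hx, Pi.add_apply]
      ring
    have h2 : ∫ x in Ω, ⟪((p + q).snd : E d → E d) x, v⟫_ℝ * φ x
        = (∫ x in Ω, ⟪(p.snd : E d → E d) x, v⟫_ℝ * φ x)
          + ∫ x in Ω, ⟪(q.snd : E d → E d) x, v⟫_ℝ * φ x := by
      rw [← integral_add (integrable_inner_mul Ω p.snd h hc v)
        (integrable_inner_mul Ω q.snd h hc v)]
      refine integral_congr_ae ?_
      filter_upwards [Lp.coeFn_add p.snd q.snd] with x hx
      simp only [WithLp.add_snd, hx, Pi.add_apply, inner_add_left]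
      ring
    rw [h1, h2, hp φ h hc hs v, hq φ h hc hs v]
    ring
  smul_mem' := by
    intro c p hp φ h hc hs v
    have h1 : ∫ x in Ω, ((c • p).fst : E d → ℝ) x * fderiv ℝ φ x v
        = c * ∫ x in Ω, (p.fst : E d → ℝ) x * fderiv ℝ φ x v := by
      rw [← integral_const_mul]
      refine integral_congr_ae ?_
      filter_upwards [Lp.coeFn_smul c p.fst] with x hx
      simp only [WithLp.smul_fst, hx, Pi.smul_apply, smul_eq_mul]
      ring
    have h2 : ∫ x in Ω, ⟪((c • p).snd : E d → E d) x, v⟫_ℝ * φ x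
        = c * ∫ x in Ω, ⟪(p.snd : E d → E d) x, v⟫_ℝ * φ x := by
      rw [← integral_const_mul]
      refine integral_congr_ae ?_
      filter_upwards [Lp.coeFn_smul c p.snd] with x hx
      simp only [WithLp.smul_snd, hx, Pi.smul_apply, inner_smul_left, conj_trivial]
      ring
    rw [h1, h2, hp φ h hc hs v]
    ring

/-- The function underlying an element of `H¹(Ω)`, as an element of `L²(Ω)`. -/
def H1.val {d : ℕ} {Ω : Set (E d)} (u : H1 Ω) : Lp ℝ 2 (volume.restrict Ω) :=
  (u : L2Pair Ω).fst

/-- The weak gradient of an element of `H¹(Ω)`. -/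
def H1.grad {d : ℕ} {Ω : Set (E d)} (u : H1 Ω) : Lp (E d) 2 (volume.restrict Ω) :=
  (u : L2Pair Ω).snd

/-- A bounded linear operator `H¹(Ω) → L²(∂Ω)` is a trace operator if it restricts to the boundary
every function which is smooth up to the boundary. -/
def IsTraceOperator {d : ℕ} (Ω : Set (E d)) (T : H1 Ω →L[ℝ] Lp ℝ 2 (surfaceMeasure Ω)) : Prop :=
  ∀ (u : H1 Ω) (φ : E d → ℝ), ContDiff ℝ ∞ φ →
    (H1.val u : E d → ℝ) =ᵐ[volume.restrict Ω] φ →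
    (T u : E d → ℝ) =ᵐ[surfaceMeasure Ω] φ

open Classical in
/-- The trace operator `τ : H¹(Ω) → L²(∂Ω)`. (On a bounded Lipschitz domain there is exactly one
operator satisfying `IsTraceOperator`; the value `0` is only a default for other sets.) -/
def trace {d : ℕ} (Ω : Set (E d)) : H1 Ω →L[ℝ] Lp ℝ 2 (surfaceMeasure Ω) :=
  if h : ∃ T, IsTraceOperator Ω T then h.choose else 0

/-- The Dirichlet form `∫_Ω ∇u · ∇w`. -/
def dirichletForm {d : ℕ} {Ω : Set (E d)} (u w : H1 Ω) : ℝ :=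
  ∫ x in Ω, ⟪H1.grad u x, H1.grad w x⟫_ℝ

/-- The form `(u, w) = ∫_Ω u w`. -/
def neumannForm {d : ℕ} {Ω : Set (E d)} (u w : H1 Ω) : ℝ :=
  ∫ x in Ω, H1.val u x * H1.val w x

/-- The form `(u, w)_β = A_d β ∫_Ω u w + ∫_{∂Ω} τu τw`. -/
def dynamicalForm {d : ℕ} {Ω : Set (E d)} (β : ℝ) (u w : H1 Ω) : ℝ :=
  sphereArea d * β * (∫ x in Ω, H1.val u x * H1.val w x)
    + ∫ x, trace Ω u x * trace Ω w x ∂(surfaceMeasure Ω)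

/-- `u` is an eigenfunction with eigenvalue `t` of the weak eigenvalue problem
`∫_Ω ∇u · ∇w = t b(u, w)` for all `w ∈ H¹(Ω)`.
For `b = neumannForm` this is the weak form of `-Δu = t u` in `Ω`, `∂_ν u = 0` on `∂Ω`; for
`b = dynamicalForm β` it is the weak form of `-Δu = A_d β t u` in `Ω`, `∂_ν u = t u` on `∂Ω`. -/
def IsEigenpair {d : ℕ} {Ω : Set (E d)} (b : H1 Ω → H1 Ω → ℝ) (t : ℝ) (u : H1 Ω) : Prop :=
  u ≠ 0 ∧ ∀ w : H1 Ω, dirichletForm u w = t * b u w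

/-- The `k`-th eigenvalue (`k = 0, 1, 2, …`, in increasing order and repeated according to
multiplicity): the least `s` such that there are `k + 1` linearly independent eigenfunctions with
eigenvalues at most `s`. -/
def eigenvalue {d : ℕ} {Ω : Set (E d)} (b : H1 Ω → H1 Ω → ℝ) (k : ℕ) : ℝ :=
  sInf {s : ℝ | ∃ u : Fin (k + 1) → H1 Ω, LinearIndependent ℝ u ∧
    ∀ i, ∃ t ≤ s, IsEigenpair b t (u i)}

/-- The Neumann eigenvalue `μ_k` of `Ω`. -/
def neumannEigenvalue {d : ℕ} (Ω : Set (E d)) (k : ℕ) : ℝ :=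
  eigenvalue (neumannForm (Ω := Ω)) k

/-- The eigenvalue `Σ_{k,β}` of the dynamical problem on `Ω`. -/
def dynamicalEigenvalue {d : ℕ} (Ω : Set (E d)) (k : ℕ) (β : ℝ) : ℝ :=
  eigenvalue (dynamicalForm (Ω := Ω) β) k

/-- `(u_k)` is a sequence of eigenfunctions associated with the eigenvalues counted with
multiplicity and orthonormal with respect to `b`. -/
def IsEigenbasis {d : ℕ} {Ω : Set (E d)} (b : H1 Ω → H1 Ω → ℝ) (u : ℕ → H1 Ω) : Prop :=
  (∀ k, IsEigenpair b (eigenvalue b k) (u k)) ∧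
    ∀ i j, b (u i) (u j) = if i = j then 1 else 0

/-- The spectrum is a sequence `0 = λ_0 < λ_1 ≤ λ_2 ≤ ⋯ → ∞` with associated orthonormal
eigenfunctions. -/
def HasDiscreteSpectrum {d : ℕ} {Ω : Set (E d)} (b : H1 Ω → H1 Ω → ℝ) : Prop :=
  eigenvalue b 0 = 0 ∧ 0 < eigenvalue b 1 ∧ Monotone (eigenvalue b) ∧
    Tendsto (eigenvalue b) atTop atTop ∧ ∃ u, IsEigenbasis b u

/-- Weak convergence in a normed space. -/
def WeakTendsto {ι H : Type*} [NormedAddCommGroup H] [NormedSpace ℝ H]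
    (F : ι → H) (l : Filter ι) (a : H) : Prop :=
  ∀ ℓ : H →L[ℝ] ℝ, Tendsto (fun i => ℓ (F i)) l (𝓝 (ℓ a))

end DynamicalSpectrum

end

open DynamicalSpectrum

/-! On `H = H¹(Ω)` let `D` be the Dirichlet form, `n` the `L²(Ω)` form and `s` the form of the
traces. The dynamical problem is the eigenvalue problem of `D` relative to `s + t n` with `t = A_d
β`. Since `s + t n = t (n + t⁻¹ s)`, the numbers `A_d β Σ` are the eigenvalues of `D` relative to `n
+ ε s`, where `ε = (A_d β)⁻¹`. The limit `β → ∞` is therefore a regular perturbation of the Neumann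
problem, bounded relative to `D + n`.

Eigenvalues: the eigenvalues defined by counting eigenvectors are the successive minima of the
Rayleigh quotient (`IsMinSystem.formEigenvalue_eq`), so min-max applies. If `p ≥ 0` is bounded by a
multiple of `D + b`, the eigenvalues relative to `b + x p` are Lipschitz in `x ≥ 0`
(`lipschitz_formEigenvalue`). With `b = s`, `p = n` this is continuity on `[0, ∞)`; with `b = n`, `p
= s` at `x = 0` it is the limit `μ_k`.

Eigenvectors: an eigenvector `v` normalised for `n + ε s` has bounded norm, so `√ε v → 0` in `H`.
Testing its equation with a Neumann eigenfunction of another eigenvalue shows that this coefficient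
of `v` tends to zero; testing with the part of `v` orthogonal to `f_0, …, f_{k+m-1}` and using the
gap above `μ_k` shows that this part tends to zero in norm. The coefficients on the eigenspace of
`μ_k` form matrices `Q` with `Q Qᵀ → 1`, which orthogonal matrices undo asymptotically
(`exists_orthogonal_tendsto_eigenvectors`). The convergence obtained is strong, hence weak.

Analysis on `Ω`: a Lipschitz boundary lets points near it be pushed into `Ω` along a fixed open cone
of directions. Averages over such directions only see values inside `Ω`, which yields density of
functions smooth up to the boundary (`dense_smoothElements`) and Rellich's theorem
(`exists_subseq_cauchy_val`). In graph coordinates, integrating along vertical lines gives `‖τu‖² ≤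
C ‖u‖_{L²} ‖u‖_{H¹}` (`exists_norm_trace_sq_le`), so `s` is compact along with `n`. Connectedness
makes the kernel of `D` the constants, whose trace is non-zero; by compactness `D + s` is then
coercive, which covers `β = 0`. -/

namespace DynamicalSpectrum

/-! ### Variational spectral theory of a pair of forms -/

section AbstractSpectrum

variable {H : Type*} [NormedAddCommGroup H] [NormedSpace ℝ H]

/-- The `k`-th eigenvalue of the problem `D u w = t b u w`: the least `s` such that there are
`k + 1` linearly independent eigenvectors with eigenvalues at most `s`. -/
noncomputable def formEigenvalue (D b : H → H → ℝ) (k : ℕ) : ℝ :=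
  sInf {s : ℝ | ∃ u : Fin (k + 1) → H, LinearIndependent ℝ u ∧
    ∀ i, ∃ t ≤ s, u i ≠ 0 ∧ ∀ w : H, D (u i) w = t * b (u i) w}

/-- A pair of nonnegative symmetric forms with `D + b` coercive, `b` compact and of infinite rank,
and `D` with one-dimensional kernel. -/
structure IsSpectralPair (D b : H →L[ℝ] H →L[ℝ] ℝ) : Prop where
  symm_left : ∀ u w, D u w = D w u
  symm_right : ∀ u w, b u w = b w u
  nonneg_left : ∀ u, 0 ≤ D u u
  nonneg_right : ∀ u, 0 ≤ b u u
  coercive : ∃ c > 0, ∀ u, c * ‖u‖ ^ 2 ≤ D u u + b u u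
  compact : ∀ u : ℕ → H, (∃ C, ∀ n, ‖u n‖ ≤ C) → ∃ φ : ℕ → ℕ, StrictMono φ ∧
    ∀ ε > 0, ∃ N, ∀ m ≥ N, ∀ n ≥ N,
      b (u (φ m) - u (φ n)) (u (φ m) - u (φ n)) < ε
  rank : ∀ n : ℕ, ∃ v : Fin n → H, (∀ i, 0 < b (v i) (v i)) ∧ ∀ i j, i ≠ j → b (v i) (v j) = 0
  kernel : ∃ e, e ≠ 0 ∧ D e e = 0 ∧ ∀ u, D u u = 0 → ∃ c : ℝ, u = c • e

/-- A `b`-orthonormal sequence of eigenvectors which successively minimise the Rayleigh quotient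
on the orthogonal complement of their predecessors. -/
structure IsMinSystem (D b : H →L[ℝ] H →L[ℝ] ℝ) (u : ℕ → H) (ev : ℕ → ℝ) : Prop where
  orthonormal : ∀ i j, b (u i) (u j) = if i = j then 1 else 0
  eigen : ∀ k w, D (u k) w = ev k * b (u k) w
  min : ∀ k w, (∀ j < k, b (u j) w = 0) → ev k * b w w ≤ D w w

/-- Along `w + t u` the form is affine in `t` because `q u u = 0`, and an affine function bounded
below has slope zero. For `q = D - λ b` and a minimiser `u` this is the Euler–Lagrange equation. -/
lemma form_apply_eq_zero_of_nonneg {q : H →L[ℝ] H →L[ℝ] ℝ} (hs : ∀ u w, q u w = q w u)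
    {K : Submodule ℝ H} (hK : ∀ w ∈ K, 0 ≤ q w w) {u w : H} (hu : u ∈ K) (hw : w ∈ K)
    (h0 : q u u = 0) : q u w = 0 := by
  have h : ∀ t : ℝ, 0 ≤ q w w + 2 * t * q u w := by
    intro t
    have := hK (w + t • u) (K.add_mem hw (K.smul_mem t hu))
    simp only [map_add, map_smul, add_apply, smul_apply,
      smul_eq_mul, h0, hs w u] at this
    linarith
  by_contra hne
  have h1 := h (-(q w w + 1) / (2 * q u w))
  have : 2 * (-(q w w + 1) / (2 * q u w)) * q u w = -(q w w + 1) := by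
    field_simp
  linarith

lemma form_sub_self {q : H →L[ℝ] H →L[ℝ] ℝ} (hs : ∀ u w, q u w = q w u) (x y : H) :
    q (x - y) (x - y) = 2 * q x x + 2 * q y y - q (x + y) (x + y) := by
  simp only [map_sub, map_add, sub_apply, add_apply, hs y x]
  ring

lemma form_smul_self (q : H →L[ℝ] H →L[ℝ] ℝ) (c : ℝ) (x : H) :
    q (c • x) (c • x) = c ^ 2 * q x x := by
  simp only [map_smul, smul_apply, smul_eq_mul]
  ring

lemma continuous_form_self (q : H →L[ℝ] H →L[ℝ] ℝ) : Continuous fun x => q x x :=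
  q.continuous.clm_apply continuous_id

lemma continuous_form {X : Type*} [TopologicalSpace X] (q : H →L[ℝ] H →L[ℝ] ℝ) {f g : X → H}
    (hf : Continuous f) (hg : Continuous g) : Continuous fun x => q (f x) (g x) :=
  (q.continuous.comp hf).clm_apply hg

variable {D b : H →L[ℝ] H →L[ℝ] ℝ}

/-- The direct method with strong convergence only: by the parallelogram identity, a minimising
sequence is Cauchy in norm as soon as it is Cauchy for `b`, and compactness provides a subsequence
with that property. -/
lemma IsSpectralPair.exists_minimizer [CompleteSpace H] (h : IsSpectralPair D b)
    {K : Submodule ℝ H} (hc : IsClosed (K : Set H)) (hK : ∃ v ∈ K, 0 < b v v) :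
    ∃ u ∈ K, b u u = 1 ∧ ∀ w ∈ K, D u u * b w w ≤ D w w := by
  set S : Set ℝ := (fun w => D w w) '' {w | w ∈ K ∧ b w w = 1} with hS
  have hSne : S.Nonempty := by
    obtain ⟨v, hv, hpos⟩ := hK
    refine ⟨_, (Real.sqrt (b v v))⁻¹ • v, ⟨K.smul_mem _ hv, ?_⟩, rfl⟩
    rw [form_smul_self, inv_pow, Real.sq_sqrt hpos.le, inv_mul_cancel₀ hpos.ne']
  have hSb : BddBelow S := ⟨0, by rintro _ ⟨w, -, rfl⟩; exact h.nonneg_left w⟩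
  set m := sInf S with hm
  have hm0 : 0 ≤ m := le_csInf hSne (by rintro _ ⟨w, -, rfl⟩; exact h.nonneg_left w)
  have hmin : ∀ w ∈ K, m * b w w ≤ D w w := by
    intro w hw
    rcases (h.nonneg_right w).eq_or_lt with h0 | hpos
    · rw [← h0, mul_zero]; exact h.nonneg_left w
    · have : m ≤ D ((Real.sqrt (b w w))⁻¹ • w) ((Real.sqrt (b w w))⁻¹ • w) := by
        refine csInf_le hSb ⟨_, ⟨K.smul_mem _ hw, ?_⟩, rfl⟩
        rw [form_smul_self, inv_pow, Real.sq_sqrt hpos.le, inv_mul_cancel₀ hpos.ne']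
      rw [form_smul_self, inv_pow, Real.sq_sqrt hpos.le] at this
      calc m * b w w ≤ ((b w w)⁻¹ * D w w) * b w w := by gcongr
        _ = D w w := by field_simp
  obtain ⟨s, -, hs, hsS⟩ := exists_seq_tendsto_sInf hSne hSb
  choose x hx hxs using hsS
  simp only [mem_ofPred_eq] at hx hxs
  obtain ⟨c, hc0, hcoer⟩ := h.coercive
  have hDx : Tendsto (fun n => D (x n) (x n)) atTop (𝓝 m) := by
    simpa only [hxs] using hs
  have hbdd : ∃ C, ∀ n, ‖x n‖ ≤ C := by
    obtain ⟨B, hB⟩ := hDx.bddAbove_range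
    refine ⟨Real.sqrt ((B + 1) / c), fun n => Real.le_sqrt_of_sq_le ?_⟩
    rw [le_div_iff₀ hc0]
    have h1 := hcoer (x n)
    have h2 : D (x n) (x n) ≤ B := hB ⟨n, rfl⟩
    rw [(hx n).2] at h1
    linarith
  obtain ⟨φ, hφ, hcomp⟩ := h.compact x hbdd
  -- Add the parallelogram identities of `D` and `b`. Minimality gives `D (x i + x j) ≥ m b (x i + x
  -- j)` on the diagonal, and `b (x i + x j) = 4 - b (x i - x j)` by normalisation.
  have key : ∀ i j, c * ‖x i - x j‖ ^ 2 ≤ 2 * (D (x i) (x i) - m) + 2 * (D (x j) (x j) - m)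
      + (m + 1) * b (x i - x j) (x i - x j) := by
    intro i j
    have h1 := hcoer (x i - x j)
    have h2 := form_sub_self h.symm_left (x i) (x j)
    have h3 := form_sub_self h.symm_right (x i) (x j)
    have h4 := hmin (x i + x j) (K.add_mem (hx i).1 (hx j).1)
    rw [(hx i).2, (hx j).2] at h3
    nlinarith
  have hcau : CauchySeq (x ∘ φ) := by
    rw [Metric.cauchySeq_iff]
    intro ε hε
    set δ := c * ε ^ 2 with hδ
    have hδ0 : 0 < δ := by positivity
    obtain ⟨N₁, hN₁⟩ := hcomp (δ / (4 * (m + 1))) (by positivity)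
    have hev : ∀ᶠ n in atTop, D (x (φ n)) (x (φ n)) < m + δ / 8 :=
      (hDx.comp hφ.tendsto_atTop).eventually_lt_const (by linarith)
    obtain ⟨N₂, hN₂⟩ := eventually_atTop.1 hev
    refine ⟨max N₁ N₂, fun i hi j hj => ?_⟩
    have h1 := key (φ i) (φ j)
    have h2 := hN₁ i (le_trans (le_max_left _ _) hi) j (le_trans (le_max_left _ _) hj)
    have h3 := hN₂ i (le_trans (le_max_right _ _) hi)
    have h4 := hN₂ j (le_trans (le_max_right _ _) hj)
    have h5 : (m + 1) * b (x (φ i) - x (φ j)) (x (φ i) - x (φ j)) < δ / 4 := by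
      rw [lt_div_iff₀ (by positivity)] at h2
      linarith
    rw [dist_eq_norm]
    have h6 : c * ‖x (φ i) - x (φ j)‖ ^ 2 < c * ε ^ 2 := by linarith
    exact lt_of_pow_lt_pow_left₀ 2 hε.le (lt_of_mul_lt_mul_left h6 hc0.le)
  obtain ⟨u, hu⟩ := cauchySeq_tendsto_of_complete hcau
  have hbu : b u u = 1 := by
    have h1 := ((continuous_form_self b).tendsto u).comp hu
    refine tendsto_nhds_unique h1 ?_
    simp only [Function.comp_def, (hx _).2]
    exact tendsto_const_nhds
  have hDu : D u u = m :=
    tendsto_nhds_unique (((continuous_form_self D).tendsto u).comp hu)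
      (hDx.comp hφ.tendsto_atTop)
  refine ⟨u, hc.mem_of_tendsto hu (Eventually.of_forall fun n => (hx _).1), hbu, ?_⟩
  rw [hDu]
  exact hmin

/-- The subspace of vectors which are `b`-orthogonal to all elements of `S`. -/
def formOrthogonal (b : H →L[ℝ] H →L[ℝ] ℝ) (S : Set H) : Submodule ℝ H where
  carrier := {w | ∀ v ∈ S, b v w = 0}
  zero_mem' := by simp
  add_mem' := by
    intro x y hx hy v hv
    rw [map_add, hx v hv, hy v hv, add_zero]
  smul_mem' := by
    intro c x hx v hv
    rw [map_smul, hx v hv, smul_zero]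

lemma mem_formOrthogonal {S : Set H} {w : H} :
    w ∈ formOrthogonal b S ↔ ∀ v ∈ S, b v w = 0 := Iff.rfl

lemma isClosed_formOrthogonal (S : Set H) : IsClosed (formOrthogonal b S : Set H) := by
  have : (formOrthogonal b S : Set H) = ⋂ v ∈ S, {w | b v w = 0} := by
    ext w; simp [mem_formOrthogonal]
  rw [this]
  exact isClosed_biInter fun v _ => isClosed_eq (b v).continuous continuous_const

/-- There are fewer linear conditions than coefficients, so the kernel is non-trivial. This is the
dimension count behind min-max. -/
lemma exists_combination_orthogonal {ι κ : Type*} [Fintype ι] [Fintype κ]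
    (b : H →L[ℝ] H →L[ℝ] ℝ) (hcard : Fintype.card κ < Fintype.card ι) (v : ι → H) (u : κ → H) :
    ∃ c : ι → ℝ, c ≠ 0 ∧ ∀ j, b (u j) (∑ i, c i • v i) = 0 := by
  let T : (ι → ℝ) →ₗ[ℝ] (κ → ℝ) :=
    LinearMap.pi fun j => (b (u j)).toLinearMap ∘ₗ Fintype.linearCombination ℝ v
  have hT : LinearMap.ker T ≠ ⊥ := LinearMap.ker_ne_bot_of_finrank_lt (by simpa using hcard)
  obtain ⟨c, hc, hc0⟩ := (Submodule.ne_bot_iff _).1 hT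
  refine ⟨c, hc0, fun j => ?_⟩
  have := congrFun (LinearMap.mem_ker.1 hc) j
  simpa [T, Fintype.linearCombination_apply] using this

lemma form_sum_of_orthogonal {ι : Type*} [Fintype ι] [DecidableEq ι] (q : H →L[ℝ] H →L[ℝ] ℝ)
    {v : ι → H} (hv : ∀ i j, i ≠ j → q (v i) (v j) = 0) (c : ι → ℝ) :
    q (∑ i, c i • v i) (∑ i, c i • v i) = ∑ i, c i ^ 2 * q (v i) (v i) := by
  simp only [map_sum, map_smul, sum_apply, smul_apply,
    smul_eq_mul]
  refine Finset.sum_congr rfl fun i _ => ?_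
  rw [Finset.sum_eq_single i]
  · ring
  · intro j _ hj
    rw [hv j i hj, mul_zero]
  · simp

/-- Infinite rank of `b` guarantees that the successive minimisation never stops. -/
lemma IsSpectralPair.exists_pos_orthogonal (h : IsSpectralPair D b) {S : Set H} (hS : S.Finite) :
    ∃ v ∈ formOrthogonal b S, 0 < b v v := by
  have := hS.fintype
  obtain ⟨v, hv, hv0⟩ := h.rank (Fintype.card S + 1)
  obtain ⟨c, hc, hc0⟩ := exists_combination_orthogonal b (by simp) v (fun s : S => (s : H))
  refine ⟨∑ i, c i • v i, fun s hs => hc0 ⟨s, hs⟩, ?_⟩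
  rw [form_sum_of_orthogonal b hv0]
  obtain ⟨i, hi⟩ := Function.ne_iff.1 hc
  refine Finset.sum_pos' (fun j _ => mul_nonneg (sq_nonneg _) (hv j).le) ⟨i, Finset.mem_univ _, ?_⟩
  have : c i ≠ 0 := hi
  have := hv i
  positivity

lemma IsSpectralPair.exists_isMinSystem [CompleteSpace H] (h : IsSpectralPair D b) :
    ∃ u ev, IsMinSystem D b u ev := by
  -- Stated for every set so that a choice function exists; the value 0 on infinite sets is never
  -- used.
  have hstep : ∀ S : Set H, ∃ u, S.Finite → u ∈ formOrthogonal b S ∧ b u u = 1 ∧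
      ∀ w ∈ formOrthogonal b S, D u u * b w w ≤ D w w := by
    intro S
    by_cases hS : S.Finite
    · obtain ⟨u, h1, h2, h3⟩ := h.exists_minimizer (isClosed_formOrthogonal S)
        (h.exists_pos_orthogonal hS)
      exact ⟨u, fun _ => ⟨h1, h2, h3⟩⟩
    · exact ⟨0, fun h => absurd h hS⟩
  choose F hF using hstep
  -- `S n` collects the first `n` minimisers; the next one is chosen `b`-orthogonal to them.
  let S : ℕ → Set H := fun n => Nat.rec ∅ (fun _ T => insert (F T) T) n
  let u : ℕ → H := fun n => F (S n)
  have hSu : ∀ n, S n = u '' Iio n := by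
    intro n
    induction n with
    | zero => simp [S]
    | succ n ih =>
      have : S (n + 1) = insert (u n) (S n) := rfl
      rw [this, ih, ← image_insert_eq]
      congr 1
      ext j
      simp only [mem_insert_iff, mem_Iio]
      omega
  have hfin : ∀ n, (S n).Finite := fun n => by rw [hSu]; exact (finite_Iio n).image _
  have horth : ∀ i j, i < j → b (u i) (u j) = 0 := by
    intro i j hij
    refine (hF (S j) (hfin j)).1 _ ?_
    rw [hSu]
    exact ⟨i, hij, rfl⟩
  have hon : ∀ i j, b (u i) (u j) = if i = j then 1 else 0 := by
    intro i j
    rcases lt_trichotomy i j with hij | rfl | hij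
    · rw [if_neg hij.ne, horth i j hij]
    · rw [if_pos rfl]; exact (hF (S i) (hfin i)).2.1
    · rw [if_neg hij.ne', h.symm_right, horth j i hij]
  have hmem : ∀ k w, (∀ j < k, b (u j) w = 0) → w ∈ formOrthogonal b (S k) := by
    intro k w hw v hv
    rw [hSu] at hv
    obtain ⟨j, hj, rfl⟩ := hv
    exact hw j hj
  have hmin : ∀ k w, (∀ j < k, b (u j) w = 0) → D (u k) (u k) * b w w ≤ D w w :=
    fun k w hw => (hF (S k) (hfin k)).2.2 w (hmem k w hw)
  have hEL : ∀ k w, (∀ j < k, b (u j) w = 0) → D (u k) w = D (u k) (u k) * b (u k) w := by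
    intro k w hw
    have := form_apply_eq_zero_of_nonneg (q := D - (D (u k) (u k)) • b)
      (K := formOrthogonal b (S k)) (u := u k) (w := w) ?_ ?_ (hF (S k) (hfin k)).1 (hmem k w hw) ?_
    · simpa [sub_eq_zero] using this
    · intro x y
      simp [h.symm_left x y, h.symm_right x y]
    · intro x hx
      have := (hF (S k) (hfin k)).2.2 x hx
      simpa [sub_nonneg] using this
    · simp [hon]
  refine ⟨u, fun k => D (u k) (u k), hon, ?_, hmin⟩
  intro k
  induction k using Nat.strong_induction_on with
  | _ k ih =>
    intro w
    -- The Euler–Lagrange equation of `u k` is known only against vectors `b`-orthogonal to its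
    -- predecessors. It extends to all `w` because `D (u k) (u j) = ev j * b (u j) (u k) = 0` for `j
    -- < k`, by induction.
    set w' := w - ∑ j ∈ Finset.range k, b (u j) w • u j with hw'
    have h1 : ∀ j < k, b (u j) w' = 0 := by
      intro j hj
      rw [hw', map_sub, map_sum, Finset.sum_eq_single j]
      · simp [hon]
      · intro i _ hij
        simp [hon, hij.symm]
      · simp [hj]
    have h2 := hEL k w' h1
    have h3 : ∀ j ∈ Finset.range k, b (u j) w • (D (u k)) (u j) = 0 := by
      intro j hj
      have hj := Finset.mem_range.1 hj
      rw [h.symm_left, ih j hj, hon, if_neg hj.ne]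
      simp
    have h4 : ∀ j ∈ Finset.range k, b (u j) w • (b (u k)) (u j) = 0 := by
      intro j hj
      have hj := Finset.mem_range.1 hj
      rw [hon, if_neg hj.ne']
      simp
    simp only [hw', map_sub, map_sum, map_smul] at h2
    rwa [Finset.sum_eq_zero h3, Finset.sum_eq_zero h4, sub_zero, sub_zero] at h2

namespace IsMinSystem

variable {u : ℕ → H} {ev : ℕ → ℝ}

lemma eigen_self (hm : IsMinSystem D b u ev) (k : ℕ) : D (u k) (u k) = ev k := by
  simp [hm.eigen, hm.orthonormal]

lemma ne_zero (hm : IsMinSystem D b u ev) (k : ℕ) : u k ≠ 0 := by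
  intro h
  have := hm.orthonormal k k
  simp [h] at this

lemma linearIndependent (hm : IsMinSystem D b u ev) : LinearIndependent ℝ u := by
  rw [linearIndependent_iff']
  intro s g hg i hi
  have := congrArg (b (u i)) hg
  simpa [hm.orthonormal, hi] using this

lemma monotone (hm : IsMinSystem D b u ev) : Monotone ev := by
  refine monotone_nat_of_le_succ fun k => ?_
  have := hm.min k (u (k + 1)) (fun j hj => by rw [hm.orthonormal, if_neg (by omega)])
  simpa [hm.orthonormal, hm.eigen_self] using this

lemma nonneg (h : IsSpectralPair D b) (hm : IsMinSystem D b u ev) (k : ℕ) : 0 ≤ ev k := by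
  rw [← hm.eigen_self]; exact h.nonneg_left _

lemma sub_proj_orthogonal (hm : IsMinSystem D b u ev) (k : ℕ) (w : H) :
    ∀ j < k, b (u j) (w - ∑ i ∈ Finset.range k, b (u i) w • u i) = 0 := by
  intro j hj
  rw [map_sub, map_sum, Finset.sum_eq_single j]
  · simp [hm.orthonormal]
  · intro i _ hij
    simp [hm.orthonormal, hij.symm]
  · simp [hj]

end IsMinSystem

lemma IsSpectralPair.eq_zero_of_le (h : IsSpectralPair D b) {x : H} (h1 : D x x + b x x ≤ 0) :
    x = 0 := by
  obtain ⟨c, hc, hco⟩ := h.coercive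
  have h2 := hco x
  have : ‖x‖ ^ 2 ≤ 0 := by
    by_contra hne
    push Not at hne
    have := mul_pos hc hne
    linarith
  have : ‖x‖ = 0 := by nlinarith [norm_nonneg x]
  simpa using this

/-- An eigenvector with eigenvalue below `ev k` is a combination of the first `k` minimisers. -/
lemma IsMinSystem.mem_span {u : ℕ → H} {ev : ℕ → ℝ} (h : IsSpectralPair D b)
    (hm : IsMinSystem D b u ev) {k : ℕ} {x : H} {t : ℝ} (hx : ∀ w, D x w = t * b x w)
    (ht : t < ev k) : x ∈ Submodule.span ℝ (u '' Iio k) := by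
  set y := x - ∑ i ∈ Finset.range k, b (u i) x • u i with hy
  -- Eigenvectors of different eigenvalues are `b`-orthogonal, so removing the first `k` components
  -- leaves an eigenvector `y` for `t`. The bound at level `k` with `t < ev k` then forces `b y y =
  -- 0`, hence `y = 0`.
  have hcoef : ∀ i, (t - ev i) * b (u i) x = 0 := by
    intro i
    have h1 := hx (u i)
    rw [h.symm_left, hm.eigen, h.symm_right x] at h1
    linarith
  have hyeig : ∀ w, D y w = t * b y w := by
    intro w
    simp only [hy, map_sub, map_sum, map_smul, sub_apply,
      sum_apply, smul_apply, smul_eq_mul, hx, hm.eigen,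
      mul_sub, Finset.mul_sum]
    congr 1
    refine Finset.sum_congr rfl fun i _ => ?_
    linear_combination (-b (u i) w) * hcoef i
  have h1 := hm.min k y (hm.sub_proj_orthogonal k x)
  rw [hyeig] at h1
  have hb : b y y = 0 := by
    have := h.nonneg_right y
    nlinarith
  have hy0 : y = 0 := h.eq_zero_of_le (by rw [hyeig, hb]; simp)
  have : x = ∑ i ∈ Finset.range k, b (u i) x • u i := by rwa [hy, sub_eq_zero] at hy0
  rw [this]
  exact Submodule.sum_mem _ fun i hi =>
    Submodule.smul_mem _ _ (Submodule.subset_span ⟨i, Finset.mem_range.1 hi, rfl⟩)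

lemma finrank_span_image_Iio (u : ℕ → H) (k : ℕ) :
    Module.finrank ℝ (Submodule.span ℝ (u '' Iio k)) ≤ k := by
  have h1 : u '' Iio k = range (fun i : Fin k => u i) := by
    ext x
    simp only [mem_image, mem_Iio, mem_range]
    exact ⟨fun ⟨i, hi, h⟩ => ⟨⟨i, hi⟩, h⟩, fun ⟨i, h⟩ => ⟨i, i.2, h⟩⟩
  rw [h1]
  simpa [Set.finrank] using finrank_range_le_card (R := ℝ) (fun i : Fin k => u i)

lemma card_le_of_mem_span {n k : ℕ} {v : Fin n → H} (hv : LinearIndependent ℝ v) {u : ℕ → H}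
    (hvu : ∀ i, v i ∈ Submodule.span ℝ (u '' Iio k)) : n ≤ k := by
  have hfin : FiniteDimensional ℝ (Submodule.span ℝ (u '' Iio k)) :=
    FiniteDimensional.span_of_finite ℝ ((finite_Iio k).image u)
  have h1 := Submodule.finrank_mono (Submodule.span_le.2 (range_subset_iff.2 hvu))
  rw [finrank_span_eq_card hv, Fintype.card_fin] at h1
  exact h1.trans (finrank_span_image_Iio u k)

/-- The eigenvalues of the frozen definition are the successive minima of the Rayleigh quotient. -/
lemma IsMinSystem.formEigenvalue_eq {u : ℕ → H} {ev : ℕ → ℝ} (h : IsSpectralPair D b)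
    (hm : IsMinSystem D b u ev) (k : ℕ) :
    formEigenvalue (fun x y => D x y) (fun x y => b x y) k = ev k := by
  refine IsLeast.csInf_eq ⟨⟨fun i => u i, ?_, fun i => ⟨ev i, ?_, hm.ne_zero _, hm.eigen _⟩⟩, ?_⟩
  · exact hm.linearIndependent.comp _ Fin.val_injective
  · exact hm.monotone (by omega)
  · rintro s ⟨v, hv, hvs⟩
    by_contra hlt
    push Not at hlt
    have := card_le_of_mem_span hv (u := u) (k := k) fun i => by
      obtain ⟨t, ht, -, hx⟩ := hvs i
      exact hm.mem_span h hx (ht.trans_lt hlt)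
    omega

/-- Bounded eigenvalues would bound the norms of the `u n` by coercivity, and compactness would give
a `b`-Cauchy subsequence; but distinct members satisfy `b (u i - u j) (u i - u j) = 2`. -/
lemma IsMinSystem.tendsto_atTop {u : ℕ → H} {ev : ℕ → ℝ} (h : IsSpectralPair D b)
    (hm : IsMinSystem D b u ev) : Tendsto ev atTop atTop := by
  refine tendsto_atTop_atTop_of_monotone hm.monotone fun B => ?_
  by_contra hne
  push Not at hne
  obtain ⟨c, hc0, hco⟩ := h.coercive
  obtain ⟨φ, hφ, hcomp⟩ := h.compact u ⟨Real.sqrt ((B + 1) / c), fun n => by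
    refine Real.le_sqrt_of_sq_le ?_
    rw [le_div_iff₀ hc0]
    have h1 := hco (u n)
    rw [hm.eigen_self, hm.orthonormal, if_pos rfl] at h1
    linarith [hne n]⟩
  obtain ⟨N, hN⟩ := hcomp 1 one_pos
  have h1 := hN N le_rfl (N + 1) (Nat.le_succ N)
  have h2 : φ N ≠ φ (N + 1) := (hφ (Nat.lt_succ_self N)).ne
  simp [hm.orthonormal, h2, h2.symm] at h1
  norm_num at h1

/-- The min-max principle. -/
lemma IsMinSystem.le_of_forall_mem_span {u : ℕ → H} {ev : ℕ → ℝ} (h : IsSpectralPair D b)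
    (hm : IsMinSystem D b u ev) {k : ℕ} {v : Fin (k + 1) → H} (hv : LinearIndependent ℝ v) {s : ℝ}
    (hs : ∀ c : Fin (k + 1) → ℝ,
      D (∑ i, c i • v i) (∑ i, c i • v i) ≤ s * b (∑ i, c i • v i) (∑ i, c i • v i)) :
    ev k ≤ s := by
  -- A vector in the span of the `k + 1` trial vectors that is `b`-orthogonal to the first `k`
  -- minimisers has Rayleigh quotient at least `ev k` and at most `s`.
  obtain ⟨c, hc, hc0⟩ := exists_combination_orthogonal b (by simp) v (fun j : Fin k => u j)
  set x := ∑ i, c i • v i with hx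
  have hx0 : x ≠ 0 := fun h0 => hc (funext fun i => Fintype.linearIndependent_iff.1 hv c h0 i)
  have h1 := hm.min k x fun j hj => hc0 ⟨j, hj⟩
  have h2 : D x x ≤ s * b x x := hs c
  have h3 : 0 < b x x := by
    refine (h.nonneg_right x).lt_of_ne fun h0 => hx0 (h.eq_zero_of_le ?_)
    rw [← h0] at h2 ⊢
    linarith
  exact le_of_mul_le_mul_right (h1.trans h2) h3

/-- Use the span of `u 0, …, u k` as trial space for `b'`. There `D ≤ ev k * b`, so `b' ≥ (1 - δ (1
+ ev k)) b`. The product form of the conclusion avoids a case distinction: it is trivial when the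
factor is not positive. -/
lemma IsMinSystem.mul_le {b' : H →L[ℝ] H →L[ℝ] ℝ} {u u' : ℕ → H} {ev ev' : ℕ → ℝ}
    (h : IsSpectralPair D b) (h' : IsSpectralPair D b')
    (hm : IsMinSystem D b u ev) (hm' : IsMinSystem D b' u' ev') {δ : ℝ} (hδ : 0 ≤ δ)
    (hbb : ∀ x, b x x ≤ b' x x + δ * (D x x + b x x)) (k : ℕ) :
    ev' k * (1 - δ * (1 + ev k)) ≤ ev k := by
  rcases le_or_gt (1 - δ * (1 + ev k)) 0 with hθ | hθ
  · exact (mul_nonpos_of_nonneg_of_nonpos (hm'.nonneg h' k) hθ).trans (hm.nonneg h k)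
  rw [← le_div_iff₀ hθ]
  refine hm'.le_of_forall_mem_span h' (v := fun i => u i)
    (hm.linearIndependent.comp _ Fin.val_injective) fun c => ?_
  set x := ∑ i, c i • u (i : ℕ) with hx
  have hbx : b x x = ∑ i, c i ^ 2 := by
    rw [hx, form_sum_of_orthogonal b (v := fun i : Fin (k + 1) => u i)]
    · simp [hm.orthonormal]
    · intro i j hij
      rw [hm.orthonormal, if_neg (fun h => hij (Fin.ext h))]
  have hDx : D x x ≤ ev k * b x x := by
    rw [hbx, hx, form_sum_of_orthogonal D (v := fun i : Fin (k + 1) => u i), Finset.mul_sum]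
    · refine Finset.sum_le_sum fun i _ => ?_
      rw [hm.eigen_self, mul_comm]
      exact mul_le_mul_of_nonneg_right (hm.monotone (by omega)) (sq_nonneg _)
    · intro i j hij
      rw [hm.eigen, hm.orthonormal, if_neg (fun h => hij (Fin.ext h)), mul_zero]
  have h1 : (1 - δ * (1 + ev k)) * b x x ≤ b' x x := by
    have := hbb x
    nlinarith
  rw [div_mul_eq_mul_div, le_div_iff₀ hθ]
  have h2 : 0 ≤ ev k := hm.nonneg h k
  calc D x x * (1 - δ * (1 + ev k)) ≤ ev k * b x x * (1 - δ * (1 + ev k)) := by gcongr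
    _ = ev k * ((1 - δ * (1 + ev k)) * b x x) := by ring
    _ ≤ ev k * b' x x := by gcongr

/-- Lipschitz dependence of the eigenvalues on the parameter of a pencil of forms. -/
lemma lipschitz_formEigenvalue [CompleteSpace H] {p : H →L[ℝ] H →L[ℝ] ℝ}
    (hp : ∀ u, 0 ≤ p u u) (h : ∀ ε : ℝ, 0 ≤ ε → IsSpectralPair D (b + ε • p)) (k : ℕ) :
    ∃ C : ℝ, ∀ x, 0 ≤ x → ∀ y, 0 ≤ y →
      |formEigenvalue (fun u w => D u w) (fun u w => (b + x • p) u w) k -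
        formEigenvalue (fun u w => D u w) (fun u w => (b + y • p) u w) k| ≤ C * |x - y| := by
  have hb : IsSpectralPair D b := by
    have h0 : b + (0 : ℝ) • p = b := by ext; simp
    exact h0 ▸ h 0 le_rfl
  have hsys : ∀ ε : ℝ, ∃ u ev, 0 ≤ ε → IsMinSystem D (b + ε • p) u ev := by
    intro ε
    by_cases hε : 0 ≤ ε
    · obtain ⟨u, ev, hm⟩ := (h ε hε).exists_isMinSystem
      exact ⟨u, ev, fun _ => hm⟩
    · exact ⟨0, 0, fun h => absurd h hε⟩
  choose u ev hm using hsys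
  obtain ⟨c, hc, hco⟩ := hb.coercive
  have hpC : ∀ x, p x x ≤ ‖p‖ / c * (D x x + b x x) := by
    intro x
    calc p x x ≤ ‖p x x‖ := le_abs_self _
      _ ≤ ‖p‖ * ‖x‖ * ‖x‖ := p.le_opNorm₂ x x
      _ = ‖p‖ / c * (c * ‖x‖ ^ 2) := by field_simp
      _ ≤ _ := by gcongr; exact hco x
  set K := ‖p‖ / c with hK
  have hK0 : 0 ≤ K := by positivity
  set L := ev 0 k with hL
  have hle : ∀ x, 0 ≤ x → ev x k ≤ L := by
    intro x hx
    -- Taking `δ = 0` expresses monotonicity: enlarging `b` lowers the eigenvalues. So `L`, the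
    -- value at parameter 0, bounds them all and makes the Lipschitz constant uniform.
    have := (hm 0 le_rfl).mul_le (h 0 le_rfl) (h x hx) (hm x hx) (δ := 0) le_rfl (fun w => by
      have := mul_nonneg hx (hp w)
      simpa using this) k
    simpa using this
  have hL0 : 0 ≤ L := (hm 0 le_rfl).nonneg (h 0 le_rfl) k
  have hone : ∀ x, 0 ≤ x → ∀ y, 0 ≤ y → ev y k - ev x k ≤ K * L * (1 + L) * |x - y| := by
    intro x hx y hy
    -- The forms at `x` and `y` differ by at most `|x - y| p`, and `p ≤ K (D + b) ≤ K (D + b + x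
    -- p)`; hence this `δ`.
    have h1 := (hm x hx).mul_le (h x hx) (h y hy) (hm y hy) (δ := K * |x - y|)
      (by positivity) (fun w => by
        have h2 : (x - y) * p w w ≤ |x - y| * p w w :=
          mul_le_mul_of_nonneg_right (le_abs_self _) (hp w)
        have h3 : |x - y| * p w w ≤ |x - y| * (K * (D w w + b w w)) :=
          mul_le_mul_of_nonneg_left (hpC w) (abs_nonneg _)
        have h4 : 0 ≤ K * |x - y| * (x * p w w) := by
          have := hp w
          positivity
        simp only [add_apply, smul_apply, smul_eq_mul]
        nlinarith) k
    have hx1 := hle x hx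
    have hy1 := hle y hy
    have hx0 := (hm x hx).nonneg (h x hx) k
    have hy0 := (hm y hy).nonneg (h y hy) k
    have h5 : ev y k * (1 + ev x k) ≤ L * (1 + L) := by gcongr
    have h6 : 0 ≤ K * |x - y| := by positivity
    nlinarith [mul_le_mul_of_nonneg_left h5 h6]
  refine ⟨K * L * (1 + L), fun x hx y hy => ?_⟩
  rw [(hm x hx).formEigenvalue_eq (h x hx), (hm y hy).formEigenvalue_eq (h y hy), abs_sub_le_iff]
  refine ⟨?_, hone x hx y hy⟩
  rw [abs_sub_comm]
  exact hone y hy x hx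

lemma continuousOn_formEigenvalue [CompleteSpace H] {p : H →L[ℝ] H →L[ℝ] ℝ}
    (hp : ∀ u, 0 ≤ p u u) (h : ∀ ε : ℝ, 0 ≤ ε → IsSpectralPair D (b + ε • p)) (k : ℕ) :
    ContinuousOn (fun x : ℝ => formEigenvalue (fun u w => D u w)
      (fun u w => (b + x • p) u w) k) (Ici 0) := by
  obtain ⟨C, hC⟩ := lipschitz_formEigenvalue hp h k
  refine (LipschitzOnWith.of_dist_le_mul (K := C.toNNReal) fun x hx y hy => ?_).continuousOn
  rw [Real.dist_eq, Real.dist_eq]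
  exact (hC x hx y hy).trans (mul_le_mul_of_nonneg_right (Real.le_coe_toNNReal C) (abs_nonneg _))

open scoped Pointwise in
-- The sets whose infima define the two eigenvalues are dilates of each other by `a`.
lemma formEigenvalue_smul (D b : H → H → ℝ) {a : ℝ} (ha : 0 < a) (k : ℕ) :
    formEigenvalue D b k = a * formEigenvalue D (fun u w => a * b u w) k := by
  have hset : {s : ℝ | ∃ u : Fin (k + 1) → H, LinearIndependent ℝ u ∧
      ∀ i, ∃ t ≤ s, u i ≠ 0 ∧ ∀ w : H, D (u i) w = t * b (u i) w} =
      a • {s : ℝ | ∃ u : Fin (k + 1) → H, LinearIndependent ℝ u ∧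
      ∀ i, ∃ t ≤ s, u i ≠ 0 ∧ ∀ w : H, D (u i) w = t * (a * b (u i) w)} := by
    ext s
    rw [mem_smul_set_iff_inv_smul_mem₀ ha.ne']
    simp only [mem_ofPred_eq, smul_eq_mul]
    refine exists_congr fun u => and_congr_right fun _ => forall_congr' fun i => ?_
    constructor
    · rintro ⟨t, ht, h0, h⟩
      refine ⟨a⁻¹ * t, by gcongr, h0, fun w => ?_⟩
      rw [h w]
      field_simp
    · rintro ⟨t, ht, h0, h⟩
      refine ⟨a * t, ?_, h0, fun w => ?_⟩
      · rwa [← le_inv_mul_iff₀ ha]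
      · rw [h w]
        ring
  unfold formEigenvalue
  rw [hset, Real.sInf_smul_of_nonneg ha.le, smul_eq_mul]

end AbstractSpectrum

/-! ### Almost orthogonal matrices -/

section NearbyOrthogonal

/-- A family of square matrices with `Q Qᵀ → 1` is asymptotically inverted by orthogonal
matrices. -/
lemma exists_orthogonal_mul_tendsto_one {ι : Type*} {l : Filter ι} {m : ℕ}
    {Q : ι → Matrix (Fin m) (Fin m) ℝ}
    (hQ : Tendsto (fun i => Q i * (Q i).transpose) l (𝓝 1)) :
    ∃ M : ι → Matrix (Fin m) (Fin m) ℝ, (∀ i, M i ∈ Matrix.orthogonalGroup (Fin m) ℝ) ∧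
      Tendsto (fun i => M i * Q i) l (𝓝 1) := by
  -- A compact box: diagonal entries of `A Aᵀ` at most 4 force the entries of `A` into `[-2, 2]`. It
  -- contains the orthogonal group and, eventually, the matrices `Q i`.
  let B : Set (Matrix (Fin m) (Fin m) ℝ) := Set.pi univ fun _ => Set.pi univ fun _ => Icc (-2) 2
  have hB : IsCompact B := isCompact_univ_pi fun _ => isCompact_univ_pi fun _ => isCompact_Icc
  let O : Set (Matrix (Fin m) (Fin m) ℝ) := {A | A * A.transpose = 1}
  have hO : ∀ A, A ∈ O ↔ A ∈ Matrix.orthogonalGroup (Fin m) ℝ := fun A => by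
    rw [Matrix.mem_orthogonalGroup_iff]; rfl
  have hOc : IsClosed O :=
    isClosed_eq (continuous_id.matrix_mul continuous_id.matrix_transpose) continuous_const
  have hentry : ∀ A : Matrix (Fin m) (Fin m) ℝ, ∀ i j, A i j ^ 2 ≤ (A * A.transpose) i i := by
    intro A i j
    rw [Matrix.mul_apply]
    refine le_trans ?_ (Finset.single_le_sum
      (f := fun j => A i j * A.transpose j i) (fun j _ => ?_) (Finset.mem_univ j))
    · simp [sq]
    · simpa using mul_self_nonneg (A i j)
  have hmemB : ∀ A : Matrix (Fin m) (Fin m) ℝ, (∀ i, (A * A.transpose) i i ≤ 4) → A ∈ B := by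
    intro A hA i _ j _
    have := (hentry A i j).trans (hA i)
    exact abs_le.1 (abs_le_of_sq_le_sq (by norm_num; linarith) (by norm_num))
  have hOB : O ⊆ B := fun A hA => hmemB A fun i => by
    rw [show A * A.transpose = 1 from hA]; simp
  have hOk : IsCompact O := hB.of_isClosed_subset hOc hOB
  let g : Matrix (Fin m) (Fin m) ℝ → ℝ := fun A => ∑ i, ∑ j, (A i j - (1 : Matrix _ _ ℝ) i j) ^ 2
  have hg : Continuous g := by
    refine continuous_finsetSum _ fun i _ => continuous_finsetSum _ fun j _ => ?_
    exact ((continuous_id.matrix_elem i j).sub continuous_const).pow 2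
  have hgn : ∀ A, 0 ≤ g A := fun A =>
    Finset.sum_nonneg fun i _ => Finset.sum_nonneg fun j _ => sq_nonneg _
  have hone : (1 : Matrix (Fin m) (Fin m) ℝ) ∈ O := by simp [O]
  -- `M i` is a best orthogonal approximate inverse of `Q i`. By minimality it suffices to exhibit a
  -- good competitor along each ultrafilter.
  have hmin : ∀ i, ∃ A ∈ O, IsMinOn (fun A => g (A * Q i)) O A := fun i =>
    hOk.exists_isMinOn ⟨1, hone⟩
      (hg.comp (continuous_id.matrix_mul continuous_const)).continuousOn
  choose M hMO hM using hmin
  have hgM : Tendsto (fun i => g (M i * Q i)) l (𝓝 0) := by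
    -- Along an ultrafilter `Q` converges in the box to some orthogonal `Q₀`, and the constant
    -- competitor `Q₀ᵀ` drives the error to zero.
    rw [tendsto_iff_ultrafilter]
    intro G hG
    have hQG := hQ.mono_left hG
    have hev : ∀ᶠ i in (G : Filter ι), Q i ∈ B := by
      have : ∀ᶠ i in (G : Filter ι), ∀ a : Fin m, (Q i * (Q i).transpose) a a < 4 := by
        refine eventually_all.2 fun a => ?_
        have h1 := ((continuous_id.matrix_elem a a).tendsto (1 : Matrix (Fin m) (Fin m) ℝ)).comp hQG
        refine h1.eventually_lt_const ?_
        simp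
      filter_upwards [this] with i hi
      exact hmemB _ fun a => (hi a).le
    obtain ⟨Q₀, -, hQ₀⟩ := hB.ultrafilter_le_nhds (G.map Q) (le_principal_iff.2 hev)
    have hT : Tendsto Q (G : Filter ι) (𝓝 Q₀) := hQ₀
    have h1 : Q₀ * Q₀.transpose = 1 := by
      refine tendsto_nhds_unique ?_ hQG
      exact (((continuous_id.matrix_mul continuous_id.matrix_transpose)).tendsto Q₀).comp hT
    have h2 : Q₀.transpose * Q₀ = 1 := mul_eq_one_comm.1 h1
    have h3 : Q₀.transpose ∈ O := by simpa [O] using h2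
    have h4 : Tendsto (fun i => g (Q₀.transpose * Q i)) (G : Filter ι) (𝓝 0) := by
      have h5 : g (Q₀.transpose * Q₀) = 0 := by rw [h2]; simp [g]
      rw [← h5]
      exact ((hg.comp (continuous_const.matrix_mul continuous_id)).tendsto Q₀).comp hT
    exact squeeze_zero (fun i => hgn _) (fun i => hM i h3) h4
  refine ⟨M, fun i => (hO _).1 (hMO i), ?_⟩
  refine tendsto_pi_nhds.2 fun a => tendsto_pi_nhds.2 fun c => ?_
  have h1 : Tendsto (fun i => ((M i * Q i) a c - (1 : Matrix _ _ ℝ) a c) ^ 2) l (𝓝 0) := by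
    refine squeeze_zero (fun i => sq_nonneg _) (fun i => ?_) hgM
    refine le_trans ?_ (Finset.single_le_sum (f := fun a => ∑ c,
      ((M i * Q i) a c - (1 : Matrix _ _ ℝ) a c) ^ 2)
      (fun a _ => Finset.sum_nonneg fun c _ => sq_nonneg _) (Finset.mem_univ a))
    exact Finset.single_le_sum (f := fun c => ((M i * Q i) a c - (1 : Matrix _ _ ℝ) a c) ^ 2)
      (fun c _ => sq_nonneg _) (Finset.mem_univ c)
  have h2 : Tendsto (fun i => |(M i * Q i) a c - (1 : Matrix _ _ ℝ) a c|) l (𝓝 0) := by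
    have := (Real.continuous_sqrt.tendsto 0).comp h1
    simpa [Function.comp_def, Real.sqrt_sq_eq_abs] using this
  have h3 := (tendsto_zero_iff_abs_tendsto_zero _).2 h2
  simpa using h3.add_const ((1 : Matrix (Fin m) (Fin m) ℝ) a c)

lemma abs_apply_le_one_of_mem_orthogonalGroup {m : ℕ} {A : Matrix (Fin m) (Fin m) ℝ}
    (hA : A ∈ Matrix.orthogonalGroup (Fin m) ℝ) (i j : Fin m) : |A i j| ≤ 1 :=
  entry_norm_bound_of_unitary hA i j

end NearbyOrthogonal

/-! ### Convergence of eigenvectors under a small perturbation -/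

section EigenvectorConvergence

variable {H : Type*} [NormedAddCommGroup H] [NormedSpace ℝ H]

/-- A `b`-orthonormal sequence of eigenvectors for the eigenvalues counted with multiplicity. -/
structure IsEigenSystem (D b : H →L[ℝ] H →L[ℝ] ℝ) (u : ℕ → H) : Prop where
  orthonormal : ∀ i j, b (u i) (u j) = if i = j then 1 else 0
  eigen : ∀ k w, D (u k) w =
    formEigenvalue (fun x y => D x y) (fun x y => b x y) k * b (u k) w

variable {D b : H →L[ℝ] H →L[ℝ] ℝ}

lemma IsEigenSystem.linearIndependent {u : ℕ → H} (hu : IsEigenSystem D b u) :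
    LinearIndependent ℝ u := by
  rw [linearIndependent_iff']
  intro s g hg i hi
  have := congrArg (b (u i)) hg
  simpa [hu.orthonormal, hi] using this

/-- At a gap of the spectrum the Rayleigh quotient is bounded below on the orthogonal complement
of any choice of lower eigenvectors. -/
lemma IsEigenSystem.mul_le_of_orthogonal [CompleteSpace H] (h : IsSpectralPair D b) {f : ℕ → H}
    (hf : IsEigenSystem D b f) {K : ℕ}
    (hgap : ∀ j < K, formEigenvalue (fun x y => D x y) (fun x y => b x y) j <
      formEigenvalue (fun x y => D x y) (fun x y => b x y) K)
    {r : H} (hr : ∀ j < K, b (f j) r = 0) :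
    formEigenvalue (fun x y => D x y) (fun x y => b x y) K * b r r ≤ D r r := by
  obtain ⟨u, ev, hm⟩ := h.exists_isMinSystem
  rw [hm.formEigenvalue_eq h]
  refine hm.min K r fun j hj => ?_
  have hfin : FiniteDimensional ℝ (Submodule.span ℝ (u '' Iio K)) :=
    FiniteDimensional.span_of_finite ℝ ((finite_Iio K).image u)
  -- The strict gap puts each `f i`, `i < K`, in the span of the first `K` minimisers, and
  -- dimensions agree. So orthogonality to the `f i` is orthogonality to the minimisers, for which
  -- the bound holds.
  have hle : Submodule.span ℝ (range fun i : Fin K => f i) ≤ Submodule.span ℝ (u '' Iio K) := by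
    refine Submodule.span_le.2 (range_subset_iff.2 fun i => ?_)
    refine hm.mem_span h (hf.eigen i) ?_
    have := hgap i i.2
    rwa [hm.formEigenvalue_eq h K] at this
  have heq := Submodule.eq_of_le_of_finrank_le hle (by
    rw [finrank_span_eq_card (b := fun i : Fin K => f i)
      (hf.linearIndependent.comp _ Fin.val_injective), Fintype.card_fin]
    exact finrank_span_image_Iio u K)
  have hmem : u j ∈ Submodule.span ℝ (range fun i : Fin K => f i) := by
    rw [heq]
    exact Submodule.subset_span ⟨j, hj, rfl⟩
  have hsub : Submodule.span ℝ (range fun i : Fin K => f i) ≤ formOrthogonal b {r} := by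
    refine Submodule.span_le.2 (range_subset_iff.2 fun i => ?_)
    intro v hv
    rw [mem_singleton_iff.1 hv, h.symm_right]
    exact hr i i.2
  rw [h.symm_right]
  exact hsub hmem r rfl

variable {s : H →L[ℝ] H →L[ℝ] ℝ} {ι : Type*} {l : Filter ι} {v : ι → H} {ev ε : ι → ℝ} {μ : ℝ}

/-- The normalisation gives `D (v i) (v i) = ev i` and `b (v i) (v i) ≤ 1`, so coercivity bounds `‖v
i‖`. The scaling by `√ε` is convenient because `ε s(v, w) = s(√ε v, √ε w)`, to which continuity of
`s` applies. -/
lemma sqrt_smul_eigenvector_tendsto_zero (h : IsSpectralPair D b) (hs : ∀ x, 0 ≤ s x x)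
    (hε : Tendsto ε l (𝓝 0)) (hε0 : ∀ᶠ i in l, 0 ≤ ε i) (hev : Tendsto ev l (𝓝 μ))
    (hv : ∀ᶠ i in l, ∀ w, D (v i) w = ev i * (b (v i) w + ε i * s (v i) w))
    (hv1 : ∀ᶠ i in l, b (v i) (v i) + ε i * s (v i) (v i) = 1) :
    Tendsto (fun i => Real.sqrt (ε i) • v i) l (𝓝 0) := by
  obtain ⟨c, hc, hco⟩ := h.coercive
  have hbd : ∀ᶠ i in l, ‖Real.sqrt (ε i) • v i‖ ≤ Real.sqrt (ε i) * Real.sqrt ((μ + 2) / c) := by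
    filter_upwards [hε0, hv, hv1, hev.eventually_lt_const (lt_add_one μ)] with i h0 h1 h2 h3
    rw [norm_smul, Real.norm_of_nonneg (Real.sqrt_nonneg _)]
    refine mul_le_mul_of_nonneg_left (Real.le_sqrt_of_sq_le ?_) (Real.sqrt_nonneg _)
    rw [le_div_iff₀ hc]
    have h4 := hco (v i)
    rw [h1, h2, mul_one] at h4
    have := mul_nonneg h0 (hs (v i))
    linarith
  refine squeeze_zero_norm' hbd ?_
  have := ((Real.continuous_sqrt.tendsto 0).comp hε).mul_const (Real.sqrt ((μ + 2) / c))
  simpa using this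

lemma form_sqrt_smul (q : H →L[ℝ] H →L[ℝ] ℝ) {t : ℝ} (ht : 0 ≤ t) (x y : H) :
    q (Real.sqrt t • x) (Real.sqrt t • y) = t * q x y := by
  simp only [map_smul, smul_apply, smul_eq_mul]
  rw [← mul_assoc, Real.mul_self_sqrt ht]

/-- Test the equation of `v i` with `g` and that of `g` with `v i`: the difference is `(ν - ev i)
b(g, v i) = ev i * s(√ε v i, √ε g)`. The right side tends to zero while `ν - ev i` stays away from
zero. -/
lemma coefficient_tendsto_zero (h : IsSpectralPair D b) (hs : ∀ x, 0 ≤ s x x)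
    (hε : Tendsto ε l (𝓝 0)) (hε0 : ∀ᶠ i in l, 0 ≤ ε i) (hev : Tendsto ev l (𝓝 μ))
    (hv : ∀ᶠ i in l, ∀ w, D (v i) w = ev i * (b (v i) w + ε i * s (v i) w))
    (hv1 : ∀ᶠ i in l, b (v i) (v i) + ε i * s (v i) (v i) = 1)
    {g : H} {ν : ℝ} (hg : ∀ w, D g w = ν * b g w) (hν : ν ≠ μ) :
    Tendsto (fun i => b g (v i)) l (𝓝 0) := by
  have hx := sqrt_smul_eigenvector_tendsto_zero h hs hε hε0 hev hv hv1
  have hgx : Tendsto (fun i => Real.sqrt (ε i) • g) l (𝓝 0) := by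
    have := ((Real.continuous_sqrt.tendsto 0).comp hε).smul_const g
    simpa using this
  have h1 : Tendsto (fun i => ev i * s (Real.sqrt (ε i) • v i) (Real.sqrt (ε i) • g)) l (𝓝 0) := by
    have h2 := ((continuous_form s continuous_fst continuous_snd).tendsto ((0 : H), (0 : H))).comp
      (hx.prodMk_nhds hgx)
    have := hev.mul h2
    simpa [Function.comp_def] using this
  have hd : Tendsto (fun i => ν - ev i) l (𝓝 (ν - μ)) := tendsto_const_nhds.sub hev
  have h3 := h1.div hd (sub_ne_zero.2 hν)
  rw [zero_div] at h3
  refine h3.congr' ?_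
  filter_upwards [hε0, hv, hd.eventually_ne (sub_ne_zero.2 hν)] with i h0 h4 h5
  simp only [Pi.div_apply]
  rw [div_eq_iff h5, form_sqrt_smul _ h0]
  have h6 := h4 g
  rw [h.symm_left, hg, h.symm_right (v i) g] at h6
  linarith

/-- Let `P` remove the components on `f 0, …, f (K - 1)`. Testing the equation with `P v` gives
`D(Pv, Pv) = ev b(Pv, Pv) + o(1)`, while `D(Pv, Pv) ≥ κ b(Pv, Pv)` with `κ > μ`. So `b(Pv, Pv) → 0`,
then `D(Pv, Pv) → 0`, and coercivity gives convergence in norm. -/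
lemma remainder_tendsto_zero (h : IsSpectralPair D b) (hs : ∀ x, 0 ≤ s x x)
    (hε : Tendsto ε l (𝓝 0)) (hε0 : ∀ᶠ i in l, 0 ≤ ε i) (hev : Tendsto ev l (𝓝 μ))
    (hv : ∀ᶠ i in l, ∀ w, D (v i) w = ev i * (b (v i) w + ε i * s (v i) w))
    (hv1 : ∀ᶠ i in l, b (v i) (v i) + ε i * s (v i) (v i) = 1)
    {f : ℕ → H} (hf : ∀ i j, b (f i) (f j) = if i = j then 1 else 0) {ν : ℕ → ℝ}
    (hfe : ∀ k w, D (f k) w = ν k * b (f k) w) {K : ℕ} {κ : ℝ} (hκ : μ < κ)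
    (hmin : ∀ r, (∀ j < K, b (f j) r = 0) → κ * b r r ≤ D r r) :
    Tendsto (fun i => v i - ∑ j ∈ Finset.range K, b (f j) (v i) • f j) l (𝓝 0) := by
  have hx := sqrt_smul_eigenvector_tendsto_zero h hs hε hε0 hev hv hv1
  let P : H → H := fun x => x - ∑ j ∈ Finset.range K, b (f j) x • f j
  have hP : Continuous P := continuous_id.sub
    (continuous_finsetSum _ fun j _ => ((b (f j)).continuous).smul continuous_const)
  have hP0 : P 0 = 0 := by simp [P]
  have hPo : ∀ x, ∀ j < K, b (f j) (P x) = 0 := by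
    intro x j hj
    simp only [P]
    rw [map_sub, map_sum, Finset.sum_eq_single j]
    · simp [hf]
    · intro i _ hij
      simp [hf, hij.symm]
    · simp [hj]
  have hPs : ∀ (c : ℝ) x, P (c • x) = c • P x := by
    intro c x
    simp only [P, map_smul, smul_sub, Finset.smul_sum, smul_eq_mul, mul_smul]
  change Tendsto (fun i => P (v i)) l (𝓝 0)
  have hsx : Tendsto (fun i => s (Real.sqrt (ε i) • v i) (P (Real.sqrt (ε i) • v i))) l (𝓝 0) := by
    have := ((continuous_form s continuous_id hP).tendsto (0 : H)).comp hx
    simpa [Function.comp_def] using this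
  have hrel : ∀ᶠ i in l, D (P (v i)) (P (v i)) = ev i * b (P (v i)) (P (v i)) +
      ev i * s (Real.sqrt (ε i) • v i) (P (Real.sqrt (ε i) • v i)) := by
    filter_upwards [hε0, hv] with i h0 h1
    rw [hPs, form_sqrt_smul _ h0]
    have h2 : ∀ q : H →L[ℝ] H →L[ℝ] ℝ, ∀ y, q (P (v i)) y = q (v i) y -
        ∑ j ∈ Finset.range K, b (f j) (v i) * q (f j) y := by
      intro q y
      simp [P]
    have h3 : ∑ j ∈ Finset.range K, b (f j) (v i) * D (f j) (P (v i)) = 0 :=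
      Finset.sum_eq_zero fun j hj => by
        rw [hfe, hPo _ _ (Finset.mem_range.1 hj)]; simp
    have h4 : ∑ j ∈ Finset.range K, b (f j) (v i) * b (f j) (P (v i)) = 0 :=
      Finset.sum_eq_zero fun j hj => by
        rw [hPo _ _ (Finset.mem_range.1 hj)]; simp
    rw [h2 D, h2 b, h3, h4, h1]
    ring
  have hbP : Tendsto (fun i => b (P (v i)) (P (v i))) l (𝓝 0) := by
    have h1 : Tendsto (fun i => κ - ev i) l (𝓝 (κ - μ)) := tendsto_const_nhds.sub hev
    have h2 : Tendsto (fun i => ev i * s (Real.sqrt (ε i) • v i) (P (Real.sqrt (ε i) • v i)) /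
        (κ - ev i)) l (𝓝 0) := by
      have := (hev.mul hsx).div h1 (sub_pos.2 hκ).ne'
      rwa [mul_zero, zero_div] at this
    refine squeeze_zero' (Eventually.of_forall fun i => h.nonneg_right _) ?_ h2
    filter_upwards [hrel, h1.eventually_const_lt (sub_pos.2 hκ)] with i h3 h4
    rw [le_div_iff₀ h4]
    have := hmin _ (hPo (v i))
    linarith
  have hsum : Tendsto (fun i => D (P (v i)) (P (v i)) + b (P (v i)) (P (v i))) l (𝓝 0) := by
    have := ((hev.mul hbP).add (hev.mul hsx)).add hbP
    simp only [mul_zero, add_zero] at this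
    refine this.congr' ?_
    filter_upwards [hrel] with i h1
    rw [h1]
  obtain ⟨c, hc, hco⟩ := h.coercive
  rw [tendsto_zero_iff_norm_tendsto_zero]
  have hsq : Tendsto (fun i => ‖P (v i)‖ ^ 2) l (𝓝 0) := by
    refine squeeze_zero (fun i => sq_nonneg _) (fun i => ?_) (by simpa using hsum.div_const c)
    rw [le_div_iff₀ hc, mul_comm]
    exact hco _
  have := (Real.continuous_sqrt.tendsto 0).comp hsq
  simpa [Function.comp_def, Real.sqrt_sq] using this

/-- Convergence of the eigenvectors of a pencil of forms, up to orthogonal matrices. -/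
theorem exists_orthogonal_tendsto_eigenvectors [CompleteSpace H] (h : IsSpectralPair D b)
    (hs : ∀ x, 0 ≤ s x x) (hε : Tendsto ε l (𝓝 0)) (hε0 : ∀ᶠ i in l, 0 ≤ ε i)
    {f : ℕ → H} (hf : IsEigenSystem D b f) {V : ι → ℕ → H}
    (hV : ∀ᶠ i in l, IsEigenSystem D (b + ε i • s) (V i))
    (hev : ∀ j, Tendsto (fun i => formEigenvalue (fun x y => D x y)
      (fun x y => (b + ε i • s) x y) j) l (𝓝 (formEigenvalue (fun x y => D x y)
      (fun x y => b x y) j)))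
    {k m : ℕ}
    (hlt : ∀ j < k, formEigenvalue (fun x y => D x y) (fun x y => b x y) j <
      formEigenvalue (fun x y => D x y) (fun x y => b x y) k)
    (heq : ∀ i < m, formEigenvalue (fun x y => D x y) (fun x y => b x y) (k + i) =
      formEigenvalue (fun x y => D x y) (fun x y => b x y) k)
    (hgt : formEigenvalue (fun x y => D x y) (fun x y => b x y) k <
      formEigenvalue (fun x y => D x y) (fun x y => b x y) (k + m)) :
    ∃ M : ι → Matrix (Fin m) (Fin m) ℝ, (∀ i, M i ∈ Matrix.orthogonalGroup (Fin m) ℝ) ∧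
      ∀ a : Fin m, Tendsto (fun i => ∑ j : Fin m, M i a j • V i (k + j)) l (𝓝 (f (k + a))) := by
  set μ : ℕ → ℝ := formEigenvalue (fun x y => D x y) (fun x y => b x y) with hμ
  have hgap : ∀ j < k + m, μ j < μ (k + m) := by
    intro j hj
    rcases lt_or_ge j k with hjk | hjk
    · exact (hlt j hjk).trans hgt
    · obtain ⟨i, rfl⟩ := Nat.exists_eq_add_of_le hjk
      rw [heq i (by omega)]
      exact hgt
  have hmin : ∀ r, (∀ j < k + m, b (f j) r = 0) → μ (k + m) * b r r ≤ D r r :=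
    fun r hr => hf.mul_le_of_orthogonal h hgap hr
  have hvj : ∀ j, ∀ᶠ i in l, ∀ w, D (V i j) w = formEigenvalue (fun x y => D x y)
      (fun x y => (b + ε i • s) x y) j * (b (V i j) w + ε i * s (V i j) w) := by
    intro j
    filter_upwards [hV] with i hi w
    simpa using hi.eigen j w
  have hon : ∀ᶠ i in l, ∀ j j', b (V i j) (V i j') + ε i * s (V i j) (V i j') =
      if j = j' then 1 else 0 := by
    filter_upwards [hV] with i hi j j'
    simpa using hi.orthonormal j j'
  have hv1 : ∀ j, ∀ᶠ i in l, b (V i j) (V i j) + ε i * s (V i j) (V i j) = 1 := by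
    intro j
    filter_upwards [hon] with i hi
    simpa using hi j j
  have hevm : ∀ j : Fin m, Tendsto (fun i => formEigenvalue (fun x y => D x y)
      (fun x y => (b + ε i • s) x y) (k + j)) l (𝓝 (μ k)) := by
    intro j
    rw [← heq j j.2]
    exact hev _
  have hx : ∀ j : Fin m, Tendsto (fun i => Real.sqrt (ε i) • V i (k + j)) l (𝓝 0) := fun j =>
    sqrt_smul_eigenvector_tendsto_zero h hs hε hε0 (hevm j) (hvj _) (hv1 _)
  have hcoef : ∀ j : Fin m, ∀ a < k, Tendsto (fun i => b (f a) (V i (k + j))) l (𝓝 0) :=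
    fun j a ha => coefficient_tendsto_zero h hs hε hε0 (hevm j) (hvj _) (hv1 _) (hf.eigen a)
      (hlt a ha).ne
  have hrem : ∀ j : Fin m, Tendsto (fun i => V i (k + j) -
      ∑ a ∈ Finset.range (k + m), b (f a) (V i (k + j)) • f a) l (𝓝 0) :=
    fun j => remainder_tendsto_zero h hs hε hε0 (hevm j) (hvj _) (hv1 _) hf.orthonormal hf.eigen
      hgt hmin
  -- `Q` holds the coefficients on the target block `f k, …, f (k + m - 1)`; `R` is everything else,
  -- which tends to zero by the two preceding lemmas.
  let Q : ι → Matrix (Fin m) (Fin m) ℝ := fun i => Matrix.of fun j a => b (f (k + a)) (V i (k + j))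
  let R : ι → Fin m → H := fun i j => V i (k + j) - ∑ a : Fin m, Q i j a • f (k + a)
  have hR : ∀ j, Tendsto (fun i => R i j) l (𝓝 0) := by
    intro j
    have h1 : Tendsto (fun i => ∑ a ∈ Finset.range k, b (f a) (V i (k + j)) • f a) l (𝓝 0) := by
      have : Tendsto (fun i => ∑ a ∈ Finset.range k, b (f a) (V i (k + j)) • f a) l
          (𝓝 (∑ a ∈ Finset.range k, (0 : ℝ) • f a)) :=
        tendsto_finsetSum _ fun a ha =>
          (hcoef j a (Finset.mem_range.1 ha)).smul_const _
      simpa using this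
    have h2 := (hrem j).add h1
    rw [add_zero] at h2
    refine h2.congr fun i => ?_
    rw [Finset.sum_range_add]
    simp only [R, Q, Matrix.of_apply, ← Fin.sum_univ_eq_sum_range
      (fun a => b (f (k + a)) (V i (k + j)) • f (k + a)) m]
    abel
  have hfk : ∀ a a' : Fin m, b (f (k + a)) (f (k + a')) = if a = a' then 1 else 0 := by
    intro a a'
    rw [hf.orthonormal]
    simp [Fin.ext_iff]
  have hfR : ∀ i (j a : Fin m), b (f (k + a)) (R i j) = 0 := by
    intro i j a
    simp [R, Q, hfk]
  -- The normalisation of the `V i` reads `Q Qᵀ = 1 - ε s(V, V) - b(R, R)`, and both corrections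
  -- tend to zero.
  have hQQ : Tendsto (fun i => Q i * (Q i).transpose) l (𝓝 1) := by
    refine tendsto_pi_nhds.2 fun j => tendsto_pi_nhds.2 fun j' => ?_
    have h1 : Tendsto (fun i => b (R i j) (R i j')) l (𝓝 0) := by
      have := ((continuous_form b continuous_fst continuous_snd).tendsto ((0 : H), (0 : H))).comp
        ((hR j).prodMk_nhds (hR j'))
      simpa [Function.comp_def] using this
    have h2 : Tendsto (fun i => s (Real.sqrt (ε i) • V i (k + j))
        (Real.sqrt (ε i) • V i (k + j'))) l (𝓝 0) := by
      have := ((continuous_form s continuous_fst continuous_snd).tendsto ((0 : H), (0 : H))).comp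
        ((hx j).prodMk_nhds (hx j'))
      simpa [Function.comp_def] using this
    have h3 : Tendsto (fun i => (1 : Matrix (Fin m) (Fin m) ℝ) j j' -
        s (Real.sqrt (ε i) • V i (k + j))
        (Real.sqrt (ε i) • V i (k + j')) - b (R i j) (R i j')) l
        (𝓝 ((1 : Matrix (Fin m) (Fin m) ℝ) j j')) := by
      have := (tendsto_const_nhds (x := (1 : Matrix (Fin m) (Fin m) ℝ) j j')).sub h2 |>.sub h1
      simpa using this
    refine h3.congr' ?_
    filter_upwards [hε0, hon] with i h0 h4
    rw [form_sqrt_smul _ h0]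
    have h5 := h4 (k + j) (k + j')
    have h6 : b (V i (k + j)) (V i (k + j')) =
        b (R i j) (R i j') + (Q i * (Q i).transpose) j j' := by
      have hV1 : ∀ j : Fin m, V i (k + j) = R i j + ∑ a : Fin m, Q i j a • f (k + a) := by
        intro j; simp [R]
      have h7 : ∀ a : Fin m, b (R i j) (f (k + a)) = 0 := fun a => by
        rw [h.symm_right, hfR]
      rw [hV1 j, hV1 j']
      simp only [map_add, map_sum, map_smul, add_apply, sum_apply, smul_apply, smul_eq_mul, hfR,
        h7, hfk, Matrix.mul_apply, Matrix.transpose_apply]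
      simp [mul_comm]
    have h8 : (1 : Matrix (Fin m) (Fin m) ℝ) j j' = if k + (j : ℕ) = k + j' then 1 else 0 := by
      simp [Matrix.one_apply, Fin.ext_iff]
    rw [h8, ← h5, h6]
    ring
  obtain ⟨M, hM, hMQ⟩ := exists_orthogonal_mul_tendsto_one hQQ
  refine ⟨M, hM, fun a => ?_⟩
  -- Entries of orthogonal matrices are bounded by 1, so `M` does not spoil the convergence of `R`.
  have h1 : Tendsto (fun i => ∑ j : Fin m, M i a j • R i j) l (𝓝 0) := by
    have : Tendsto (fun i => ∑ j : Fin m, M i a j • R i j) l (𝓝 (∑ j : Fin m, (0 : H))) := by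
      refine tendsto_finsetSum _ fun j _ => ?_
      refine squeeze_zero_norm (fun i => ?_) (tendsto_zero_iff_norm_tendsto_zero.1 (hR j))
      rw [norm_smul]
      exact mul_le_of_le_one_left (norm_nonneg _)
        (abs_apply_le_one_of_mem_orthogonalGroup (hM i) a j)
    simpa using this
  have h2 : Tendsto (fun i => ∑ c : Fin m, (M i * Q i) a c • f (k + c)) l (𝓝 (f (k + a))) := by
    have h3 : Tendsto (fun i => ∑ c : Fin m, (M i * Q i) a c • f (k + c)) l
        (𝓝 (∑ c : Fin m, (1 : Matrix (Fin m) (Fin m) ℝ) a c • f (k + c))) :=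
      tendsto_finsetSum _ fun c _ =>
        ((tendsto_pi_nhds.1 (tendsto_pi_nhds.1 hMQ a) c)).smul_const _
    have h4 : ∑ c : Fin m, (1 : Matrix (Fin m) (Fin m) ℝ) a c • f (k + (c : ℕ)) = f (k + a) := by
      simp [Matrix.one_apply]
    rwa [h4] at h3
  have h5 := h1.add h2
  rw [zero_add] at h5
  refine h5.congr fun i => ?_
  simp only [Matrix.mul_apply, Finset.sum_smul]
  rw [Finset.sum_comm, ← Finset.sum_add_distrib]
  refine Finset.sum_congr rfl fun j _ => ?_
  simp only [mul_smul, ← Finset.smul_sum, ← smul_add]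
  simp [R]

end EigenvectorConvergence

/-! ### The Sobolev space: completeness, smooth elements, cutoffs -/

section SobolevBasics

variable {d : ℕ} {Ω : Set (E d)}

lemma inner_gradient_left {φ : E d → ℝ} (x v : E d) : ⟪gradient φ x, v⟫_ℝ = fderiv ℝ φ x v := by
  rw [← toDual_gradient (𝕜 := ℝ) (f := φ) (x := x), InnerProductSpace.toDual_apply_apply]

lemma ContDiff.continuous_gradient {φ : E d → ℝ} (hφ : ContDiff ℝ ∞ φ) :
    Continuous (gradient φ) :=
  (InnerProductSpace.toDual ℝ (E d)).symm.continuous.comp (hφ.continuous_fderiv (by simp))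

lemma norm_gradient (φ : E d → ℝ) (x : E d) : ‖gradient φ x‖ = ‖fderiv ℝ φ x‖ := by
  rw [← toDual_gradient (𝕜 := ℝ) (f := φ) (x := x), LinearIsometryEquiv.norm_map]

lemma memLp_fderiv_apply {φ : E d → ℝ} (h : ContDiff ℝ ∞ φ) (hc : HasCompactSupport φ) (v : E d) :
    MemLp (fun x => fderiv ℝ φ x v) 2 (volume.restrict Ω) :=
  (((h.continuous_fderiv (by simp)).clm_apply continuous_const).memLp_of_hasCompactSupport
    (hc.fderiv_apply ℝ v)).restrict Ω

lemma memLp_smul_const {φ : E d → ℝ} (h : ContDiff ℝ ∞ φ) (hc : HasCompactSupport φ) (v : E d) :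
    MemLp (fun x => φ x • v) 2 (volume.restrict Ω) :=
  ((h.continuous.smul continuous_const).memLp_of_hasCompactSupport hc.smul_right).restrict Ω

/-- Written as inner products with fixed `L²` elements, the condition is visibly closed; this makes
`H¹(Ω)` complete. -/
lemma isWeakGradient_iff_inner (p : L2Pair Ω) : IsWeakGradient Ω p.fst p.snd ↔
    ∀ φ : E d → ℝ, ∀ h : ContDiff ℝ ∞ φ, ∀ hc : HasCompactSupport φ, tsupport φ ⊆ Ω → ∀ v : E d,
    ⟪p.fst, (memLp_fderiv_apply (Ω := Ω) h hc v).toLp⟫_ℝ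
      = -⟪p.snd, (memLp_smul_const (Ω := Ω) h hc v).toLp⟫_ℝ := by
  refine forall_congr' fun φ => forall_congr' fun h => forall_congr' fun hc =>
    forall_congr' fun hs => forall_congr' fun v => ?_
  rw [L2.inner_def, L2.inner_def]
  have h1 : ∫ x, ⟪p.fst x, (memLp_fderiv_apply (Ω := Ω) h hc v).toLp _ x⟫_ℝ ∂(volume.restrict Ω)
      = ∫ x in Ω, p.fst x * fderiv ℝ φ x v := by
    refine integral_congr_ae ?_
    filter_upwards [(memLp_fderiv_apply (Ω := Ω) h hc v).coeFn_toLp] with x hx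
    rw [hx]
    simp [mul_comm]
  have h2 : ∫ x, ⟪p.snd x, (memLp_smul_const (Ω := Ω) h hc v).toLp _ x⟫_ℝ ∂(volume.restrict Ω)
      = ∫ x in Ω, ⟪p.snd x, v⟫_ℝ * φ x := by
    refine integral_congr_ae ?_
    filter_upwards [(memLp_smul_const (Ω := Ω) h hc v).coeFn_toLp] with x hx
    rw [hx, inner_smul_right, mul_comm]
  rw [h1, h2]

lemma isClosed_H1 (Ω : Set (E d)) : IsClosed (H1 Ω : Set (L2Pair Ω)) := by
  have hset : (H1 Ω : Set (L2Pair Ω)) = {p | IsWeakGradient Ω p.fst p.snd} := rfl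
  simp only [hset, isWeakGradient_iff_inner, ofPred_forall]
  refine isClosed_iInter fun φ => isClosed_iInter fun h => isClosed_iInter fun hc =>
    isClosed_iInter fun _ => isClosed_iInter fun v => isClosed_eq ?_ ?_
  · exact (WithLp.fstL 2 ℝ _ _).continuous.inner continuous_const
  · exact ((WithLp.sndL 2 ℝ _ _).continuous.inner continuous_const).neg

instance : CompleteSpace (H1 Ω) := (isClosed_H1 Ω).completeSpace_coe

/-- The inclusion `H¹(Ω) → L²(Ω)`. -/
noncomputable def valL (Ω : Set (E d)) : H1 Ω →L[ℝ] Lp ℝ 2 (volume.restrict Ω) :=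
  (WithLp.fstL 2 ℝ _ _).comp (H1 Ω).subtypeL

/-- The weak gradient as a bounded operator. -/
noncomputable def gradL (Ω : Set (E d)) : H1 Ω →L[ℝ] Lp (E d) 2 (volume.restrict Ω) :=
  (WithLp.sndL 2 ℝ _ _).comp (H1 Ω).subtypeL

lemma valL_apply (u : H1 Ω) : valL Ω u = H1.val u := rfl

lemma gradL_apply (u : H1 Ω) : gradL Ω u = H1.grad u := rfl

lemma H1.norm_sq (u : H1 Ω) : ‖u‖ ^ 2 = ‖H1.val u‖ ^ 2 + ‖H1.grad u‖ ^ 2 :=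
  WithLp.prod_norm_sq_eq_of_L2 (u : L2Pair Ω)

lemma H1.ext {u w : H1 Ω} (hv : H1.val u = H1.val w) (hg : H1.grad u = H1.grad w) : u = w := by
  have h : u - w = 0 := by
    have h1 := H1.norm_sq (u - w)
    rw [← valL_apply, ← gradL_apply, map_sub, map_sub, valL_apply, valL_apply, gradL_apply,
      gradL_apply, hv, hg, sub_self, sub_self, norm_zero, norm_zero] at h1
    rw [zero_pow two_ne_zero, add_zero] at h1
    exact norm_eq_zero.1 ((pow_eq_zero_iff two_ne_zero).1 h1)
  exact sub_eq_zero.1 h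

/-- The form `⟪T u, T w⟫` of a bounded operator. -/
noncomputable def operatorForm {H K : Type*} [NormedAddCommGroup H] [NormedSpace ℝ H]
    [NormedAddCommGroup K] [InnerProductSpace ℝ K] (T : H →L[ℝ] K) : H →L[ℝ] H →L[ℝ] ℝ :=
  (innerSL ℝ).bilinearComp T T

lemma operatorForm_apply {H K : Type*} [NormedAddCommGroup H] [NormedSpace ℝ H]
    [NormedAddCommGroup K] [InnerProductSpace ℝ K] (T : H →L[ℝ] K) (u w : H) :
    operatorForm T u w = ⟪T u, T w⟫_ℝ := rfl

lemma operatorForm_self {H K : Type*} [NormedAddCommGroup H] [NormedSpace ℝ H]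
    [NormedAddCommGroup K] [InnerProductSpace ℝ K] (T : H →L[ℝ] K) (u : H) :
    operatorForm T u u = ‖T u‖ ^ 2 := by
  rw [operatorForm_apply, real_inner_self_eq_norm_sq]

lemma real_inner_eq_mul (a b : ℝ) : ⟪a, b⟫_ℝ = a * b := by simp [mul_comm]

lemma neumannForm_eq (u w : H1 Ω) : neumannForm u w = operatorForm (valL Ω) u w := by
  rw [operatorForm_apply, L2.inner_def]
  simp only [real_inner_eq_mul]
  rfl

lemma dynamicalForm_eq (β : ℝ) (u w : H1 Ω) : dynamicalForm β u w =
    sphereArea d * β * operatorForm (valL Ω) u w + operatorForm (trace Ω) u w := by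
  rw [← neumannForm_eq, operatorForm_apply, L2.inner_def]
  simp only [real_inner_eq_mul]
  rfl

lemma IsWeakGradient.congr {u u' : E d → ℝ} {g g' : E d → E d} (h : IsWeakGradient Ω u g)
    (hu : u =ᵐ[volume.restrict Ω] u') (hg : g =ᵐ[volume.restrict Ω] g') :
    IsWeakGradient Ω u' g' := by
  intro φ h1 hc hs v
  have := h φ h1 hc hs v
  rw [integral_congr_ae (g := fun x => u' x * fderiv ℝ φ x v),
    integral_congr_ae (f := fun x => ⟪g x, v⟫_ℝ * φ x) (g := fun x => ⟪g' x, v⟫_ℝ * φ x)] at this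
  · exact this
  · filter_upwards [hg] with x hx
    rw [hx]
  · filter_upwards [hu] with x hx
    rw [hx]

/-- The element of `H¹(Ω)` given by square integrable functions. -/
noncomputable def H1.ofMemLp {u : E d → ℝ} {g : E d → E d} (hu : MemLp u 2 (volume.restrict Ω))
    (hg : MemLp g 2 (volume.restrict Ω)) (h : IsWeakGradient Ω u g) : H1 Ω :=
  ⟨WithLp.toLp 2 (hu.toLp u, hg.toLp g), h.congr hu.coeFn_toLp.symm hg.coeFn_toLp.symm⟩

lemma H1.isWeakGradient (u : H1 Ω) : IsWeakGradient Ω (H1.val u) (H1.grad u) := u.2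

lemma setIntegral_eq_integral_of_tsupport_subset {F : E d → ℝ} (φ : E d → ℝ)
    (hs : tsupport φ ⊆ Ω) (hF : ∀ x, x ∉ tsupport φ → F x = 0) : ∫ x in Ω, F x = ∫ x, F x :=
  setIntegral_eq_integral_of_forall_compl_eq_zero fun x hx => hF x fun h => hx (hs h)

lemma fderiv_eq_zero_of_notMem_tsupport {φ : E d → ℝ} {x : E d} (hx : x ∉ tsupport φ) :
    fderiv ℝ φ x = 0 :=
  image_eq_zero_of_notMem_tsupport fun h => hx (tsupport_fderiv_subset ℝ h)

lemma ContDiff.isWeakGradient {φ : E d → ℝ} (hφ : ContDiff ℝ ∞ φ) :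
    IsWeakGradient Ω φ (gradient φ) := by
  intro ψ hψ hc hs v
  have hcφ := hφ.continuous
  have hcdφ : Continuous fun x => fderiv ℝ φ x v :=
    (hφ.continuous_fderiv (by simp)).clm_apply continuous_const
  have hcdψ : Continuous fun x => fderiv ℝ ψ x v :=
    (hψ.continuous_fderiv (by simp)).clm_apply continuous_const
  rw [setIntegral_eq_integral_of_tsupport_subset ψ hs fun x hx => by
      rw [fderiv_eq_zero_of_notMem_tsupport hx]; simp,
    setIntegral_eq_integral_of_tsupport_subset ψ hs fun x hx => by
      rw [image_eq_zero_of_notMem_tsupport hx]; simp]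
  simp only [inner_gradient_left]
  refine integral_mul_fderiv_eq_neg_fderiv_mul_of_integrable ?_ ?_ ?_
    (fun x _ => hφ.differentiable (by simp) x) (fun x _ => hψ.differentiable (by simp) x)
  · exact (hcdφ.mul hψ.continuous).integrable_of_hasCompactSupport hc.mul_left
  · exact (hcφ.mul hcdψ).integrable_of_hasCompactSupport (hc.fderiv_apply ℝ v).mul_left
  · exact (hcφ.mul hψ.continuous).integrable_of_hasCompactSupport hc.mul_left

lemma memLp_of_continuous (hb : Bornology.IsBounded Ω) {F : Type*} [NormedAddCommGroup F]
    {φ : E d → F} (hφ : Continuous φ) : MemLp φ 2 (volume.restrict Ω) := by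
  have : IsFiniteMeasure (volume.restrict Ω) := ⟨by
    rw [Measure.restrict_apply_univ]; exact hb.measure_lt_top⟩
  obtain ⟨C, hC⟩ := (hb.isCompact_closure.image hφ).isBounded.exists_norm_le
  refine MemLp.of_bound hφ.aestronglyMeasurable C ?_
  have hsub : Ω ⊆ {x | ‖φ x‖ ≤ C} := fun x hx => hC _ ⟨x, subset_closure hx, rfl⟩
  have hm : MeasurableSet {x | ‖φ x‖ ≤ C} := (isClosed_le hφ.norm continuous_const).measurableSet
  rw [ae_iff, Measure.restrict_apply (by exact hm.compl)]
  have : {a | ¬‖φ a‖ ≤ C} ∩ Ω = ∅ := by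
    ext x
    simp only [mem_inter_iff, mem_ofPred_eq, mem_empty_iff_false, iff_false, not_and]
    exact fun h hx => h (hsub hx)
  rw [this, measure_empty]

/-- A function which is smooth up to the boundary of a bounded set, as an element of `H¹`. -/
noncomputable def H1.ofSmooth (hb : Bornology.IsBounded Ω) {φ : E d → ℝ} (hφ : ContDiff ℝ ∞ φ) :
    H1 Ω :=
  H1.ofMemLp (memLp_of_continuous hb hφ.continuous)
    (memLp_of_continuous hb (ContDiff.continuous_gradient hφ)) (ContDiff.isWeakGradient hφ)

lemma H1.val_ofSmooth (hb : Bornology.IsBounded Ω) {φ : E d → ℝ} (hφ : ContDiff ℝ ∞ φ) :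
    H1.val (H1.ofSmooth hb hφ) =ᵐ[volume.restrict Ω] φ :=
  (memLp_of_continuous hb hφ.continuous).coeFn_toLp

lemma H1.grad_ofSmooth (hb : Bornology.IsBounded Ω) {φ : E d → ℝ} (hφ : ContDiff ℝ ∞ φ) :
    H1.grad (H1.ofSmooth hb hφ) =ᵐ[volume.restrict Ω] gradient φ :=
  (memLp_of_continuous hb (ContDiff.continuous_gradient hφ)).coeFn_toLp

/-- The product rule for a test function and an element of `H¹(Ω)`. -/
lemma H1.isWeakGradient_mul (u : H1 Ω) {χ : E d → ℝ} (hχ : ContDiff ℝ ∞ χ)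
    (hχc : HasCompactSupport χ) :
    IsWeakGradient Ω (fun x => χ x * H1.val u x)
      (fun x => χ x • H1.grad u x + H1.val u x • gradient χ x) := by
  intro φ hφ hc hs v
  have h1 := H1.isWeakGradient u (fun x => χ x * φ x) (hχ.mul hφ) hc.mul_left
    ((closure_mono (Function.support_mul_subset_right _ _)).trans hs) v
  have hfd : ∀ x, fderiv ℝ (fun x => χ x * φ x) x v =
      χ x * fderiv ℝ φ x v + φ x * fderiv ℝ χ x v := by
    intro x
    rw [fderiv_fun_mul (hχ.differentiable (by simp) x) (hφ.differentiable (by simp) x)]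
    simp
  have hcφ := hφ.continuous
  have hcχ := hχ.continuous
  have hcdφ : Continuous fun x => fderiv ℝ φ x v :=
    (hφ.continuous_fderiv (by simp)).clm_apply continuous_const
  have hcdχ : Continuous fun x => fderiv ℝ χ x v :=
    (hχ.continuous_fderiv (by simp)).clm_apply continuous_const
  have hi1 : Integrable (fun x => H1.val u x * (χ x * fderiv ℝ φ x v)) (volume.restrict Ω) :=
    (Lp.memLp (H1.val u)).integrable_mul (q := 2)
      (((hcχ.mul hcdφ).memLp_of_hasCompactSupport hχc.mul_right).restrict Ω)
  have hi2 : Integrable (fun x => H1.val u x * (φ x * fderiv ℝ χ x v)) (volume.restrict Ω) :=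
    (Lp.memLp (H1.val u)).integrable_mul (q := 2)
      (((hcφ.mul hcdχ).memLp_of_hasCompactSupport hc.mul_right).restrict Ω)
  have hi3 : Integrable (fun x => ⟪H1.grad u x, v⟫_ℝ * (χ x * φ x)) (volume.restrict Ω) :=
    ((Lp.memLp (H1.grad u)).inner_const v).integrable_mul (q := 2)
      (((hcχ.mul hcφ).memLp_of_hasCompactSupport hχc.mul_right).restrict Ω)
  simp only [hfd, mul_add] at h1
  rw [integral_add hi1 hi2] at h1
  have e1 : ∀ x, χ x * H1.val u x * fderiv ℝ φ x v = H1.val u x * (χ x * fderiv ℝ φ x v) :=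
    fun x => by ring
  have e2 : ∀ x, ⟪χ x • H1.grad u x + H1.val u x • gradient χ x, v⟫_ℝ * φ x =
      ⟪H1.grad u x, v⟫_ℝ * (χ x * φ x) + H1.val u x * (φ x * fderiv ℝ χ x v) := by
    intro x
    rw [inner_add_left, inner_smul_left, inner_smul_left, inner_gradient_left]
    simp only [conj_trivial]
    ring
  simp only [e1, e2]
  rw [integral_add hi3 hi2]
  linarith

lemma memLp_mul_val (u : H1 Ω) {χ : E d → ℝ} (hχ : Continuous χ)
    (hχc : HasCompactSupport χ) :
    MemLp (fun x => χ x * H1.val u x) 2 (volume.restrict Ω) :=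
  (Lp.memLp (H1.val u)).mul ((hχ.memLp_of_hasCompactSupport (p := ⊤) hχc).restrict Ω)

lemma memLp_mul_grad (u : H1 Ω) {χ : E d → ℝ} (hχ : ContDiff ℝ ∞ χ)
    (hχc : HasCompactSupport χ) :
    MemLp (fun x => χ x • H1.grad u x + H1.val u x • gradient χ x) 2 (volume.restrict Ω) := by
  refine MemLp.add ?_ ?_
  · exact (Lp.memLp (H1.grad u)).smul
      ((hχ.continuous.memLp_of_hasCompactSupport (p := ⊤) hχc).restrict Ω)
  · have hgc : HasCompactSupport (gradient χ) :=
      (hχc.fderiv ℝ).comp_left (g := (InnerProductSpace.toDual ℝ (E d)).symm) (map_zero _)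
    have := ((ContDiff.continuous_gradient hχ).memLp_of_hasCompactSupport (p := ⊤)
      (μ := volume) hgc).restrict Ω
    exact MemLp.smul (p := 2) (q := ⊤) (r := 2) this (Lp.memLp (H1.val u))

/-- The product of an element of `H¹(Ω)` with a test function. -/
noncomputable def H1.cutoff (u : H1 Ω) {χ : E d → ℝ} (hχ : ContDiff ℝ ∞ χ)
    (hχc : HasCompactSupport χ) : H1 Ω :=
  H1.ofMemLp (memLp_mul_val u hχ.continuous hχc) (memLp_mul_grad u hχ hχc)
    (H1.isWeakGradient_mul u hχ hχc)

end SobolevBasics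

/-! ### Translations and averages in `L²` -/

section Averages

variable {d : ℕ} {F : Type*} [NormedAddCommGroup F]

lemma Lp_enorm_sq {X : Type*} [MeasurableSpace X] {μ : Measure X} (f : Lp F 2 μ) :
    ‖f‖ₑ ^ 2 = ∫⁻ x, ‖f x‖ₑ ^ 2 ∂μ := by
  have := eLpNorm_nnreal_pow_eq_lintegral (μ := μ) (f := f) (p := 2) two_ne_zero
  rw [Lp.enorm_def]
  simpa using this

lemma eLpNorm_two_sq {X : Type*} [MeasurableSpace X] {μ : Measure X} (f : X → F) :
    eLpNorm f 2 μ ^ 2 = ∫⁻ x, ‖f x‖ₑ ^ 2 ∂μ := by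
  have := eLpNorm_nnreal_pow_eq_lintegral (μ := μ) (f := f) (p := 2) two_ne_zero
  simpa using this

lemma memLp_two_of_lintegral_lt_top {X : Type*} [MeasurableSpace X] {μ : Measure X} {f : X → F}
    (hf : AEStronglyMeasurable f μ) (h : ∫⁻ x, ‖f x‖ₑ ^ 2 ∂μ < ⊤) : MemLp f 2 μ := by
  refine ⟨hf, ?_⟩
  rw [← eLpNorm_two_sq] at h
  by_contra htop
  rw [not_lt, top_le_iff] at htop
  simp [htop] at h

lemma tendsto_lintegral_translate_sub {f : E d → F} (hf : MemLp f 2 volume) :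
    Tendsto (fun z : E d => ∫⁻ x, ‖f (x + z) - f x‖ₑ ^ 2) (𝓝 0) (𝓝 0) := by
  let g : E d → C(E d, E d) := fun z => ⟨fun x => x + z, by fun_prop⟩
  have hg : Continuous g :=
    ContinuousMap.continuous_of_continuous_uncurry _ (by
      simp only [g, Function.uncurry_def, ContinuousMap.coe_mk]; fun_prop)
  have hgm : ∀ z, MeasurePreserving (g z) (volume : Measure (E d)) volume :=
    fun z => measurePreserving_add_right volume z
  have hcont : Continuous fun z => Lp.compMeasurePreserving (g z) (hgm z) (hf.toLp f) :=
    continuous_const.compMeasurePreservingLp hg hgm (by norm_num)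
  have h1 : Tendsto (fun z => ‖Lp.compMeasurePreserving (g z) (hgm z) (hf.toLp f) - hf.toLp f‖ₑ ^ 2)
      (𝓝 0) (𝓝 0) := by
    have h0 : Lp.compMeasurePreserving (g 0) (hgm 0) (hf.toLp f) = hf.toLp f := by
      refine Lp.ext ?_
      filter_upwards [Lp.coeFn_compMeasurePreserving (hf.toLp f) (hgm 0)] with x hx
      rw [hx]
      simp [g]
    have h2 := ((hcont.sub continuous_const).enorm (f := fun z =>
      Lp.compMeasurePreserving (g z) (hgm z) (hf.toLp f) - hf.toLp f)).tendsto 0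
    rw [h0, sub_self, enorm_zero] at h2
    simpa using ENNReal.Tendsto.pow (n := 2) h2
  refine h1.congr fun z => ?_
  rw [Lp_enorm_sq]
  refine lintegral_congr_ae ?_
  filter_upwards [Lp.coeFn_sub (Lp.compMeasurePreserving (g z) (hgm z) (hf.toLp f)) (hf.toLp f),
    Lp.coeFn_compMeasurePreserving (hf.toLp f) (hgm z), hf.coeFn_toLp,
    (hgm z).quasiMeasurePreserving.ae_eq_comp hf.coeFn_toLp] with x h1 h2 h3 h4
  rw [h1, Pi.sub_apply, h2, h3, h4]
  rfl

lemma locallyIntegrable_translate {f : E d → F} (hf : LocallyIntegrable f volume) (x : E d) :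
    LocallyIntegrable (fun z => f (x + z)) volume := by
  have hmp : MeasurePreserving (fun z : E d => x + z) volume volume :=
    measurePreserving_add_left volume x
  have h := (locallyIntegrable_map_homeomorph (Homeomorph.addLeft x) (f := f)
    (μ := (volume : Measure (E d)))).1
  rw [show Measure.map (Homeomorph.addLeft x) (volume : Measure (E d)) = volume from
    hmp.map_eq] at h
  exact h hf

variable [NormedSpace ℝ F]

lemma enorm_integral_sq_le {Z : Type*} [MeasurableSpace Z] {ν : Measure Z} [IsProbabilityMeasure ν]
    {g : Z → F} (hg : AEStronglyMeasurable g ν) : ‖∫ z, g z ∂ν‖ₑ ^ 2 ≤ ∫⁻ z, ‖g z‖ₑ ^ 2 ∂ν := by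
  rw [← eLpNorm_two_sq]
  gcongr
  calc ‖∫ z, g z ∂ν‖ₑ ≤ ∫⁻ z, ‖g z‖ₑ ∂ν := enorm_integral_le_lintegral_enorm g
    _ = eLpNorm g 1 ν := eLpNorm_one_eq_lintegral_enorm.symm
    _ ≤ eLpNorm g 2 ν := eLpNorm_le_eLpNorm_of_exponent_le (by norm_num) hg

/-- Jensen's inequality for the probability measure `ν`, followed by Tonelli. It reduces estimates
of averages to estimates of single translations. -/
lemma lintegral_average_sub_le {f : E d → F} (hf : StronglyMeasurable f) (A : Set (E d))
    {ν : Measure (E d)} [IsProbabilityMeasure ν] [CompleteSpace F]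
    (hint : ∀ x, Integrable (fun z => f (x + z)) ν) :
    ∫⁻ x in A, ‖(∫ z, f (x + z) ∂ν) - f x‖ₑ ^ 2 ≤
      ∫⁻ z, ∫⁻ x in A, ‖f (x + z) - f x‖ₑ ^ 2 ∂volume ∂ν := by
  have hF : StronglyMeasurable (fun p : E d × E d => f (p.1 + p.2) - f p.1) :=
    (hf.comp_measurable measurable_add).sub (hf.comp_measurable measurable_fst)
  calc ∫⁻ x in A, ‖(∫ z, f (x + z) ∂ν) - f x‖ₑ ^ 2
      = ∫⁻ x in A, ‖∫ z, (f (x + z) - f x) ∂ν‖ₑ ^ 2 := by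
        refine lintegral_congr fun x => ?_
        rw [integral_sub (hint x) (integrable_const _)]
        simp
    _ ≤ ∫⁻ x in A, ∫⁻ z, ‖f (x + z) - f x‖ₑ ^ 2 ∂ν := by
        refine lintegral_mono fun x => enorm_integral_sq_le ?_
        exact (hF.comp_measurable measurable_prodMk_left).aestronglyMeasurable
    _ = _ := lintegral_lintegral_swap (hF.enorm.pow_const 2).aemeasurable

end Averages

/-! ### Bump functions as probability measures -/

section Bump

variable {d : ℕ} {c : E d} (κ : ContDiffBump c)

/-- The probability measure whose density is a normalised bump function. -/
noncomputable def bumpMeasure : Measure (E d) :=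
  volume.withDensity fun z => ENNReal.ofReal (κ.normed volume z)

lemma measurable_ofReal_normed : Measurable fun z => ENNReal.ofReal (κ.normed volume z) :=
  κ.continuous_normed.measurable.ennreal_ofReal

instance : IsProbabilityMeasure (bumpMeasure κ) := ⟨by
  rw [bumpMeasure, withDensity_apply _ MeasurableSet.univ, Measure.restrict_univ,
    ← ofReal_integral_eq_lintegral_ofReal κ.integrable_normed
      (Eventually.of_forall κ.nonneg_normed), κ.integral_normed, ENNReal.ofReal_one]⟩

variable {F : Type*} [NormedAddCommGroup F] [NormedSpace ℝ F]

lemma integral_bumpMeasure (g : E d → F) :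
    ∫ z, g z ∂(bumpMeasure κ) = ∫ z, κ.normed volume z • g z := by
  rw [bumpMeasure, integral_withDensity_eq_integral_toReal_smul (measurable_ofReal_normed κ)
    (Eventually.of_forall fun _ => ENNReal.ofReal_lt_top)]
  simp only [ENNReal.toReal_ofReal (κ.nonneg_normed _)]

lemma integrable_bumpMeasure {g : E d → F} (hg : LocallyIntegrable g volume) :
    Integrable g (bumpMeasure κ) := by
  rw [bumpMeasure, integrable_withDensity_iff_integrable_smul' (measurable_ofReal_normed κ)
    (Eventually.of_forall fun _ => ENNReal.ofReal_lt_top)]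
  simp only [ENNReal.toReal_ofReal (κ.nonneg_normed _)]
  exact hg.integrable_smul_left_of_hasCompactSupport κ.continuous_normed κ.hasCompactSupport_normed

lemma ae_bumpMeasure_mem : ∀ᵐ z ∂(bumpMeasure κ), z ∈ Metric.ball c κ.rOut := by
  rw [bumpMeasure, ae_withDensity_iff (measurable_ofReal_normed κ)]
  refine Eventually.of_forall fun z hz => ?_
  rw [← κ.support_normed_eq (μ := volume)]
  intro h0
  simp [h0] at hz

lemma integral_bumpMeasure_translate (f : E d → F) (x : E d) :
    ∫ z, f (x + z) ∂(bumpMeasure κ) = ∫ y, κ.normed volume (y - x) • f y := by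
  rw [integral_bumpMeasure, ← integral_add_left_eq_self (fun y => κ.normed volume (y - x) • f y) x]
  simp

end Bump

/-! ### The interior cone property of a Lipschitz domain -/

section ConeProperty

variable {d : ℕ} {Ω : Set (E d)}

/-- Near `p` all points of `Ω` can be moved inside `Ω` in an open cone of directions. -/
def HasConeProperty (Ω : Set (E d)) (p : E d) : Prop :=
  ∃ v : E d, ∃ η > (0 : ℝ), ∃ r > (0 : ℝ), ∃ t₀ > (0 : ℝ), ∀ x ∈ Ω, dist x p < r →
    ∀ z, ‖z - v‖ ≤ η → ∀ t : ℝ, 0 < t → t ≤ t₀ → x + t • z ∈ Ω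

lemma hasConeProperty_of_mem (hΩ : IsOpen Ω) {p : E d} (hp : p ∈ Ω) : HasConeProperty Ω p := by
  obtain ⟨ρ, hρ, hb⟩ := Metric.isOpen_iff.1 hΩ p hp
  -- The axis is 0 and every direction of norm at most 1 is allowed; `ρ / 2 + ρ / 4 < ρ` keeps the
  -- moved point in the ball.
  refine ⟨0, 1, one_pos, ρ / 2, by positivity, ρ / 4, by positivity, fun x _ hx z hz t ht ht0 => ?_⟩
  refine hb ?_
  rw [Metric.mem_ball, dist_eq_norm] at *
  rw [sub_zero] at hz
  have h1 : ‖t • z‖ ≤ ρ / 4 := by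
    rw [norm_smul, Real.norm_of_nonneg ht.le]
    nlinarith [norm_nonneg z]
  calc ‖x + t • z - p‖ = ‖(x - p) + t • z‖ := by congr 1; abel
    _ ≤ ‖x - p‖ + ‖t • z‖ := norm_add_le _ _
    _ < ρ := by linarith

lemma norm_proj_orthogonal_le {v z : E d} :
    ‖(ℝ ∙ v)ᗮ.orthogonalProjectionOnto z‖ ≤ ‖z - v‖ := by
  have h1 : (ℝ ∙ v)ᗮ.orthogonalProjectionOnto v = 0 :=
    Submodule.orthogonalProjectionOnto_orthogonal_apply_eq_zero
      (Submodule.mem_span_singleton_self v)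
  calc ‖(ℝ ∙ v)ᗮ.orthogonalProjectionOnto z‖
      = ‖(ℝ ∙ v)ᗮ.orthogonalProjectionOnto (z - v)‖ := by rw [map_sub, h1, sub_zero]
    _ ≤ ‖z - v‖ := Submodule.norm_orthogonalProjectionOnto_apply_le _ _

/-- A step `t z` with `‖z - v‖ ≤ η` raises the vertical coordinate by at least `t (1 - η)` and the
graph below it by at most `t K η`. The choice `η = 1 / (K + 2)` makes the first larger, so the point
stays above the graph. -/
lemma hasConeProperty_of_frontier (hΩ : HasLipschitzBoundary Ω) {p : E d} (hp : p ∈ frontier Ω) :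
    HasConeProperty Ω p := by
  obtain ⟨v, hv, γ, K, hγ, U, hU, hgraph⟩ := hΩ p hp
  obtain ⟨ρ, hρ, hb⟩ := Metric.mem_nhds_iff.1 hU
  have hK : (0 : ℝ) ≤ K := K.2
  set η : ℝ := 1 / (K + 2) with hη
  have hη0 : 0 < η := by positivity
  have hKη : K * η < 1 - η := by
    rw [hη]; field_simp; linarith
  have hη1 : η ≤ 1 := by
    have := mul_nonneg hK hη0.le
    linarith
  refine ⟨v, η, hη0, ρ / 2, by positivity, ρ / 8, by positivity, fun x hxΩ hx z hz t ht ht0 => ?_⟩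
  have hzn : ‖z‖ ≤ 2 := by
    calc ‖z‖ = ‖(z - v) + v‖ := by congr 1; abel
      _ ≤ ‖z - v‖ + ‖v‖ := norm_add_le _ _
      _ ≤ 2 := by linarith
  have hxU : x ∈ U := hb (by rw [Metric.mem_ball]; linarith)
  have hyU : x + t • z ∈ U := by
    refine hb ?_
    rw [Metric.mem_ball, dist_eq_norm] at *
    have h1 : ‖t • z‖ ≤ ρ / 4 := by
      rw [norm_smul, Real.norm_of_nonneg ht.le]
      nlinarith [norm_nonneg z]
    calc ‖x + t • z - p‖ = ‖(x - p) + t • z‖ := by congr 1; abel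
      _ ≤ ‖x - p‖ + ‖t • z‖ := norm_add_le _ _
      _ < ρ := by linarith
  rw [hgraph _ hyU]
  have hx0 := (hgraph _ hxU).1 hxΩ
  have h1 : γ ((ℝ ∙ v)ᗮ.orthogonalProjectionOnto (x + t • z)) ≤
      γ ((ℝ ∙ v)ᗮ.orthogonalProjectionOnto x) + K * (t * η) := by
    have h2 := hγ.dist_le_mul ((ℝ ∙ v)ᗮ.orthogonalProjectionOnto (x + t • z))
      ((ℝ ∙ v)ᗮ.orthogonalProjectionOnto x)
    rw [Real.dist_eq, dist_eq_norm, ← map_sub, add_sub_cancel_left, map_smul, norm_smul,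
      Real.norm_of_nonneg ht.le] at h2
    have h3 : ‖(ℝ ∙ v)ᗮ.orthogonalProjectionOnto z‖ ≤ η := norm_proj_orthogonal_le.trans hz
    have h4 : K * (t * ‖(ℝ ∙ v)ᗮ.orthogonalProjectionOnto z‖) ≤ K * (t * η) := by gcongr
    linarith [le_abs_self (γ ((ℝ ∙ v)ᗮ.orthogonalProjectionOnto (x + t • z)) -
      γ ((ℝ ∙ v)ᗮ.orthogonalProjectionOnto x))]
  have h5 : 1 - η ≤ ⟪v, z⟫_ℝ := by
    have h6 : ⟪v, z⟫_ℝ = 1 + ⟪v, z - v⟫_ℝ := by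
      rw [inner_sub_right, real_inner_self_eq_norm_sq, hv]; ring
    have h7 : |⟪v, z - v⟫_ℝ| ≤ η := by
      calc |⟪v, z - v⟫_ℝ| ≤ ‖v‖ * ‖z - v‖ := abs_real_inner_le_norm _ _
        _ ≤ η := by rw [hv, one_mul]; exact hz
    linarith [neg_abs_le ⟪v, z - v⟫_ℝ]
  rw [inner_add_right, inner_smul_right]
  have h8 : t * (K * η) < t * ⟪v, z⟫_ℝ := by
    refine mul_lt_mul_of_pos_left ?_ ht
    linarith
  linarith

lemma IsLipschitzDomain.hasConeProperty (hΩ : IsLipschitzDomain Ω) {p : E d}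
    (hp : p ∈ closure Ω) : HasConeProperty Ω p := by
  by_cases h : p ∈ Ω
  · exact hasConeProperty_of_mem hΩ.isOpen h
  · refine hasConeProperty_of_frontier hΩ.lipschitz ?_
    rw [hΩ.isOpen.frontier_eq]
    exact ⟨hp, h⟩

end ConeProperty

/-! ### Smoothness and gradients of averages -/

section Mollification

variable {d : ℕ} {c : E d} (κ : ContDiffBump c)

open scoped Convolution in
lemma average_eq_convolution (W : E d → ℝ) :
    (fun x => ∫ z, W (x + z) ∂(bumpMeasure κ)) =
      W ⋆[ContinuousLinearMap.mul ℝ ℝ, volume] (fun s => κ.normed volume (-s)) := by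
  ext x
  rw [integral_bumpMeasure_translate, convolution_def]
  refine integral_congr_ae (Eventually.of_forall fun y => ?_)
  simp [mul_comm]

lemma hasCompactSupport_normed_neg : HasCompactSupport fun s => κ.normed volume (-s) :=
  κ.hasCompactSupport_normed.comp_homeomorph (Homeomorph.neg (E d))

lemma contDiff_normed_neg : ContDiff ℝ ∞ fun s => κ.normed volume (-s) :=
  κ.contDiff_normed.comp contDiff_neg

lemma contDiff_average {W : E d → ℝ} (hW : LocallyIntegrable W volume) :
    ContDiff ℝ ∞ fun x => ∫ z, W (x + z) ∂(bumpMeasure κ) := by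
  rw [average_eq_convolution]
  exact (hasCompactSupport_normed_neg κ).contDiff_convolution_right _ hW (contDiff_normed_neg κ)

lemma fderiv_normed_sub (x y e : E d) :
    fderiv ℝ (fun y => κ.normed volume (y - x)) y e =
      -fderiv ℝ (fun s => κ.normed volume (-s)) (x - y) e := by
  have h1 : (fun y => κ.normed volume (y - x)) =
      (fun s => κ.normed volume (-s)) ∘ fun y => x - y := by
    ext y; simp
  have h2 : DifferentiableAt ℝ (fun s => κ.normed volume (-s)) (x - y) :=
    (contDiff_normed_neg κ).differentiable (by simp) _
  have h3 : HasFDerivAt (fun y : E d => x - y) (-ContinuousLinearMap.id ℝ (E d)) y :=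
    (hasFDerivAt_id y).const_sub x
  rw [h1, (h2.hasFDerivAt.comp y h3).fderiv]
  simp

lemma fderiv_average {W : E d → ℝ} (hW : LocallyIntegrable W volume) (x e : E d) :
    fderiv ℝ (fun x => ∫ z, W (x + z) ∂(bumpMeasure κ)) x e =
      -∫ y, W y * fderiv ℝ (fun y => κ.normed volume (y - x)) y e := by
  have h1 : ContDiff ℝ 1 fun s => κ.normed volume (-s) :=
    (contDiff_normed_neg κ).of_le (by simp)
  rw [average_eq_convolution, ((hasCompactSupport_normed_neg κ).hasFDerivAt_convolution_right
    (ContinuousLinearMap.mul ℝ ℝ) hW h1 x).fderiv,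
    convolution_precompR_apply (L := ContinuousLinearMap.mul ℝ ℝ) hW
      ((hasCompactSupport_normed_neg κ).fderiv ℝ) (h1.continuous_fderiv one_ne_zero),
    convolution_def, ← integral_neg]
  refine integral_congr_ae (Eventually.of_forall fun y => ?_)
  simp [fderiv_normed_sub]

/-- The derivative falls on the kernel, and `h` is the weak gradient identity tested with the kernel
translated to `x`. It is demanded at one point only, since for one-sided averages it holds only for
`x` in `Ω`. -/
lemma gradient_average {W : E d → ℝ} {G : E d → E d} (hW : LocallyIntegrable W volume)
    (hG : LocallyIntegrable G volume) {x : E d}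
    (h : ∀ e, ∫ y, W y * fderiv ℝ (fun y => κ.normed volume (y - x)) y e =
      -∫ y, ⟪G y, e⟫_ℝ * κ.normed volume (y - x)) :
    gradient (fun x => ∫ z, W (x + z) ∂(bumpMeasure κ)) x = ∫ z, G (x + z) ∂(bumpMeasure κ) := by
  refine ext_inner_right ℝ fun e => ?_
  rw [inner_gradient_left, fderiv_average κ hW, h, neg_neg, real_inner_comm,
    ← integral_inner (integrable_bumpMeasure κ (locallyIntegrable_translate hG x)),
    integral_bumpMeasure_translate κ (fun y => ⟪e, G y⟫_ℝ)]
  refine integral_congr_ae (Eventually.of_forall fun y => ?_)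
  simp [mul_comm, real_inner_comm]

lemma lintegral_average_sub_le_of_forall {F : Type*} [NormedAddCommGroup F] [NormedSpace ℝ F]
    [CompleteSpace F] {f : E d → F} (hf : StronglyMeasurable f) (hl : LocallyIntegrable f volume)
    (A : Set (E d)) {a : ENNReal}
    (h : ∀ z ∈ Metric.ball c κ.rOut, ∫⁻ x in A, ‖f (x + z) - f x‖ₑ ^ 2 ≤ a) :
    ∫⁻ x in A, ‖(∫ z, f (x + z) ∂(bumpMeasure κ)) - f x‖ₑ ^ 2 ≤ a := by
  refine (lintegral_average_sub_le hf A fun x =>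
    integrable_bumpMeasure κ (locallyIntegrable_translate hl x)).trans ?_
  calc ∫⁻ z, ∫⁻ x in A, ‖f (x + z) - f x‖ₑ ^ 2 ∂volume ∂(bumpMeasure κ)
      ≤ ∫⁻ _, a ∂(bumpMeasure κ) := by
        refine lintegral_mono_ae ?_
        filter_upwards [ae_bumpMeasure_mem κ] with z hz using h z hz
    _ = a := by simp

lemma norm_sq_le_of_lintegral_le {X F : Type*} [MeasurableSpace X] {μ : Measure X}
    [NormedAddCommGroup F] {f : Lp F 2 μ} {g : X → F} (hfg : f =ᵐ[μ] g) {a : ℝ} (ha : 0 ≤ a)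
    (h : ∫⁻ x, ‖g x‖ₑ ^ 2 ∂μ ≤ ENNReal.ofReal a) : ‖f‖ ^ 2 ≤ a := by
  have h1 : ‖f‖ₑ ^ 2 ≤ ENNReal.ofReal a := by
    rw [Lp_enorm_sq, lintegral_congr_ae (g := fun x => ‖g x‖ₑ ^ 2)]
    · exact h
    · filter_upwards [hfg] with x hx
      rw [hx]
  rw [← ofReal_norm, ← ENNReal.ofReal_pow (norm_nonneg _)] at h1
  exact (ENNReal.ofReal_le_ofReal_iff ha).1 h1

/-- A small bump function supported in a cone with axis `v`. -/
lemma exists_bump_in_cone {d : ℕ} (v : E d) {η t₀ ρ : ℝ} (hη : 0 < η) (ht₀ : 0 < t₀)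
    (hρ : 0 < ρ) : ∃ δ : ℝ, 0 < δ ∧ δ ≤ t₀ ∧ ∃ κ : ContDiffBump (δ • v),
      ∀ z ∈ Metric.closedBall (δ • v) κ.rOut, ‖z‖ < ρ ∧ ∃ z', ‖z' - v‖ ≤ η ∧ z = δ • z' := by
  have hlen : 0 < ‖v‖ + η := by positivity
  set δ : ℝ := min t₀ (ρ / (2 * (‖v‖ + η))) with hδ
  have hδ0 : 0 < δ := by positivity
  have hδl : δ * (‖v‖ + η) < ρ := by
    have h1 : δ ≤ ρ / (2 * (‖v‖ + η)) := min_le_right _ _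
    calc δ * (‖v‖ + η) ≤ ρ / (2 * (‖v‖ + η)) * (‖v‖ + η) := by gcongr
      _ = ρ / 2 := by field_simp
      _ < _ := by linarith
  -- The ball of radius `δ η` about `δ v` is `δ` times the ball of radius `η` about `v`, so the
  -- kernel lives in the cone.
  refine ⟨δ, hδ0, min_le_left _ _, ⟨δ * η / 2, δ * η, by positivity, by
    have := mul_pos hδ0 hη; linarith⟩, fun z hz => ?_⟩
  rw [mem_closedBall_iff_norm] at hz
  have hz' : z = δ • (δ⁻¹ • z) := by rw [smul_smul, mul_inv_cancel₀ hδ0.ne', one_smul]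
  refine ⟨?_, δ⁻¹ • z, ?_, hz'⟩
  · calc ‖z‖ = ‖(z - δ • v) + δ • v‖ := by congr 1; abel
      _ ≤ ‖z - δ • v‖ + ‖δ • v‖ := norm_add_le _ _
      _ ≤ δ * η + δ * ‖v‖ := by
        rw [norm_smul, Real.norm_of_nonneg hδ0.le]; linarith
      _ = δ * (‖v‖ + η) := by ring
      _ < _ := hδl
  · have : δ⁻¹ • z - v = δ⁻¹ • (z - δ • v) := by
      rw [smul_sub, smul_smul, inv_mul_cancel₀ hδ0.ne', one_smul]
    rw [this, norm_smul, norm_inv, Real.norm_of_nonneg hδ0.le, inv_mul_le_iff₀ hδ0]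
    exact hz

end Mollification

/-! ### Density of functions smooth up to the boundary -/

section Density

variable {d : ℕ} {Ω : Set (E d)}

/-- The elements of `H¹(Ω)` which are smooth up to the boundary. -/
def smoothElements (Ω : Set (E d)) : Submodule ℝ (H1 Ω) where
  carrier := {w | ∃ φ : E d → ℝ, ContDiff ℝ ∞ φ ∧ H1.val w =ᵐ[volume.restrict Ω] φ}
  zero_mem' := ⟨0, contDiff_const, Lp.coeFn_zero ℝ 2 _⟩
  add_mem' := by
    rintro u w ⟨φ, hφ, hu⟩ ⟨ψ, hψ, hw⟩
    refine ⟨φ + ψ, hφ.add hψ, ?_⟩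
    exact (Lp.coeFn_add (H1.val u) (H1.val w)).trans (hu.add hw)
  smul_mem' := by
    rintro c u ⟨φ, hφ, hu⟩
    refine ⟨c • φ, contDiff_const.smul hφ, ?_⟩
    exact (Lp.coeFn_smul c (H1.val u)).trans (hu.const_smul c)

lemma ofSmooth_mem_smoothElements (hb : Bornology.IsBounded Ω) {φ : E d → ℝ}
    (hφ : ContDiff ℝ ∞ φ) : H1.ofSmooth hb hφ ∈ smoothElements Ω :=
  ⟨φ, hφ, H1.val_ofSmooth hb hφ⟩

/-- The extension by zero of a cutoff of an element of `H¹(Ω)`. -/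
noncomputable def cutoffVal (u : H1 Ω) (χ : E d → ℝ) : E d → ℝ :=
  Ω.indicator fun x => χ x * H1.val u x

/-- The extension by zero of the gradient of a cutoff of an element of `H¹(Ω)`. -/
noncomputable def cutoffGrad (u : H1 Ω) (χ : E d → ℝ) : E d → E d :=
  Ω.indicator fun x => χ x • H1.grad u x + H1.val u x • gradient χ x

lemma stronglyMeasurable_cutoffVal (hΩ : IsOpen Ω) (u : H1 Ω) {χ : E d → ℝ}
    (hχ : ContDiff ℝ ∞ χ) : StronglyMeasurable (cutoffVal u χ) :=
  (hχ.continuous.stronglyMeasurable.mul (Lp.stronglyMeasurable _)).indicator hΩ.measurableSet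

lemma stronglyMeasurable_cutoffGrad (hΩ : IsOpen Ω) (u : H1 Ω) {χ : E d → ℝ}
    (hχ : ContDiff ℝ ∞ χ) : StronglyMeasurable (cutoffGrad u χ) :=
  ((hχ.continuous.stronglyMeasurable.smul (Lp.stronglyMeasurable (H1.grad u))).add
    ((Lp.stronglyMeasurable (H1.val u)).smul
      (ContDiff.continuous_gradient hχ).stronglyMeasurable)).indicator hΩ.measurableSet

lemma memLp_cutoffVal (hΩ : IsOpen Ω) (u : H1 Ω) {χ : E d → ℝ} (hχ : ContDiff ℝ ∞ χ)
    (hχc : HasCompactSupport χ) : MemLp (cutoffVal u χ) 2 volume :=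
  (memLp_indicator_iff_restrict hΩ.measurableSet).2 (memLp_mul_val u hχ.continuous hχc)

lemma memLp_cutoffGrad (hΩ : IsOpen Ω) (u : H1 Ω) {χ : E d → ℝ} (hχ : ContDiff ℝ ∞ χ)
    (hχc : HasCompactSupport χ) : MemLp (cutoffGrad u χ) 2 volume :=
  (memLp_indicator_iff_restrict hΩ.measurableSet).2 (memLp_mul_grad u hχ hχc)

lemma cutoffVal_eq_zero (u : H1 Ω) {χ : E d → ℝ} {y : E d} (hy : y ∉ tsupport χ) :
    cutoffVal u χ y = 0 := by
  have h1 : χ y = 0 := image_eq_zero_of_notMem_tsupport hy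
  unfold cutoffVal
  by_cases h : y ∈ Ω
  · rw [indicator_of_mem h, h1, zero_mul]
  · rw [indicator_of_notMem h]

lemma cutoffGrad_eq_zero (u : H1 Ω) {χ : E d → ℝ} {y : E d} (hy : y ∉ tsupport χ) :
    cutoffGrad u χ y = 0 := by
  have h1 : χ y = 0 := image_eq_zero_of_notMem_tsupport hy
  have h2 : gradient χ y = 0 := by
    rw [← norm_eq_zero, norm_gradient, fderiv_eq_zero_of_notMem_tsupport hy, norm_zero]
  unfold cutoffGrad
  by_cases h : y ∈ Ω
  · rw [indicator_of_mem h, h1, h2, zero_smul, smul_zero, add_zero]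
  · rw [indicator_of_notMem h]

lemma integral_cutoffVal_mul_fderiv (hΩ : IsOpen Ω) (u : H1 Ω) {χ : E d → ℝ}
    (hχ : ContDiff ℝ ∞ χ) (hχc : HasCompactSupport χ) {ψ : E d → ℝ} (hψ : ContDiff ℝ ∞ ψ)
    (hψc : HasCompactSupport ψ) (hψs : tsupport ψ ⊆ Ω) (e : E d) :
    ∫ y, cutoffVal u χ y * fderiv ℝ ψ y e = -∫ y, ⟪cutoffGrad u χ y, e⟫_ℝ * ψ y := by
  have h1 := H1.isWeakGradient_mul u hχ hχc ψ hψ hψc hψs e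
  rw [← integral_indicator hΩ.measurableSet, ← integral_indicator hΩ.measurableSet] at h1
  have h2 : ∀ y, Ω.indicator (fun y => χ y * H1.val u y * fderiv ℝ ψ y e) y =
      cutoffVal u χ y * fderiv ℝ ψ y e := by
    intro y
    unfold cutoffVal
    by_cases h : y ∈ Ω
    · rw [indicator_of_mem h, indicator_of_mem h]
    · rw [indicator_of_notMem h, indicator_of_notMem h, zero_mul]
  have h3 : ∀ y, Ω.indicator (fun y => ⟪χ y • H1.grad u y + H1.val u y • gradient χ y, e⟫_ℝ * ψ y) y
      = ⟪cutoffGrad u χ y, e⟫_ℝ * ψ y := by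
    intro y
    unfold cutoffGrad
    by_cases h : y ∈ Ω
    · rw [indicator_of_mem h, indicator_of_mem h]
    · rw [indicator_of_notMem h, indicator_of_notMem h, inner_zero_left, zero_mul]
  simpa only [h2, h3] using h1

lemma val_cutoff_ae_eq (hΩ : IsOpen Ω) (u : H1 Ω) {χ : E d → ℝ} (hχ : ContDiff ℝ ∞ χ)
    (hχc : HasCompactSupport χ) :
    H1.val (H1.cutoff u hχ hχc) =ᵐ[volume.restrict Ω] cutoffVal u χ := by
  filter_upwards [(memLp_mul_val u hχ.continuous hχc).coeFn_toLp,
    ae_restrict_mem hΩ.measurableSet] with x h1 h2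
  rw [cutoffVal, indicator_of_mem h2]
  exact h1

lemma grad_cutoff_ae_eq (hΩ : IsOpen Ω) (u : H1 Ω) {χ : E d → ℝ} (hχ : ContDiff ℝ ∞ χ)
    (hχc : HasCompactSupport χ) :
    H1.grad (H1.cutoff u hχ hχc) =ᵐ[volume.restrict Ω] cutoffGrad u χ := by
  filter_upwards [(memLp_mul_grad u hχ hχc).coeFn_toLp,
    ae_restrict_mem hΩ.measurableSet] with x h1 h2
  rw [cutoffGrad, indicator_of_mem h2]
  exact h1

/-- One-sided averages of a cutoff commute with the gradient inside `Ω`. -/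
lemma gradient_average_cutoff (hΩ : IsOpen Ω) {p v : E d} {η r t₀ δ : ℝ}
    (hcone : ∀ x ∈ Ω, dist x p < r → ∀ z, ‖z - v‖ ≤ η → ∀ t : ℝ, 0 < t → t ≤ t₀ → x + t • z ∈ Ω)
    (u : H1 Ω) {χ : E d → ℝ} (hχ : ContDiff ℝ ∞ χ) (hχc : HasCompactSupport χ)
    (hsupp : tsupport χ ⊆ Metric.ball p (r / 2)) (hδ0 : 0 < δ) (hδt : δ ≤ t₀)
    {c : E d} (κ : ContDiffBump c)
    (hball : ∀ z ∈ Metric.closedBall c κ.rOut,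
      ‖z‖ < r / 2 ∧ ∃ z', ‖z' - v‖ ≤ η ∧ z = δ • z') {x : E d} (hx : x ∈ Ω) :
    gradient (fun x => ∫ z, cutoffVal u χ (x + z) ∂(bumpMeasure κ)) x =
      ∫ z, cutoffGrad u χ (x + z) ∂(bumpMeasure κ) := by
  refine gradient_average κ ((memLp_cutoffVal hΩ u hχ hχc).locallyIntegrable one_le_two)
    ((memLp_cutoffGrad hΩ u hχ hχc).locallyIntegrable one_le_two) fun e => ?_
  have hts : ∀ y ∈ tsupport (fun y => κ.normed volume (y - x)),
      y - x ∈ Metric.closedBall c κ.rOut := by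
    intro y hy
    rw [← κ.tsupport_normed_eq (μ := volume)]
    exact tsupport_comp_subset_preimage (κ.normed volume) (f := fun y => y - x)
      (by fun_prop) hy
  -- Near `p` the cone property puts the support of the translated kernel inside `Ω`, so it is an
  -- admissible test function. Otherwise that support, within `r / 2` of `x`, misses the support of
  -- `χ`, and both sides vanish.
  by_cases hxp : dist x p < r
  · refine integral_cutoffVal_mul_fderiv hΩ u hχ hχc
      (κ.contDiff_normed.comp (contDiff_id.sub contDiff_const))
      (κ.hasCompactSupport_normed.comp_homeomorph (Homeomorph.subRight x)) ?_ e
    intro y hy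
    obtain ⟨-, z', hz', hyz⟩ := hball _ (hts y hy)
    have := hcone x hx hxp z' hz' δ hδ0 hδt
    rwa [← hyz, add_sub_cancel] at this
  · have hfar : ∀ y ∈ tsupport (fun y => κ.normed volume (y - x)), y ∉ tsupport χ := by
      intro y hy hyp
      have h1 := (hball _ (hts y hy)).1
      have h3 := hsupp hyp
      rw [Metric.mem_ball] at h3
      have h2 := dist_triangle x y p
      rw [dist_comm x y, dist_eq_norm y x] at h2
      linarith
    have h1 : ∀ y, cutoffVal u χ y * fderiv ℝ (fun y => κ.normed volume (y - x)) y e = 0 := by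
      intro y
      by_cases hy : y ∈ tsupport (fun y => κ.normed volume (y - x))
      · rw [cutoffVal_eq_zero u (hfar y hy), zero_mul]
      · rw [fderiv_eq_zero_of_notMem_tsupport hy]; simp
    have h2 : ∀ y, ⟪cutoffGrad u χ y, e⟫_ℝ * κ.normed volume (y - x) = 0 := by
      intro y
      by_cases hy : y ∈ tsupport (fun y => κ.normed volume (y - x))
      · rw [cutoffGrad_eq_zero u (hfar y hy), inner_zero_left, zero_mul]
      · have := image_eq_zero_of_notMem_tsupport hy
        rw [this, mul_zero]
    simp [h1, h2]

/-- Extend the cutoff by zero and average it over a small bump in the cone. The result is smooth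
everywhere, its gradient in `Ω` is the average of the gradient, and continuity of translations in
`L²` makes both errors small. The extension itself need not be in `H¹(ℝ^d)`. -/
lemma cutoff_mem_closure (hΩ : IsOpen Ω) (hb : Bornology.IsBounded Ω) {p v : E d} {η r t₀ : ℝ}
    (hη : 0 < η) (hr : 0 < r) (ht₀ : 0 < t₀)
    (hcone : ∀ x ∈ Ω, dist x p < r → ∀ z, ‖z - v‖ ≤ η → ∀ t : ℝ, 0 < t → t ≤ t₀ → x + t • z ∈ Ω)
    (u : H1 Ω) {χ : E d → ℝ} (hχ : ContDiff ℝ ∞ χ) (hχc : HasCompactSupport χ)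
    (hsupp : tsupport χ ⊆ Metric.ball p (r / 2)) :
    H1.cutoff u hχ hχc ∈ closure (smoothElements Ω : Set (H1 Ω)) := by
  have hW2 := memLp_cutoffVal hΩ u hχ hχc
  have hG2 := memLp_cutoffGrad hΩ u hχ hχc
  have hWl := hW2.locallyIntegrable one_le_two
  have hGl := hG2.locallyIntegrable one_le_two
  rw [Metric.mem_closure_iff]
  intro ε hε
  -- The squared errors of the values and of the gradient are at most `a` each, and `2 a < ε ^ 2`.
  set a : ℝ := ε ^ 2 / 4 with ha
  have ha0 : 0 < a := by positivity
  have htr : ∀ᶠ z : E d in 𝓝 0,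
      ∫⁻ x, ‖cutoffVal u χ (x + z) - cutoffVal u χ x‖ₑ ^ 2 ≤ ENNReal.ofReal a ∧
      ∫⁻ x, ‖cutoffGrad u χ (x + z) - cutoffGrad u χ x‖ₑ ^ 2 ≤ ENNReal.ofReal a :=
    ((tendsto_lintegral_translate_sub hW2).eventually_le_const (by simpa using ha0)).and
      ((tendsto_lintegral_translate_sub hG2).eventually_le_const (by simpa using ha0))
  obtain ⟨ρ, hρ, htr⟩ := Metric.eventually_nhds_iff.1 htr
  obtain ⟨δ, hδ0, hδt, κ, hball⟩ := exists_bump_in_cone v hη ht₀ (lt_min hρ (half_pos hr))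
  have hws := contDiff_average κ hWl
  refine ⟨H1.ofSmooth hb hws, ofSmooth_mem_smoothElements hb hws, ?_⟩
  have hbnd : ∀ z ∈ Metric.ball (δ • v) κ.rOut, dist z 0 < ρ := by
    intro z hz
    rw [dist_zero_right]
    exact ((hball z (Metric.ball_subset_closedBall hz)).1).trans_le (min_le_left _ _)
  have h1 : ‖H1.val (H1.ofSmooth hb hws) - H1.val (H1.cutoff u hχ hχc)‖ ^ 2 ≤ a := by
    refine norm_sq_le_of_lintegral_le
      (g := fun x => (∫ z, cutoffVal u χ (x + z) ∂(bumpMeasure κ)) - cutoffVal u χ x) ?_ ha0.le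
      (lintegral_average_sub_le_of_forall κ (stronglyMeasurable_cutoffVal hΩ u hχ) hWl Ω fun z hz =>
        (lintegral_mono' Measure.restrict_le_self le_rfl).trans (htr (hbnd z hz)).1)
    exact (Lp.coeFn_sub _ _).trans ((H1.val_ofSmooth hb hws).sub (val_cutoff_ae_eq hΩ u hχ hχc))
  have h2 : ‖H1.grad (H1.ofSmooth hb hws) - H1.grad (H1.cutoff u hχ hχc)‖ ^ 2 ≤ a := by
    refine norm_sq_le_of_lintegral_le
      (g := fun x => (∫ z, cutoffGrad u χ (x + z) ∂(bumpMeasure κ)) - cutoffGrad u χ x) ?_ ha0.le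
      (lintegral_average_sub_le_of_forall κ (stronglyMeasurable_cutoffGrad hΩ u hχ) hGl Ω
        fun z hz => (lintegral_mono' Measure.restrict_le_self le_rfl).trans (htr (hbnd z hz)).2)
    refine (Lp.coeFn_sub _ _).trans (EventuallyEq.sub ?_ (grad_cutoff_ae_eq hΩ u hχ hχc))
    filter_upwards [H1.grad_ofSmooth hb hws, ae_restrict_mem hΩ.measurableSet] with x h1 h2
    rw [h1]
    exact gradient_average_cutoff hΩ hcone u hχ hχc hsupp hδ0 hδt κ
      (fun z hz => ⟨(hball z hz).1.trans_le (min_le_right _ _), (hball z hz).2⟩) h2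
  rw [dist_comm, dist_eq_norm]
  refine lt_of_pow_lt_pow_left₀ 2 hε.le ?_
  have h3 := H1.norm_sq (H1.ofSmooth hb hws - H1.cutoff u hχ hχc)
  rw [← valL_apply, ← gradL_apply, map_sub, map_sub, valL_apply, valL_apply, gradL_apply,
    gradL_apply] at h3
  have : a + a < ε ^ 2 := by rw [ha]; nlinarith [pow_pos hε 2]
  linarith

open scoped Manifold in
/-- Functions which are smooth up to the boundary are dense in `H¹` of a Lipschitz domain. -/
theorem dense_smoothElements (hΩ : IsLipschitzDomain Ω) :
    Dense (smoothElements Ω : Set (H1 Ω)) := by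
  intro u
  have hcp : ∀ p : closure Ω, HasConeProperty Ω p := fun p => hΩ.hasConeProperty p.2
  choose v η hη r hr t₀ ht₀ hcone using hcp
  obtain ⟨s, hs⟩ := hΩ.isBounded.isCompact_closure.elim_finite_subcover
    (fun p : closure Ω => Metric.ball (p : E d) (r p / 2)) (fun _ => Metric.isOpen_ball)
    (fun p hp => mem_iUnion.2 ⟨⟨p, hp⟩, Metric.mem_ball_self (half_pos (hr ⟨p, hp⟩))⟩)
  obtain ⟨f, hf⟩ := SmoothPartitionOfUnity.exists_isSubordinate 𝓘(ℝ, E d)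
    (isClosed_closure (s := Ω)) (fun i : s => Metric.ball (i : E d) (r i / 2))
    (fun _ => Metric.isOpen_ball) (fun x hx => by
      obtain ⟨i, hi, hxi⟩ := mem_iUnion₂.1 (hs hx)
      exact mem_iUnion.2 ⟨⟨i, hi⟩, hxi⟩)
  have hfs : ∀ i, ContDiff ℝ ∞ (f i) := fun i => (f i).contMDiff.contDiff
  have hfc : ∀ i, HasCompactSupport (f i) := fun i =>
    HasCompactSupport.of_support_subset_isCompact (isCompact_closedBall (i : E d) (r i / 2))
      ((subset_tsupport _).trans ((hf i).trans Metric.ball_subset_closedBall))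
  have hsum : ∀ x ∈ Ω, ∑ i, f i x = 1 := by
    intro x hx
    rw [← finsum_eq_sum_of_fintype]
    exact f.sum_eq_one (subset_closure hx)
  -- The partition sums to 1 on the open set `Ω`, so its gradients cancel there. This is why the
  -- cutoffs add up to `u` in the gradient component too.
  have hgsum : ∀ x ∈ Ω, ∑ i, gradient (f i) x = 0 := by
    intro x hx
    refine ext_inner_right ℝ fun e => ?_
    rw [sum_inner]
    simp only [inner_gradient_left, inner_zero_left]
    have h1 : (fun y => ∑ i, f i y) =ᶠ[𝓝 x] fun _ => (1 : ℝ) := by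
      filter_upwards [hΩ.isOpen.mem_nhds hx] with y hy using hsum y hy
    have h2 := h1.fderiv_eq (𝕜 := ℝ)
    have h3 : fderiv ℝ (fun y => ∑ i, f i y) x = ∑ i, fderiv ℝ (f i) x :=
      fderiv_fun_sum fun i _ => (hfs i).differentiable (by simp) x
    rw [h3] at h2
    have := congrArg (fun L => L e) h2
    simpa using this
  have hu : u = ∑ i, H1.cutoff u (hfs i) (hfc i) := by
    refine H1.ext ?_ ?_
    · rw [← valL_apply, ← valL_apply, map_sum]
      refine Lp.ext ?_
      have hall : ∀ᵐ x ∂(volume.restrict Ω), ∀ i,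
          valL Ω (H1.cutoff u (hfs i) (hfc i)) x = f i x * H1.val u x :=
        ae_all_iff.2 fun i => (memLp_mul_val u (hfs i).continuous (hfc i)).coeFn_toLp
      filter_upwards [Lp.coeFn_finsetSum Finset.univ fun i => valL Ω (H1.cutoff u (hfs i) (hfc i)),
        hall,
        ae_restrict_mem hΩ.isOpen.measurableSet] with x h1 h2 h3
      rw [h1]
      simp only [Finset.sum_apply, h2]
      rw [← Finset.sum_mul, hsum x h3, one_mul]
      rfl
    · rw [← gradL_apply, ← gradL_apply, map_sum]
      refine Lp.ext ?_
      have hall : ∀ᵐ x ∂(volume.restrict Ω), ∀ i, gradL Ω (H1.cutoff u (hfs i) (hfc i)) x =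
          f i x • H1.grad u x + H1.val u x • gradient (f i) x :=
        ae_all_iff.2 fun i => (memLp_mul_grad u (hfs i) (hfc i)).coeFn_toLp
      filter_upwards [Lp.coeFn_finsetSum Finset.univ fun i => gradL Ω (H1.cutoff u (hfs i) (hfc i)),
        hall, ae_restrict_mem hΩ.isOpen.measurableSet] with x h1 h2 h3
      rw [h1]
      simp only [Finset.sum_apply, h2]
      rw [Finset.sum_add_distrib, ← Finset.sum_smul, ← Finset.smul_sum, hsum x h3, hgsum x h3,
        one_smul, smul_zero, add_zero]
      rfl
  rw [hu, ← Submodule.topologicalClosure_coe]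
  refine Submodule.sum_mem _ fun i _ => ?_
  rw [← SetLike.mem_coe, Submodule.topologicalClosure_coe]
  exact cutoff_mem_closure hΩ.isOpen hΩ.isBounded (hη i) (hr i) (ht₀ i) (hcone i) u (hfs i) (hfc i)
    (hf i)

end Density

/-! ### Extension by zero -/

section Extension

variable {d : ℕ} {Ω : Set (E d)}

/-- The extension by zero of an element of `L²(Ω)`. -/
noncomputable def zeroExtension (f : Lp ℝ 2 (volume.restrict Ω)) : E d → ℝ := Ω.indicator f

lemma eLpNorm_two_le_iff {X F : Type*} [MeasurableSpace X] [NormedAddCommGroup F] {μ : Measure X}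
    {f : X → F} {a : ENNReal} : eLpNorm f 2 μ ≤ a ↔ ∫⁻ x, ‖f x‖ₑ ^ 2 ∂μ ≤ a ^ 2 := by
  rw [← eLpNorm_two_sq, ENNReal.pow_le_pow_left_iff two_ne_zero]

lemma stronglyMeasurable_zeroExtension (hΩ : IsOpen Ω) (f : Lp ℝ 2 (volume.restrict Ω)) :
    StronglyMeasurable (zeroExtension f) :=
  (Lp.stronglyMeasurable f).indicator hΩ.measurableSet

lemma eLpNorm_zeroExtension (hΩ : IsOpen Ω) (f : Lp ℝ 2 (volume.restrict Ω)) :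
    eLpNorm (zeroExtension f) 2 volume = ‖f‖ₑ := by
  rw [zeroExtension, eLpNorm_indicator_eq_eLpNorm_restrict hΩ.measurableSet, Lp.enorm_def]

lemma memLp_zeroExtension (hΩ : IsOpen Ω) (f : Lp ℝ 2 (volume.restrict Ω)) :
    MemLp (zeroExtension f) 2 volume :=
  (memLp_indicator_iff_restrict hΩ.measurableSet).2 (Lp.memLp f)

lemma locallyIntegrable_zeroExtension (hΩ : IsOpen Ω) (f : Lp ℝ 2 (volume.restrict Ω)) :
    LocallyIntegrable (zeroExtension f) volume :=
  (memLp_zeroExtension hΩ f).locallyIntegrable one_le_two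

lemma zeroExtension_ae_eq (hΩ : IsOpen Ω) (f : Lp ℝ 2 (volume.restrict Ω)) :
    zeroExtension f =ᵐ[volume.restrict Ω] f :=
  indicator_ae_eq_restrict hΩ.measurableSet

lemma zeroExtension_sub (hΩ : IsOpen Ω) (f g : Lp ℝ 2 (volume.restrict Ω)) :
    zeroExtension (f - g) =ᵐ[volume] zeroExtension f - zeroExtension g := by
  have h := (ae_restrict_iff' hΩ.measurableSet).1 (Lp.coeFn_sub f g)
  filter_upwards [h] with x hx
  simp only [zeroExtension, Pi.sub_apply]
  by_cases hxΩ : x ∈ Ω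
  · rw [indicator_of_mem hxΩ, indicator_of_mem hxΩ, indicator_of_mem hxΩ, hx hxΩ, Pi.sub_apply]
  · simp [indicator_of_notMem hxΩ]

end Extension

/-! ### Difference quotients along segments inside the domain -/

section Segments

variable {d : ℕ} {Ω : Set (E d)}

/-- Write the difference as the integral of the derivative over the segment, apply Jensen in the
segment parameter and Tonelli. For each `s` the translate of `A` by `s z` lies in `Ω`, so
translation invariance bounds the inner integral by the one over `Ω`. -/
lemma eLpNorm_translate_sub_smooth_le (hΩ : IsOpen Ω) {φ : E d → ℝ} (hφ : ContDiff ℝ ∞ φ)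
    {A : Set (E d)} (hA : MeasurableSet A) {z : E d}
    (hseg : ∀ x ∈ A, ∀ s ∈ Icc (0 : ℝ) 1, x + s • z ∈ Ω) :
    eLpNorm (fun x => φ (x + z) - φ x) 2 (volume.restrict A) ≤
      ‖z‖ₑ * eLpNorm (gradient φ) 2 (volume.restrict Ω) := by
  rw [eLpNorm_two_le_iff, mul_pow, eLpNorm_two_sq]
  have hgc : Continuous (gradient φ) := ContDiff.continuous_gradient hφ
  let ν : Measure ℝ := volume.restrict (Ioc 0 1)
  have hν : IsProbabilityMeasure ν := ⟨by simp [ν]⟩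
  have hline : ∀ x, φ (x + z) - φ x = ∫ s, ⟪gradient φ (x + s • z), z⟫_ℝ ∂ν := by
    intro x
    have h1 : ∀ s ∈ uIcc (0 : ℝ) 1, HasDerivAt (fun s : ℝ => φ (x + s • z))
        (⟪gradient φ (x + s • z), z⟫_ℝ) s := by
      intro s _
      rw [inner_gradient_left]
      have h2 : HasDerivAt (fun s : ℝ => x + s • z) z s := by
        simpa using ((hasDerivAt_id s).smul_const z).const_add x
      exact ((hφ.differentiable (by simp) _).hasFDerivAt).comp_hasDerivAt s h2
    have h3 := intervalIntegral.integral_eq_sub_of_hasDerivAt h1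
      ((Continuous.inner (by fun_prop) continuous_const).intervalIntegrable 0 1)
    rw [intervalIntegral.integral_of_le zero_le_one] at h3
    simpa using h3.symm
  have hcont : Continuous fun p : E d × ℝ => ‖gradient φ (p.1 + p.2 • z)‖ₑ ^ 2 :=
    (ENNReal.continuous_pow 2).comp (hgc.comp (by fun_prop)).enorm
  calc ∫⁻ x in A, ‖φ (x + z) - φ x‖ₑ ^ 2
      ≤ ∫⁻ x in A, ∫⁻ s, ‖z‖ₑ ^ 2 * ‖gradient φ (x + s • z)‖ₑ ^ 2 ∂ν := by
        refine lintegral_mono fun x => ?_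
        rw [hline]
        refine (enorm_integral_sq_le (Continuous.aestronglyMeasurable
          (Continuous.inner (by fun_prop) continuous_const))).trans ?_
        refine lintegral_mono fun s => ?_
        rw [← mul_pow, mul_comm]
        gcongr
        simp only [← ofReal_norm]
        rw [← ENNReal.ofReal_mul (norm_nonneg _)]
        exact ENNReal.ofReal_le_ofReal (norm_inner_le_norm _ _)
    _ = ‖z‖ₑ ^ 2 * ∫⁻ s, ∫⁻ x in A, ‖gradient φ (x + s • z)‖ₑ ^ 2 ∂volume ∂ν := by
        rw [lintegral_lintegral_swap, ← lintegral_const_mul' _ _ (by finiteness)]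
        · refine lintegral_congr fun s => ?_
          rw [lintegral_const_mul' _ _ (by finiteness)]
        · exact (measurable_const.mul hcont.measurable).aemeasurable
    _ ≤ ‖z‖ₑ ^ 2 * ∫⁻ _, (∫⁻ x in Ω, ‖gradient φ x‖ₑ ^ 2) ∂ν := by
        refine mul_le_mul' le_rfl (lintegral_mono_ae ?_)
        filter_upwards [ae_restrict_mem measurableSet_Ioc] with s hs
        rw [← lintegral_indicator hA, ← lintegral_indicator hΩ.measurableSet,
          
          ← lintegral_add_right_eq_self (Ω.indicator fun x => ‖gradient φ x‖ₑ ^ 2) (s • z)]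
        refine lintegral_mono fun x => ?_
        by_cases hx : x ∈ A
        · rw [indicator_of_mem hx, indicator_of_mem (hseg x hx s ⟨hs.1.le, hs.2⟩)]
        · rw [indicator_of_notMem hx]
          exact zero_le
    _ = _ := by rw [lintegral_const, measure_univ, mul_one]

/-- The weak gradient of a smooth function is its gradient. -/
lemma H1.grad_ae_eq_gradient (hΩ : IsOpen Ω) (hb : Bornology.IsBounded Ω) {w : H1 Ω} {φ : E d → ℝ}
    (hφ : ContDiff ℝ ∞ φ) (hw : H1.val w =ᵐ[volume.restrict Ω] φ) :
    H1.grad w =ᵐ[volume.restrict Ω] gradient φ := by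
  have hwe : IsWeakGradient Ω (H1.val w) (gradient φ) :=
    (ContDiff.isWeakGradient hφ).congr hw.symm (ae_eq_refl _)
  have hsub : ∀ (g : E d → ℝ), ContDiff ℝ ∞ g → HasCompactSupport g → tsupport g ⊆ Ω →
      ∫ x, g x • (H1.grad w x - gradient φ x) ∂(volume.restrict Ω) = 0 := by
    intro g hg hgc hgs
    have hi1 : Integrable (fun x => g x • H1.grad w x) (volume.restrict Ω) :=
      memLp_one_iff_integrable.1 ((Lp.memLp (H1.grad w)).smul (p := 2) (q := 2) (r := 1)
        ((hg.continuous.memLp_of_hasCompactSupport hgc).restrict Ω))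
    have hi2 : Integrable (fun x => g x • gradient φ x) (volume.restrict Ω) :=
      ((hg.continuous.smul (ContDiff.continuous_gradient hφ)).integrable_of_hasCompactSupport
        hgc.smul_right).restrict
    simp only [smul_sub]
    rw [integral_sub hi1 hi2, sub_eq_zero]
    refine ext_inner_left ℝ fun v => ?_
    rw [← integral_inner hi1, ← integral_inner hi2]
    have h1 := H1.isWeakGradient w g hg hgc hgs v
    have h2 := hwe g hg hgc hgs v
    rw [h1] at h2
    have h3 := neg_injective h2
    have h4 : ∀ G : E d → E d, (fun x => ⟪v, g x • G x⟫_ℝ) = fun x => ⟪G x, v⟫_ℝ * g x := by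
      intro G
      ext x
      rw [inner_smul_right, real_inner_comm, mul_comm]
    rw [h4 (H1.grad w), h4 (gradient φ)]
    exact h3
  have hloc : LocallyIntegrableOn (fun x => H1.grad w x - gradient φ x) Ω volume := by
    have h1 : IntegrableOn (fun x => H1.grad w x - gradient φ x) Ω volume := by
      have : IsFiniteMeasure (volume.restrict Ω) := ⟨by
        rw [Measure.restrict_apply_univ]; exact hb.measure_lt_top⟩
      exact ((Lp.memLp (H1.grad w)).integrable one_le_two).sub
        ((memLp_of_continuous hb (ContDiff.continuous_gradient hφ)).integrable one_le_two)
    exact h1.locallyIntegrableOn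
  have := hΩ.ae_eq_zero_of_integral_contDiff_smul_eq_zero hloc (fun g hg hgc hgs => by
    rw [← setIntegral_eq_integral_of_forall_compl_eq_zero (s := Ω)]
    · exact hsub g hg hgc hgs
    · intro x hx
      rw [image_eq_zero_of_notMem_tsupport fun h => hx (hgs h), zero_smul])
  filter_upwards [(ae_restrict_iff' hΩ.measurableSet).2 this] with x hx
  exact sub_eq_zero.1 hx

/-- Difference quotients are controlled by the gradient along segments inside `Ω`. -/
theorem eLpNorm_translate_sub_le (hΩ : IsOpen Ω) (hb : Bornology.IsBounded Ω)
    (hdense : Dense (smoothElements Ω : Set (H1 Ω))) (u : H1 Ω)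
    {A : Set (E d)} (hA : MeasurableSet A) {z : E d}
    (hseg : ∀ x ∈ A, ∀ s ∈ Icc (0 : ℝ) 1, x + s • z ∈ Ω) :
    eLpNorm (fun x => zeroExtension (H1.val u) (x + z) - zeroExtension (H1.val u) x) 2
      (volume.restrict A) ≤ ‖z‖ₑ * ‖H1.grad u‖ₑ := by
  have hAΩ : ∀ x ∈ A, x ∈ Ω := fun x hx => by simpa using hseg x hx 0 (by simp)
  have hAzΩ : ∀ x ∈ A, x + z ∈ Ω := fun x hx => by simpa using hseg x hx 1 (by simp)
  have hmp : MeasurePreserving (fun x : E d => x + z) volume volume :=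
    measurePreserving_add_right volume z
  have hmeas : ∀ f : Lp ℝ 2 (volume.restrict Ω), AEStronglyMeasurable
      (fun x => zeroExtension f (x + z) - zeroExtension f x) (volume.restrict A) := fun f =>
    ((((stronglyMeasurable_zeroExtension hΩ f).comp_measurable (measurable_add_const z)).sub
      (stronglyMeasurable_zeroExtension hΩ f))).aestronglyMeasurable
  have hsmooth : ∀ w ∈ smoothElements Ω,
      eLpNorm (fun x => zeroExtension (H1.val w) (x + z) - zeroExtension (H1.val w) x) 2
        (volume.restrict A) ≤ ‖z‖ₑ * ‖H1.grad w‖ₑ := by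
    rintro w ⟨φ, hφ, hw⟩
    have hgrad := H1.grad_ae_eq_gradient hΩ hb hφ hw
    have h1 : eLpNorm (gradient φ) 2 (volume.restrict Ω) = ‖H1.grad w‖ₑ := by
      rw [Lp.enorm_def]
      exact eLpNorm_congr_ae hgrad.symm
    rw [← h1]
    refine le_trans (le_of_eq ?_) (eLpNorm_translate_sub_smooth_le hΩ hφ hA hseg)
    have h2 := (ae_restrict_iff' hΩ.measurableSet).1
      ((zeroExtension_ae_eq hΩ (H1.val w)).trans hw)
    refine eLpNorm_congr_ae ?_
    filter_upwards [ae_restrict_of_ae h2, ae_restrict_of_ae (hmp.quasiMeasurePreserving.ae h2),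
      ae_restrict_mem hA] with x h3 h4 h5
    rw [h3 (hAΩ x h5), h4 (hAzΩ x h5)]
  -- The left side is controlled by the `L²` norm alone, so the estimate passes from smooth `w` to
  -- the limit `u`.
  have hbound : ∀ f : Lp ℝ 2 (volume.restrict Ω),
      eLpNorm (fun x => zeroExtension f (x + z) - zeroExtension f x) 2 (volume.restrict A) ≤
        2 * ‖f‖ₑ := by
    intro f
    calc eLpNorm (fun x => zeroExtension f (x + z) - zeroExtension f x) 2 (volume.restrict A)
        ≤ eLpNorm (fun x => zeroExtension f (x + z) - zeroExtension f x) 2 volume :=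
          eLpNorm_mono_measure _ Measure.restrict_le_self
      _ ≤ eLpNorm (fun x => zeroExtension f (x + z)) 2 volume
          + eLpNorm (zeroExtension f) 2 volume :=
          eLpNorm_sub_le (((stronglyMeasurable_zeroExtension hΩ f).comp_measurable
            (measurable_add_const z)).aestronglyMeasurable)
            (stronglyMeasurable_zeroExtension hΩ f).aestronglyMeasurable one_le_two
      _ = 2 * ‖f‖ₑ := by
          have h1 : eLpNorm (fun x => zeroExtension f (x + z)) 2 volume =
              eLpNorm (zeroExtension f) 2 volume :=
            eLpNorm_comp_measurePreserving
              (stronglyMeasurable_zeroExtension hΩ f).aestronglyMeasurable hmp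
          rw [h1, eLpNorm_zeroExtension hΩ, two_mul]
  refine le_of_forall_pos_le_add fun ε hε => ?_
  obtain ⟨δ, hδ0, hδ⟩ : ∃ δ : ℝ, 0 < δ ∧ (2 + ‖z‖ₑ) * ENNReal.ofReal δ ≤ ε := by
    have h1 : Tendsto (fun δ : ℝ => (2 + ‖z‖ₑ) * ENNReal.ofReal δ) (𝓝 0) (𝓝 0) := by
      have := ENNReal.Tendsto.const_mul (a := 2 + ‖z‖ₑ) (ENNReal.tendsto_ofReal
        (tendsto_id (x := 𝓝 (0 : ℝ)))) (Or.inr (by finiteness))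
      simpa using this
    obtain ⟨r, hr, h2⟩ := Metric.eventually_nhds_iff.1 (h1.eventually_le_const hε)
    refine ⟨r / 2, half_pos hr, h2 ?_⟩
    rw [Real.dist_eq, sub_zero, abs_of_pos (half_pos hr)]
    linarith
  obtain ⟨w, hw, hwu⟩ := Metric.dense_iff.1 hdense u δ hδ0
  have hn : ‖u - w‖ ≤ δ := by
    rw [Metric.mem_ball, dist_comm, dist_eq_norm] at hw
    exact hw.le
  have hsq := H1.norm_sq (u - w)
  have hv : ‖H1.val (u - w)‖ₑ ≤ ENNReal.ofReal δ := by
    rw [← ofReal_norm]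
    refine ENNReal.ofReal_le_ofReal (le_trans ?_ hn)
    exact le_of_sq_le_sq (by nlinarith [sq_nonneg ‖H1.grad (u - w)‖]) (norm_nonneg _)
  have hg : ‖H1.grad (u - w)‖ₑ ≤ ENNReal.ofReal δ := by
    rw [← ofReal_norm]
    refine ENNReal.ofReal_le_ofReal (le_trans ?_ hn)
    exact le_of_sq_le_sq (by nlinarith [sq_nonneg ‖H1.val (u - w)‖]) (norm_nonneg _)
  have hsub : zeroExtension (H1.val u) =ᵐ[volume]
      zeroExtension (H1.val (u - w)) + zeroExtension (H1.val w) := by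
    have := zeroExtension_sub hΩ (H1.val u) (H1.val w)
    rw [← valL_apply, ← valL_apply, ← map_sub, valL_apply, valL_apply, valL_apply] at this
    filter_upwards [this] with x hx
    simp [hx]
  calc eLpNorm (fun x => zeroExtension (H1.val u) (x + z) - zeroExtension (H1.val u) x) 2
        (volume.restrict A)
      = eLpNorm ((fun x => zeroExtension (H1.val (u - w)) (x + z)
          - zeroExtension (H1.val (u - w)) x) + fun x => zeroExtension (H1.val w) (x + z)
          - zeroExtension (H1.val w) x) 2 (volume.restrict A) := by
        refine eLpNorm_congr_ae (ae_restrict_of_ae ?_)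
        filter_upwards [hsub, hmp.quasiMeasurePreserving.ae hsub] with x h1 h2
        simp only [Pi.add_apply] at h1 h2 ⊢
        rw [h1, h2]
        ring
    _ ≤ 2 * ‖H1.val (u - w)‖ₑ + ‖z‖ₑ * ‖H1.grad w‖ₑ :=
        (eLpNorm_add_le (hmeas _) (hmeas _) one_le_two).trans
          (add_le_add (hbound _) (hsmooth w hwu))
    _ ≤ 2 * ENNReal.ofReal δ + ‖z‖ₑ * (‖H1.grad u‖ₑ + ENNReal.ofReal δ) := by
        gcongr
        have h1 : H1.grad w = H1.grad u - H1.grad (u - w) := by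
          rw [← gradL_apply, ← gradL_apply, ← gradL_apply, map_sub]; abel
        rw [h1]
        exact (enorm_sub_le).trans (by gcongr)
    _ = ‖z‖ₑ * ‖H1.grad u‖ₑ + (2 + ‖z‖ₑ) * ENNReal.ofReal δ := by ring
    _ ≤ _ := by gcongr

end Segments

lemma setLIntegral_biUnion_finset_le {α ι : Type*} [MeasurableSpace α] {μ : Measure α}
    (s : Finset ι) (t : ι → Set α) (f : α → ENNReal) :
    ∫⁻ x in ⋃ p ∈ s, t p, f x ∂μ ≤ ∑ p ∈ s, ∫⁻ x in t p, f x ∂μ := by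
  classical
  induction s using Finset.induction_on with
  | empty => simp
  | insert a s ha ih =>
    rw [Finset.set_biUnion_insert, Finset.sum_insert ha]
    exact (lintegral_union_le _ _ _).trans (add_le_add le_rfl ih)

/-! ### Weak sequential compactness -/

section WeakCompactness

/-- Bounded sequences in a separable Hilbert space have weakly convergent subsequences. -/
lemma exists_weakly_convergent_subseq {K : Type*} [NormedAddCommGroup K] [InnerProductSpace ℝ K]
    [CompleteSpace K] [TopologicalSpace.SeparableSpace K] {f : ℕ → K} {C : ℝ}
    (hf : ∀ n, ‖f n‖ ≤ C) : ∃ φ : ℕ → ℕ, StrictMono φ ∧ ∃ g : K, ∀ h,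
      Tendsto (fun n => ⟪f (φ n), h⟫_ℝ) atTop (𝓝 ⟪g, h⟫_ℝ) := by
  obtain ⟨L, -, φ, hφ, hL⟩ := WeakDual.isSeqCompact_closedBall ℝ K 0 C
    (x := fun n => StrongDual.toWeakDual (InnerProductSpace.toDual ℝ K (f n))) (fun n => by
      simpa using hf n)
  refine ⟨φ, hφ, (InnerProductSpace.toDual ℝ K).symm (WeakDual.toStrongDual L), fun h => ?_⟩
  rw [InnerProductSpace.toDual_symm_apply]
  exact ((WeakDual.eval_continuous h).tendsto L).comp hL

end WeakCompactness

/-! ### Rellich's compactness theorem -/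

section Rellich

variable {d : ℕ} {Ω : Set (E d)} {c : E d} (κ : ContDiffBump c)

lemma memLp_normed_sub (x : E d) :
    MemLp (fun y => κ.normed volume (y - x)) 2 (volume.restrict Ω) :=
  ((κ.continuous_normed.comp (continuous_id.sub continuous_const)).memLp_of_hasCompactSupport
    (κ.hasCompactSupport_normed.comp_homeomorph (Homeomorph.subRight x))).restrict Ω

/-- The average at `x` is a bounded functional of `f`, represented by the translated kernel. Hence
weak convergence of `f` is pointwise convergence of its averages. -/
lemma average_zeroExtension_eq_inner (hΩ : IsOpen Ω) (f : Lp ℝ 2 (volume.restrict Ω)) (x : E d) :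
    ∫ z, zeroExtension f (x + z) ∂(bumpMeasure κ) =
      ⟪f, (memLp_normed_sub (Ω := Ω) κ x).toLp⟫_ℝ := by
  have h : ∫ y, ⟪f y, ((memLp_normed_sub (Ω := Ω) κ x).toLp _ : E d → ℝ) y⟫_ℝ
        ∂(volume.restrict Ω) =
      ∫ y in Ω, κ.normed volume (y - x) * f y := by
    refine integral_congr_ae ?_
    filter_upwards [(memLp_normed_sub (Ω := Ω) κ x).coeFn_toLp] with y hy
    rw [hy, real_inner_eq_mul, mul_comm]
  rw [integral_bumpMeasure_translate, L2.inner_def, h, ← integral_indicator hΩ.measurableSet]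
  refine integral_congr_ae (Eventually.of_forall fun y => ?_)
  simp only [zeroExtension, smul_eq_mul]
  by_cases hy : y ∈ Ω
  · rw [indicator_of_mem hy, indicator_of_mem hy]
  · rw [indicator_of_notMem hy, indicator_of_notMem hy, mul_zero]

lemma norm_toLp_normed_sub_le (x : E d) :
    ‖(memLp_normed_sub (Ω := Ω) κ x).toLp‖ ≤ (eLpNorm (κ.normed volume) 2 volume).toReal := by
  rw [Lp.norm_toLp]
  refine ENNReal.toReal_mono
    (κ.continuous_normed.memLp_of_hasCompactSupport κ.hasCompactSupport_normed).2.ne ?_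
  refine (eLpNorm_mono_measure _ Measure.restrict_le_self).trans (le_of_eq ?_)
  exact eLpNorm_comp_measurePreserving (ν := volume) (g := κ.normed volume) (f := fun y => y - x)
    κ.continuous_normed.aestronglyMeasurable (measurePreserving_sub_right volume x)

/-- Averages of a bounded weakly convergent sequence converge strongly. -/
lemma tendsto_eLpNorm_average_sub (hΩ : IsOpen Ω) {f : ℕ → Lp ℝ 2 (volume.restrict Ω)} {C : ℝ}
    (hf : ∀ n, ‖f n‖ ≤ C) {g : Lp ℝ 2 (volume.restrict Ω)}
    (hfg : ∀ h, Tendsto (fun n => ⟪f n, h⟫_ℝ) atTop (𝓝 ⟪g, h⟫_ℝ))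
    {A : Set (E d)} (hA : volume A ≠ ⊤) :
    Tendsto (fun n => eLpNorm (fun x => (∫ z, zeroExtension (f n) (x + z) ∂(bumpMeasure κ)) -
      ∫ z, zeroExtension g (x + z) ∂(bumpMeasure κ)) 2 (volume.restrict A)) atTop (𝓝 0) := by
  set B : ℝ := (eLpNorm (κ.normed volume) 2 volume).toReal with hB
  have hB0 : 0 ≤ B := ENNReal.toReal_nonneg
  -- By Cauchy–Schwarz the averages are bounded uniformly in `n` and `x`; on the set `A` of finite
  -- measure this is a dominating function.
  have hpt : ∀ n x, ‖(∫ z, zeroExtension (f n) (x + z) ∂(bumpMeasure κ)) -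
      ∫ z, zeroExtension g (x + z) ∂(bumpMeasure κ)‖ ≤ (C + ‖g‖) * B := by
    intro n x
    rw [average_zeroExtension_eq_inner κ hΩ, average_zeroExtension_eq_inner κ hΩ, ← inner_sub_left]
    refine (norm_inner_le_norm _ _).trans ?_
    exact mul_le_mul ((norm_sub_le _ _).trans (by linarith [hf n])) (norm_toLp_normed_sub_le κ x)
      (norm_nonneg _) (by linarith [hf n, norm_nonneg (f n), norm_nonneg g])
  have hlim : Tendsto (fun n => ∫⁻ x in A,
      ‖(∫ z, zeroExtension (f n) (x + z) ∂(bumpMeasure κ)) -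
        ∫ z, zeroExtension g (x + z) ∂(bumpMeasure κ)‖ₑ ^ 2) atTop (𝓝 (∫⁻ _ in A, 0)) := by
    refine tendsto_lintegral_of_dominated_convergence
      (fun _ => ENNReal.ofReal ((C + ‖g‖) * B) ^ 2) (fun n => ?_) (fun n => ?_) ?_ ?_
    · have h1 := (contDiff_average κ (locallyIntegrable_zeroExtension hΩ (f n))).continuous
      have h2 := (contDiff_average κ (locallyIntegrable_zeroExtension hΩ g)).continuous
      exact ((h1.sub h2).enorm.measurable).pow_const 2
    · refine Eventually.of_forall fun x => ?_
      simp only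
      gcongr
      rw [← ofReal_norm]
      exact ENNReal.ofReal_le_ofReal (hpt n x)
    · rw [lintegral_const, Measure.restrict_apply_univ]
      finiteness
    · refine Eventually.of_forall fun x => ?_
      have h1 : Tendsto (fun n => (∫ z, zeroExtension (f n) (x + z) ∂(bumpMeasure κ)) -
          ∫ z, zeroExtension g (x + z) ∂(bumpMeasure κ)) atTop (𝓝 0) := by
        simp only [average_zeroExtension_eq_inner κ hΩ]
        have := (hfg ((memLp_normed_sub (Ω := Ω) κ x).toLp)).sub_const
          ⟪g, (memLp_normed_sub (Ω := Ω) κ x).toLp⟫_ℝ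
        rwa [sub_self] at this
      have h2 := ENNReal.Tendsto.pow (n := 2) h1.enorm
      simpa using h2
  rw [lintegral_zero] at hlim
  have hs := (ENNReal.continuous_rpow_const (y := (1 / 2 : ℝ))).tendsto 0 |>.comp hlim
  rw [ENNReal.zero_rpow_of_pos (by norm_num)] at hs
  refine hs.congr fun n => ?_
  simp only [Function.comp_apply]
  rw [← eLpNorm_two_sq, ← ENNReal.rpow_natCast, ← ENNReal.rpow_mul]
  norm_num

/-- The error of averaging is linear in the size `ρ` of the shifts and uniform over bounded sets of
`H¹`: the equicontinuity needed for compactness. -/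
lemma averages_eLpNorm_sub_le (hΩ : IsOpen Ω) (hb : Bornology.IsBounded Ω)
    (hdense : Dense (smoothElements Ω : Set (H1 Ω))) {A : Set (E d)} (hA : MeasurableSet A)
    {ρ : ℝ} (hseg : ∀ z ∈ Metric.ball c κ.rOut, ‖z‖ ≤ ρ ∧
      ∀ x ∈ A, ∀ s ∈ Icc (0 : ℝ) 1, x + s • z ∈ Ω) (u : H1 Ω) :
    eLpNorm (fun x => (∫ z, zeroExtension (H1.val u) (x + z) ∂(bumpMeasure κ)) -
      zeroExtension (H1.val u) x) 2 (volume.restrict A) ≤ ENNReal.ofReal ρ * ‖H1.grad u‖ₑ := by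
  rw [eLpNorm_two_le_iff]
  refine lintegral_average_sub_le_of_forall κ (stronglyMeasurable_zeroExtension hΩ _)
    (locallyIntegrable_zeroExtension hΩ _) A fun z hz => ?_
  rw [← eLpNorm_two_le_iff]
  refine (eLpNorm_translate_sub_le hΩ hb hdense u hA (hseg z hz).2).trans ?_
  gcongr
  rw [← ofReal_norm]
  exact ENNReal.ofReal_le_ofReal (hseg z hz).1

/-- Split `u m - u n` into its average and the averaging error. The averages converge strongly
because the values converge weakly, and the error is small uniformly in `m` and `n`. -/
lemma eLpNorm_local_cauchy (hΩ : IsLipschitzDomain Ω) {u : ℕ → H1 Ω} {C : ℝ}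
    (hu : ∀ n, ‖u n‖ ≤ C) {g : Lp ℝ 2 (volume.restrict Ω)}
    (hug : ∀ h, Tendsto (fun n => ⟪H1.val (u n), h⟫_ℝ) atTop (𝓝 ⟪g, h⟫_ℝ)) {p : E d}
    (hp : p ∈ closure Ω) : ∃ r > 0, ∀ ε > 0, ∃ N, ∀ m ≥ N, ∀ n ≥ N,
      eLpNorm (zeroExtension (H1.val (u m - u n))) 2
        (volume.restrict (Ω ∩ Metric.ball p r)) ≤ ENNReal.ofReal ε := by
  have hdense := dense_smoothElements hΩ
  obtain ⟨v, η, hη, r, hr, t₀, ht₀, hcone⟩ := hΩ.hasConeProperty hp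
  refine ⟨r, hr, fun ε hε => ?_⟩
  have hC : 0 ≤ C := (norm_nonneg _).trans (hu 0)
  -- Since `‖H1.grad (u m - u n)‖ ≤ 2 C`, this leaves `ε / 2` for the averaging error; the `1` keeps
  -- the denominator positive when `C = 0`.
  set ρ : ℝ := ε / (4 * (C + 1)) with hρ
  have hρ0 : 0 < ρ := by positivity
  obtain ⟨δ, hδ0, hδt, κ, hball⟩ := exists_bump_in_cone v hη ht₀ hρ0
  set A := Ω ∩ Metric.ball p r with hAdef
  have hA : MeasurableSet A := hΩ.isOpen.measurableSet.inter measurableSet_ball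
  have hAfin : volume A ≠ ⊤ :=
    ((measure_mono inter_subset_left).trans_lt hΩ.isBounded.measure_lt_top).ne
  have hseg : ∀ z ∈ Metric.ball (δ • v) κ.rOut, ‖z‖ ≤ ρ ∧
      ∀ x ∈ A, ∀ s ∈ Icc (0 : ℝ) 1, x + s • z ∈ Ω := by
    intro z hz
    obtain ⟨h1, z', hz', rfl⟩ := hball z (Metric.ball_subset_closedBall hz)
    refine ⟨h1.le, fun x hx s hs => ?_⟩
    rcases hs.1.eq_or_lt with h0 | h0
    · rw [← h0, zero_smul, add_zero]; exact hx.1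
    · rw [smul_smul]
      exact hcone x hx.1 hx.2 z' hz' _ (mul_pos h0 hδ0)
        ((mul_le_of_le_one_left hδ0.le hs.2).trans hδt)
  have hval : ∀ n, ‖H1.val (u n)‖ ≤ C := by
    intro n
    have h1 := H1.norm_sq (u n)
    exact (le_of_sq_le_sq (by nlinarith [sq_nonneg ‖H1.grad (u n)‖]) (norm_nonneg _)).trans (hu n)
  have hlim := tendsto_eLpNorm_average_sub κ hΩ.isOpen hval hug hAfin
  have hε4 : (0 : ENNReal) < ENNReal.ofReal (ε / 4) := by simpa using hε
  obtain ⟨N, hN⟩ := eventually_atTop.1 (hlim.eventually_le_const hε4)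
  refine ⟨N, fun m hm n hn => ?_⟩
  set w := u m - u n with hw
  have hgrad : ‖H1.grad w‖ ≤ 2 * C := by
    have h1 := H1.norm_sq w
    have h2 : ‖w‖ ≤ 2 * C := (norm_sub_le _ _).trans (by linarith [hu m, hu n])
    exact (le_of_sq_le_sq (by nlinarith [sq_nonneg ‖H1.val w‖]) (norm_nonneg _)).trans h2
  set a : (Lp ℝ 2 (volume.restrict Ω)) → E d → ℝ := fun f x =>
    ∫ z, zeroExtension f (x + z) ∂(bumpMeasure κ) with ha
  have hac : ∀ f, Continuous (a f) := fun f =>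
    (contDiff_average κ (locallyIntegrable_zeroExtension hΩ.isOpen f)).continuous
  have hlin : a (H1.val w) = a (H1.val (u m)) - a (H1.val (u n)) := by
    ext x
    have h1 : H1.val w = H1.val (u m) - H1.val (u n) := by
      rw [hw, ← valL_apply, map_sub, valL_apply, valL_apply]
    simp only [ha, Pi.sub_apply]
    rw [h1, average_zeroExtension_eq_inner κ hΩ.isOpen, average_zeroExtension_eq_inner κ hΩ.isOpen,
      average_zeroExtension_eq_inner κ hΩ.isOpen, inner_sub_left]
  have hzm : AEStronglyMeasurable (zeroExtension (H1.val w)) (volume.restrict A) :=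
    (stronglyMeasurable_zeroExtension hΩ.isOpen _).aestronglyMeasurable
  have hm' : ∀ f, AEStronglyMeasurable (a f) (volume.restrict A) := fun f =>
    (hac f).aestronglyMeasurable
  have hdecomp : zeroExtension (H1.val w) = ((a (H1.val (u m)) - a g) - (a (H1.val (u n)) - a g))
      - (a (H1.val w) - zeroExtension (H1.val w)) := by
    rw [hlin]; abel
  calc eLpNorm (zeroExtension (H1.val w)) 2 (volume.restrict A)
      ≤ (eLpNorm (a (H1.val (u m)) - a g) 2 (volume.restrict A) +
          eLpNorm (a (H1.val (u n)) - a g) 2 (volume.restrict A)) +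
        eLpNorm (a (H1.val w) - zeroExtension (H1.val w)) 2 (volume.restrict A) := by
        conv_lhs => rw [hdecomp]
        refine (eLpNorm_sub_le (((hm' _).sub (hm' _)).sub ((hm' _).sub (hm' _)))
          ((hm' _).sub hzm) one_le_two).trans ?_
        gcongr
        exact eLpNorm_sub_le ((hm' _).sub (hm' _)) ((hm' _).sub (hm' _)) one_le_two
    _ ≤ (ENNReal.ofReal (ε / 4) + ENNReal.ofReal (ε / 4)) + ENNReal.ofReal (ε / 2) := by
        refine add_le_add (add_le_add (hN m hm) (hN n hn)) ?_
        refine (averages_eLpNorm_sub_le κ hΩ.isOpen hΩ.isBounded hdense hA hseg w).trans ?_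
        rw [← ofReal_norm, ← ENNReal.ofReal_mul hρ0.le]
        refine ENNReal.ofReal_le_ofReal ?_
        calc ρ * ‖H1.grad w‖ ≤ ρ * (2 * C) := by gcongr
          _ ≤ ρ * (2 * (C + 1)) := by gcongr; linarith
          _ = ε / 2 := by rw [hρ]; field_simp; norm_num
    _ = ENNReal.ofReal ε := by
        rw [← ENNReal.ofReal_add (by positivity) (by positivity),
          ← ENNReal.ofReal_add (by positivity) (by positivity)]
        congr 1
        ring

/-- Rellich's theorem on a Lipschitz domain. -/
theorem exists_subseq_cauchy_val (hΩ : IsLipschitzDomain Ω) {u : ℕ → H1 Ω} {C : ℝ}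
    (hu : ∀ n, ‖u n‖ ≤ C) : ∃ φ : ℕ → ℕ, StrictMono φ ∧ ∀ ε > 0, ∃ N, ∀ m ≥ N, ∀ n ≥ N,
      ‖H1.val (u (φ m) - u (φ n))‖ < ε := by
  have hfact : Fact ((2 : ENNReal) ≠ ⊤) := ⟨by norm_num⟩
  have hval : ∀ n, ‖H1.val (u n)‖ ≤ C := by
    intro n
    have h1 := H1.norm_sq (u n)
    exact (le_of_sq_le_sq (by nlinarith [sq_nonneg ‖H1.grad (u n)‖]) (norm_nonneg _)).trans (hu n)
  obtain ⟨φ, hφ, g, hg⟩ := exists_weakly_convergent_subseq hval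
  refine ⟨φ, hφ, ?_⟩
  have hloc := fun p : closure Ω =>
    eLpNorm_local_cauchy hΩ (u := fun n => u (φ n)) (fun n => hu _) hg p.2
  choose r hr hloc using hloc
  obtain ⟨s, hs⟩ := hΩ.isBounded.isCompact_closure.elim_finite_subcover
    (fun p : closure Ω => Metric.ball (p : E d) (r p)) (fun _ => Metric.isOpen_ball)
    (fun p hp => mem_iUnion.2 ⟨⟨p, hp⟩, Metric.mem_ball_self (hr ⟨p, hp⟩)⟩)
  intro ε hε
  set a : ℝ := (ε / 2) ^ 2 / (s.card + 1) with ha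
  have ha0 : 0 < a := by positivity
  have hN := fun p => hloc p (Real.sqrt a) (Real.sqrt_pos.2 ha0)
  choose N hN using hN
  refine ⟨s.sup N, fun m hm n hn => ?_⟩
  set w := u (φ m) - u (φ n) with hw
  have hbound : ∫⁻ x in Ω, ‖zeroExtension (H1.val w) x‖ₑ ^ 2 ≤ ENNReal.ofReal ((ε / 2) ^ 2) := by
    have hcover : Ω ⊆ ⋃ p ∈ s, Ω ∩ Metric.ball (p : E d) (r p) := by
      intro x hx
      obtain ⟨p, hp, hxp⟩ := mem_iUnion₂.1 (hs (subset_closure hx))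
      exact mem_iUnion₂.2 ⟨p, hp, hx, hxp⟩
    calc ∫⁻ x in Ω, ‖zeroExtension (H1.val w) x‖ₑ ^ 2
        ≤ ∫⁻ x in ⋃ p ∈ s, Ω ∩ Metric.ball (p : E d) (r p), ‖zeroExtension (H1.val w) x‖ₑ ^ 2 :=
          lintegral_mono_set hcover
      _ ≤ ∑ p ∈ s, ∫⁻ x in Ω ∩ Metric.ball (p : E d) (r p),
            ‖zeroExtension (H1.val w) x‖ₑ ^ 2 := setLIntegral_biUnion_finset_le _ _ _
      _ ≤ ∑ _p ∈ s, ENNReal.ofReal a := by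
          refine Finset.sum_le_sum fun p hp => ?_
          have h1 := eLpNorm_two_le_iff.1 (hN p m ((Finset.le_sup hp).trans hm) n
            ((Finset.le_sup hp).trans hn))
          rwa [← ENNReal.ofReal_pow (Real.sqrt_nonneg _), Real.sq_sqrt ha0.le] at h1
      _ ≤ ENNReal.ofReal ((ε / 2) ^ 2) := by
          rw [Finset.sum_const, nsmul_eq_mul, ← ENNReal.ofReal_natCast,
            ← ENNReal.ofReal_mul (Nat.cast_nonneg _)]
          refine ENNReal.ofReal_le_ofReal ?_
          rw [ha, ← mul_div_assoc, div_le_iff₀ (by positivity)]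
          nlinarith [sq_nonneg (ε / 2)]
  have h1 := norm_sq_le_of_lintegral_le (zeroExtension_ae_eq hΩ.isOpen (H1.val w)).symm
    (sq_nonneg _) hbound
  have h2 : ‖H1.val w‖ ≤ ε / 2 := le_of_sq_le_sq h1 (by positivity)
  linarith

end Rellich

/-! ### Vanishing gradient on a connected domain -/

section ZeroGradient

variable {d : ℕ} {Ω : Set (E d)}

/-- By Tonelli some point `x₀` of the ball satisfies `f (x₀ + z) = f x₀` for almost every `z` of
norm below `2 r`, and such `x₀ + z` cover the ball of radius `r` about `p`. -/
lemma exists_ae_eq_const_of_translate {F : Type*} [NormedAddCommGroup F] [MeasurableSpace F]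
    [BorelSpace F] [SecondCountableTopology F] {μ : Measure F} [SFinite μ] [μ.IsOpenPosMeasure]
    [μ.IsAddRightInvariant] {f : F → ℝ} (hfm : StronglyMeasurable f) {p : F} {r : ℝ}
    (hr : 0 < r) (hz : ∀ z ∈ Metric.ball (0 : F) (2 * r),
      ∫⁻ x in Metric.ball p r, ‖f (x + z) - f x‖ₑ ^ 2 ∂μ = 0) :
    ∃ c, ∀ᵐ x ∂μ, x ∈ Metric.ball p r → f x = c := by
  have hmeas : Measurable fun q : F × F => ‖f (q.1 + q.2) - f q.1‖ₑ ^ 2 :=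
    (((hfm.comp_measurable measurable_add).sub
      (hfm.comp_measurable measurable_fst)).enorm).pow_const 2
  have hint : ∫⁻ x in Metric.ball p r, ∫⁻ z in Metric.ball (0 : F) (2 * r),
      ‖f (x + z) - f x‖ₑ ^ 2 ∂μ ∂μ = 0 := by
    rw [lintegral_lintegral_swap (f := fun x z => ‖f (x + z) - f x‖ₑ ^ 2) hmeas.aemeasurable,
      setLIntegral_congr_fun measurableSet_ball hz]
    simp
  have h0m : Measurable fun x => ∫⁻ z in Metric.ball (0 : F) (2 * r),
      ‖f (x + z) - f x‖ₑ ^ 2 ∂μ := hmeas.lintegral_prod_right'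
  have hint' := (lintegral_eq_zero_iff h0m).1 hint
  have hne : (ae (μ.restrict (Metric.ball p r))).NeBot := by
    rw [ae_neBot, Ne, Measure.restrict_eq_zero]
    exact (Metric.measure_ball_pos μ p hr).ne'
  obtain ⟨x₀, h0, hx₀⟩ := (hint'.and (ae_restrict_mem measurableSet_ball)).exists
  refine ⟨f x₀, ?_⟩
  have h1m : Measurable fun z => ‖f (x₀ + z) - f x₀‖ₑ ^ 2 :=
    (((hfm.measurable.comp (measurable_const_add x₀)).sub_const (f x₀)).enorm).pow_const 2
  have h0' : ∫⁻ z in Metric.ball (0 : F) (2 * r), ‖f (x₀ + z) - f x₀‖ₑ ^ 2 ∂μ = 0 := by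
    simpa only [Pi.zero_apply] using h0
  rw [lintegral_eq_zero_iff h1m] at h0'
  have h1 : ∀ᵐ z ∂μ, z ∈ Metric.ball (0 : F) (2 * r) → ‖f (x₀ + z) - f x₀‖ₑ ^ 2 = 0 :=
    (ae_restrict_iff' measurableSet_ball).1 h0'
  have h2 : ∀ᵐ x ∂μ, x - x₀ ∈ Metric.ball (0 : F) (2 * r) →
      ‖f (x₀ + (x - x₀)) - f x₀‖ₑ ^ 2 = 0 :=
    (measurePreserving_sub_right μ x₀).quasiMeasurePreserving.ae h1
  filter_upwards [h2] with x hx hxp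
  have h3 := hx (by
    rw [mem_ball_iff_norm] at hxp hx₀
    rw [mem_ball_zero_iff]
    calc ‖x - x₀‖ = ‖(x - p) - (x₀ - p)‖ := by congr 1; abel
      _ ≤ ‖x - p‖ + ‖x₀ - p‖ := norm_sub_le _ _
      _ < 2 * r := by linarith)
  simpa [sub_eq_zero] using h3

lemma exists_ae_eq_const_on_ball (hΩ : IsOpen Ω) (hb : Bornology.IsBounded Ω)
    (hdense : Dense (smoothElements Ω : Set (H1 Ω))) {u : H1 Ω} (hu : H1.grad u = 0) {p : E d}
    (hp : p ∈ Ω) : ∃ r > (0 : ℝ), ∃ c, ∀ᵐ x, x ∈ Metric.ball p r →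
      zeroExtension (H1.val u) x = c := by
  obtain ⟨R, hR, hball⟩ := Metric.isOpen_iff.1 hΩ p hp
  refine ⟨R / 3, by positivity, exists_ae_eq_const_of_translate
    (stronglyMeasurable_zeroExtension hΩ _) (by positivity) fun z hz => ?_⟩
  have h1 := eLpNorm_translate_sub_le hΩ hb hdense u (A := Metric.ball p (R / 3))
    measurableSet_ball (z := z) (fun x hx s hs => by
      refine hball ?_
      rw [mem_ball_iff_norm] at hx ⊢
      rw [mem_ball_zero_iff] at hz
      calc ‖x + s • z - p‖ = ‖(x - p) + s • z‖ := by congr 1; abel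
        _ ≤ ‖x - p‖ + ‖s • z‖ := norm_add_le _ _
        _ ≤ ‖x - p‖ + ‖z‖ := by
          rw [norm_smul, Real.norm_of_nonneg hs.1]
          gcongr
          exact mul_le_of_le_one_left (norm_nonneg _) hs.2
        _ < R := by linarith)
  rw [hu, enorm_zero, mul_zero, eLpNorm_two_le_iff] at h1
  simpa using h1

/-- A function which is locally constant almost everywhere on a connected open set is constant
almost everywhere. -/
lemma ae_eq_const_of_local (hΩ : IsOpen Ω) (hc : IsConnected Ω) {f : E d → ℝ}
    (h : ∀ p ∈ Ω, ∃ r > (0 : ℝ), ∃ c, ∀ᵐ x, x ∈ Metric.ball p r → f x = c) :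
    ∃ c, ∀ᵐ x ∂(volume.restrict Ω), f x = c := by
  have h' : ∀ p : E d, ∃ r c, p ∈ Ω → 0 < r ∧ ∀ᵐ x, x ∈ Metric.ball p r → f x = c := by
    intro p
    by_cases hp : p ∈ Ω
    · obtain ⟨r, hr, c, hc⟩ := h p hp
      exact ⟨r, c, fun _ => ⟨hr, hc⟩⟩
    · exact ⟨0, 0, fun hp' => absurd hp' hp⟩
  choose r c hrc using h'
  -- Two overlapping balls meet in a set of positive measure, so their constants agree: `c` is
  -- locally constant on `Ω`.
  have hloc : ∀ x ∈ Ω, ∀ᶠ y in 𝓝[Ω] x, c x = c y := by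
    intro x hx
    have hmem : Metric.ball x (r x) ∩ Ω ∈ 𝓝[Ω] x :=
      inter_mem (mem_nhdsWithin_of_mem_nhds (Metric.ball_mem_nhds x (hrc x hx).1))
        self_mem_nhdsWithin
    filter_upwards [hmem] with y hy
    have hpos : 0 < volume (Metric.ball x (r x) ∩ Metric.ball y (r y)) :=
      (Metric.isOpen_ball.inter Metric.isOpen_ball).measure_pos volume
        ⟨y, hy.1, Metric.mem_ball_self (hrc y hy.2).1⟩
    have hne : (ae (volume.restrict (Metric.ball x (r x) ∩ Metric.ball y (r y)))).NeBot := by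
      rw [ae_neBot, Ne, Measure.restrict_eq_zero]
      exact hpos.ne'
    have hz := ((hrc x hx).2.and (hrc y hy.2).2).filter_mono
      (ae_mono (Measure.restrict_le_self
        (s := Metric.ball x (r x) ∩ Metric.ball y (r y))))
    obtain ⟨z, ⟨hz1, hz2⟩, hz3⟩ := (hz.and
      (ae_restrict_mem (measurableSet_ball.inter measurableSet_ball))).exists
    rw [← hz1 hz3.1, hz2 hz3.2]
  obtain ⟨p, hp⟩ := hc.nonempty
  have hconst : ∀ y ∈ Ω, c p = c y := fun y hy =>
    hc.isPreconnected.induction₂ (fun a b => c a = c b) hloc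
      (fun _ _ _ _ _ _ h1 h2 => h1.trans h2) (fun _ _ _ _ h1 => h1.symm) hp hy
  refine ⟨c p, ?_⟩
  rw [ae_restrict_iff' hΩ.measurableSet]
  have hnull : volume ({x | f x ≠ c p} ∩ Ω) = 0 := by
    refine measure_null_of_locally_null _ fun x hx => ?_
    refine ⟨Metric.ball x (r x) ∩ ({x | f x ≠ c p} ∩ Ω),
      inter_mem (mem_nhdsWithin_of_mem_nhds (Metric.ball_mem_nhds x (hrc x hx.2).1))
        self_mem_nhdsWithin, ?_⟩
    refine measure_mono_null ?_ (hrc x hx.2).2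
    intro y hy hyf
    exact hy.2.1 ((hyf hy.1).trans (hconst x hx.2).symm)
  refine measure_mono_null ?_ hnull
  intro x hx
  simp only [mem_compl_iff, mem_ofPred_eq, not_forall] at hx
  exact ⟨hx.2, hx.1⟩

/-- On a connected domain, elements of `H¹` with zero gradient are constant. -/
theorem exists_val_ae_eq_const (hΩ : IsLipschitzDomain Ω) {u : H1 Ω} (hu : H1.grad u = 0) :
    ∃ c : ℝ, H1.val u =ᵐ[volume.restrict Ω] fun _ => c := by
  obtain ⟨c, hc⟩ := ae_eq_const_of_local hΩ.isOpen hΩ.isConnected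
    (f := zeroExtension (H1.val u)) fun p hp =>
      exists_ae_eq_const_on_ball hΩ.isOpen hΩ.isBounded (dense_smoothElements hΩ) hu hp
  exact ⟨c, (zeroExtension_ae_eq hΩ.isOpen _).symm.trans hc⟩

end ZeroGradient

/-! ### Graph coordinates and surface measure near a boundary point -/

section Graph

variable {d : ℕ} {v : E d}

lemma proj_orthogonal_add_smul (y : ↥((ℝ ∙ v)ᗮ)) (t : ℝ) :
    (ℝ ∙ v)ᗮ.orthogonalProjectionOnto ((y : E d) + t • v) = y := by
  rw [map_add, Submodule.orthogonalProjectionOnto_mem_subspace_eq_self, map_smul,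
    Submodule.orthogonalProjectionOnto_orthogonal_apply_eq_zero
      (Submodule.mem_span_singleton_self v), smul_zero, add_zero]

lemma inner_add_smul (hv : ‖v‖ = 1) (y : ↥((ℝ ∙ v)ᗮ)) (t : ℝ) : ⟪v, (y : E d) + t • v⟫_ℝ = t := by
  rw [inner_add_right, Submodule.mem_orthogonal_singleton_iff_inner_right.1 y.2, inner_smul_right,
    real_inner_self_eq_norm_sq, hv]
  ring

lemma proj_orthogonal_add_inner_smul (hv : ‖v‖ = 1) (x : E d) :
    ((ℝ ∙ v)ᗮ.orthogonalProjectionOnto x : E d) + ⟪v, x⟫_ℝ • v = x := by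
  have h := (ℝ ∙ v).starProjection_add_starProjection_orthogonal x
  rw [Submodule.starProjection_unit_singleton ℝ hv, add_comm] at h
  exact h

/-- Orthogonal coordinates with vertical direction `v`. -/
noncomputable def graphCoord (hv : ‖v‖ = 1) : (↥((ℝ ∙ v)ᗮ) × ℝ) ≃L[ℝ] E d :=
  ContinuousLinearEquiv.equivOfInverse
    ((ℝ ∙ v)ᗮ.subtypeL.coprod (ContinuousLinearMap.toSpanSingleton ℝ v))
    ((ℝ ∙ v)ᗮ.orthogonalProjectionOnto.prod (innerSL ℝ v))
    (fun q => Prod.ext (proj_orthogonal_add_smul q.1 q.2) (inner_add_smul hv q.1 q.2))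
    (proj_orthogonal_add_inner_smul hv)

lemma graphCoord_apply (hv : ‖v‖ = 1) (q : ↥((ℝ ∙ v)ᗮ) × ℝ) :
    graphCoord hv q = (q.1 : E d) + q.2 • v := rfl

/-- Uniqueness of Haar measure up to a factor. Only finiteness of the factor matters for the trace
estimate. -/
lemma exists_map_graphCoord (hv : ‖v‖ = 1) : ∃ c : NNReal,
    (volume : Measure (↥((ℝ ∙ v)ᗮ) × ℝ)).map (graphCoord hv) = c • volume := by
  have h0 : (volume : Measure (↥((ℝ ∙ v)ᗮ) × ℝ)).IsAddHaarMeasure :=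
    Measure.prod.instIsAddHaarMeasure _ _
  have h : ((volume : Measure (↥((ℝ ∙ v)ᗮ) × ℝ)).map (graphCoord hv)).IsAddHaarMeasure :=
    (graphCoord hv).isAddHaarMeasure_map _
  exact ⟨_, Measure.isAddLeftInvariant_eq_smul _ _⟩

lemma finrank_orthogonal_unit (hv : ‖v‖ = 1) : Module.finrank ℝ ↥((ℝ ∙ v)ᗮ) = d - 1 := by
  have h := Submodule.finrank_add_finrank_orthogonal (ℝ ∙ v)
  rw [finrank_span_singleton (by rintro rfl; simp at hv), finrank_euclideanSpace_fin] at h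
  omega

/-- The graph of `γ`. -/
def graphMap (v : E d) (γ : ↥((ℝ ∙ v)ᗮ) → ℝ) (y : ↥((ℝ ∙ v)ᗮ)) : E d := (y : E d) + γ y • v

lemma lipschitzWith_graphMap (hv : ‖v‖ = 1) {γ : ↥((ℝ ∙ v)ᗮ) → ℝ} {K : NNReal}
    (hγ : LipschitzWith K γ) : LipschitzWith (1 + K) (graphMap v γ) := by
  refine LipschitzWith.of_dist_le_mul fun y z => ?_
  have h1 := hγ.dist_le_mul y z
  rw [dist_eq_norm, dist_eq_norm] at h1
  rw [dist_eq_norm, dist_eq_norm]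
  calc ‖graphMap v γ y - graphMap v γ z‖ = ‖((y - z : ↥((ℝ ∙ v)ᗮ)) : E d) + (γ y - γ z) • v‖ := by
        congr 1
        simp only [graphMap, Submodule.coe_sub, sub_smul]
        abel
    _ ≤ ‖y - z‖ + ‖γ y - γ z‖ * ‖v‖ := by
        refine (norm_add_le _ _).trans (le_of_eq ?_)
        rw [norm_smul, Submodule.coe_norm]
    _ ≤ (1 + K : NNReal) * ‖y - z‖ := by
        rw [hv]; push_cast; linarith

lemma proj_graphMap (γ : ↥((ℝ ∙ v)ᗮ) → ℝ) (y : ↥((ℝ ∙ v)ᗮ)) :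
    (ℝ ∙ v)ᗮ.orthogonalProjectionOnto (graphMap v γ y) = y :=
  proj_orthogonal_add_smul y (γ y)

/-- The image of a set under a Lipschitz map, in terms of the Euclidean Hausdorff measure. -/
lemma LipschitzWith.euclideanHausdorffMeasure_image_le {X Y : Type*} [EMetricSpace X]
    [MeasurableSpace X] [BorelSpace X] [EMetricSpace Y] [MeasurableSpace Y] [BorelSpace Y]
    {K : NNReal} {f : X → Y} (hf : LipschitzWith K f) (n : ℕ) (s : Set X) :
    (Measure.euclideanHausdorffMeasure n : Measure Y) (f '' s) ≤
      (K : ENNReal) ^ n * (Measure.euclideanHausdorffMeasure n : Measure X) s := by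
  rw [Measure.euclideanHausdorffMeasure_def, Measure.euclideanHausdorffMeasure_def,
    Measure.smul_apply, Measure.smul_apply, ENNReal.smul_def, ENNReal.smul_def, smul_eq_mul,
    smul_eq_mul, mul_left_comm]
  gcongr
  simpa using hf.hausdorffMeasure_image_le (Nat.cast_nonneg n) s

lemma euclideanHausdorffMeasure_orthogonal (hv : ‖v‖ = 1) :
    (Measure.euclideanHausdorffMeasure (d - 1) : Measure ↥((ℝ ∙ v)ᗮ)) = volume := by
  rw [← finrank_orthogonal_unit hv]
  exact InnerProductSpace.euclideanHausdorffMeasure_eq_volume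

variable {Ω : Set (E d)} {γ : ↥((ℝ ∙ v)ᗮ) → ℝ} {K : NNReal} {p : E d} {ρ : ℝ}

/-- A frontier point is not above the graph, as it would lie in the open set `Ω`; nor below it, as a
whole neighbourhood would then miss `Ω`. -/
lemma inner_eq_of_mem_frontier (hΩ : IsOpen Ω) (hγ : Continuous γ)
    (hU : ∀ x ∈ Metric.ball p ρ,
      (x ∈ Ω ↔ γ ((ℝ ∙ v)ᗮ.orthogonalProjectionOnto x) < ⟪v, x⟫_ℝ)) {x : E d}
    (hx : x ∈ Metric.ball p ρ) (hxf : x ∈ frontier Ω) :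
    ⟪v, x⟫_ℝ = γ ((ℝ ∙ v)ᗮ.orthogonalProjectionOnto x) := by
  rw [hΩ.frontier_eq] at hxf
  refine le_antisymm (not_lt.1 fun h => hxf.2 ((hU x hx).2 h)) (not_lt.1 fun h => ?_)
  have hopen : IsOpen {z : E d | ⟪v, z⟫_ℝ < γ ((ℝ ∙ v)ᗮ.orthogonalProjectionOnto z)} :=
    isOpen_lt (by fun_prop) (by fun_prop)
  obtain ⟨z, ⟨hz1, hz2⟩, hz3⟩ := mem_closure_iff.1 hxf.1 _ (hopen.inter Metric.isOpen_ball) ⟨h, hx⟩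
  exact lt_asymm hz1 ((hU z hz2).1 hz3)

lemma graphMap_mem_frontier (hv : ‖v‖ = 1)
    (hU : ∀ x ∈ Metric.ball p ρ,
      (x ∈ Ω ↔ γ ((ℝ ∙ v)ᗮ.orthogonalProjectionOnto x) < ⟪v, x⟫_ℝ)) {y : ↥((ℝ ∙ v)ᗮ)}
    (hy : graphMap v γ y ∈ Metric.ball p ρ) : graphMap v γ y ∈ frontier Ω := by
  rw [frontier, Set.mem_sdiff]
  constructor
  · rw [mem_closure_iff_nhds]
    intro t ht
    have hcont : Tendsto (fun s : ℝ => (y : E d) + (γ y + s) • v) (𝓝[>] 0)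
        (𝓝 (graphMap v γ y)) := by
      have : Continuous fun s : ℝ => (y : E d) + (γ y + s) • v := by fun_prop
      have h := this.tendsto 0
      simp only [add_zero] at h
      exact h.mono_left nhdsWithin_le_nhds
    obtain ⟨s, ⟨hs1, hs2⟩, hs3⟩ := ((hcont.eventually ht).and
      (hcont.eventually (Metric.isOpen_ball.mem_nhds hy))).and self_mem_nhdsWithin |>.exists
    refine ⟨_, hs1, (hU _ hs2).2 ?_⟩
    rw [proj_orthogonal_add_smul, inner_add_smul hv]
    have : 0 < s := hs3
    linarith
  · intro h
    have := (hU _ hy).1 (interior_subset h)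
    rw [proj_graphMap, graphMap, inner_add_smul hv] at this
    exact lt_irrefl _ this

/-- The boundary piece is a Lipschitz image of part of a hyperplane, on which the Hausdorff measure
is Lebesgue measure. An upper bound suffices for the trace estimate, so no area formula enters. -/
lemma surfaceMeasure_restrict_ball_le (hΩ : IsOpen Ω) (hv : ‖v‖ = 1) (hγ : LipschitzWith K γ)
    (hU : ∀ x ∈ Metric.ball p ρ,
      (x ∈ Ω ↔ γ ((ℝ ∙ v)ᗮ.orthogonalProjectionOnto x) < ⟪v, x⟫_ℝ)) :
    (surfaceMeasure Ω).restrict (Metric.ball p ρ) ≤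
      ((1 + K : NNReal) : ENNReal) ^ (d - 1) • (volume.map (graphMap v γ)) := by
  have hG := lipschitzWith_graphMap hv hγ
  refine Measure.le_iff.2 fun s hs => ?_
  rw [Measure.restrict_apply hs, surfaceMeasure,
    Measure.restrict_apply (hs.inter measurableSet_ball), Measure.smul_apply,
    Measure.map_apply hG.continuous.measurable hs, smul_eq_mul,
    ← euclideanHausdorffMeasure_orthogonal hv]
  refine (measure_mono ?_).trans (LipschitzWith.euclideanHausdorffMeasure_image_le hG _ _)
  rintro x ⟨⟨hxs, hxb⟩, hxf⟩
  have hx : graphMap v γ ((ℝ ∙ v)ᗮ.orthogonalProjectionOnto x) = x := by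
    rw [graphMap, ← inner_eq_of_mem_frontier hΩ hγ.continuous hU hxb hxf,
      proj_orthogonal_add_inner_smul hv]
  exact ⟨_, by rw [mem_preimage, hx]; exact hxs, hx⟩

/-- Projection to the hyperplane does not increase Hausdorff measure and maps the boundary piece
over `V` onto `V`, a non-empty open set. -/
lemma surfaceMeasure_ball_pos_of_graph (hv : ‖v‖ = 1) (hΩ : IsOpen Ω) (hγ : LipschitzWith K γ)
    (hρ : 0 < ρ) (hp : p ∈ frontier Ω)
    (hU : ∀ x ∈ Metric.ball p ρ,
      (x ∈ Ω ↔ γ ((ℝ ∙ v)ᗮ.orthogonalProjectionOnto x) < ⟪v, x⟫_ℝ)) :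
    0 < surfaceMeasure Ω (Metric.ball p ρ) := by
  have hG := (lipschitzWith_graphMap hv hγ).continuous
  set V := graphMap v γ ⁻¹' Metric.ball p ρ with hV
  have hVpos : 0 < volume V := by
    refine (Metric.isOpen_ball.preimage hG).measure_pos volume
      ⟨(ℝ ∙ v)ᗮ.orthogonalProjectionOnto p, ?_⟩
    rw [mem_preimage, graphMap, ← inner_eq_of_mem_frontier hΩ hγ.continuous hU
      (Metric.mem_ball_self hρ) hp, proj_orthogonal_add_inner_smul hv]
    exact Metric.mem_ball_self hρ
  have himage : (ℝ ∙ v)ᗮ.orthogonalProjectionOnto '' (graphMap v γ '' V) = V := by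
    rw [image_image]
    simp only [proj_graphMap, image_id']
  have hle := LipschitzWith.euclideanHausdorffMeasure_image_le
    ((ℝ ∙ v)ᗮ.lipschitzWith_orthogonalProjectionOnto) (d - 1) (graphMap v γ '' V)
  rw [himage, ENNReal.coe_one, one_pow, one_mul, euclideanHausdorffMeasure_orthogonal hv] at hle
  refine hVpos.trans_le (hle.trans ?_)
  rw [surfaceMeasure, Measure.restrict_apply measurableSet_ball]
  refine measure_mono ?_
  rintro _ ⟨y, hy, rfl⟩
  exact ⟨hy, graphMap_mem_frontier hv hU hy⟩

/-- One-dimensional trace estimate. -/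
lemma enorm_sq_le_lintegral_Ioi {h : ℝ → ℝ} (hh : ContDiff ℝ 1 h) (hc : HasCompactSupport h)
    (a : ℝ) : ‖h a‖ₑ ^ 2 ≤ ∫⁻ t in Ioi a, 2 * (‖h t‖ₑ * ‖deriv h t‖ₑ) := by
  have h2 : HasCompactSupport fun t => h t ^ 2 := hc.comp_left (g := fun x : ℝ => x ^ 2) (by simp)
  have h3 := h2.integral_Ioi_deriv_eq (hh.pow 2) a
  have h4 : ‖h a‖ₑ ^ 2 = ‖∫ t in Ioi a, deriv (fun t => h t ^ 2) t‖ₑ := by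
    rw [h3, enorm_neg, enorm_pow]
  rw [h4]
  refine (enorm_integral_le_lintegral_enorm _).trans (lintegral_mono fun t => ?_)
  have hd : deriv (fun t => h t ^ 2) t = 2 * (h t * deriv h t) := by
    have := ((hh.differentiable one_ne_zero t).hasDerivAt.pow 2).deriv
    rw [show (fun t => h t ^ 2) = h ^ 2 from rfl, this]; push_cast; ring
  rw [hd, enorm_mul, enorm_mul]
  gcongr
  rw [← ofReal_norm]
  simp

/-- Trace estimate for functions supported near a boundary point. -/
lemma lintegral_graphMap_le (hv : ‖v‖ = 1) (hΩ : IsOpen Ω)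
    (hU : ∀ x ∈ Metric.ball p ρ,
      (x ∈ Ω ↔ γ ((ℝ ∙ v)ᗮ.orthogonalProjectionOnto x) < ⟪v, x⟫_ℝ)) :
    ∃ C : ENNReal, C ≠ ⊤ ∧ ∀ ψ : E d → ℝ, ContDiff ℝ 1 ψ → HasCompactSupport ψ →
      tsupport ψ ⊆ Metric.ball p ρ →
      ∫⁻ y, ‖ψ (graphMap v γ y)‖ₑ ^ 2 ≤ C * ∫⁻ x in Ω, ‖ψ x‖ₑ * ‖fderiv ℝ ψ x‖ₑ := by
  obtain ⟨c, hmap⟩ := exists_map_graphCoord hv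
  refine ⟨2 * c, by finiteness, fun ψ hψ hψc hsupp => ?_⟩
  set F : E d → ENNReal := Ω.indicator fun x => ‖ψ x‖ₑ * ‖fderiv ℝ ψ x‖ₑ with hF
  have hFm : Measurable F := by
    have h1 : Continuous (fderiv ℝ ψ) := hψ.continuous_fderiv one_ne_zero
    exact ((hψ.continuous.enorm.measurable).mul h1.enorm.measurable).indicator hΩ.measurableSet
  -- On the vertical line through `y`, a point above height `γ y` is in `Ω` or outside the support
  -- of `ψ`, so the half-line integral only sees `Ω`.
  have hpt : ∀ y : ↥((ℝ ∙ v)ᗮ), ‖ψ (graphMap v γ y)‖ₑ ^ 2 ≤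
      ∫⁻ t, 2 * F (graphCoord hv (y, t)) := by
    intro y
    have haff : ContDiff ℝ 1 fun t : ℝ => (y : E d) + t • v := by fun_prop
    have hcl : HasCompactSupport fun t : ℝ => ψ ((y : E d) + t • v) := by
      refine hψc.comp_isClosedEmbedding (g := fun t : ℝ => (y : E d) + t • v) ?_
      refine (Isometry.isClosedEmbedding (Isometry.of_dist_eq fun s t => ?_))
      rw [dist_add_left, dist_eq_norm, ← sub_smul, norm_smul, hv, mul_one, dist_eq_norm]
    have h1 := enorm_sq_le_lintegral_Ioi (hψ.comp haff) hcl (γ y)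
    refine h1.trans ?_
    rw [← lintegral_indicator measurableSet_Ioi]
    refine lintegral_mono fun t => ?_
    by_cases ht : t ∈ Ioi (γ y)
    · rw [indicator_of_mem ht]
      gcongr
      rw [graphCoord_apply]
      simp only [Function.comp_apply]
      by_cases hs : (y : E d) + t • v ∈ tsupport ψ
      · have hmem : (y : E d) + t • v ∈ Ω := by
          rw [hU _ (hsupp hs), proj_orthogonal_add_smul, inner_add_smul hv]
          exact ht
        rw [hF, indicator_of_mem hmem]
        gcongr
        have hd : HasDerivAt (fun t : ℝ => ψ ((y : E d) + t • v))
            (fderiv ℝ ψ ((y : E d) + t • v) v) t := by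
          have ha : HasDerivAt (fun t : ℝ => (y : E d) + t • v) v t := by
            simpa using ((hasDerivAt_id t).smul_const v).const_add (y : E d)
          exact ((hψ.differentiable one_ne_zero _).hasFDerivAt).comp_hasDerivAt t ha
        have hd' : deriv (ψ ∘ fun t : ℝ => (y : E d) + t • v) t =
          fderiv ℝ ψ ((y : E d) + t • v) v := hd.deriv
        rw [hd', ← ofReal_norm, ← ofReal_norm]
        refine ENNReal.ofReal_le_ofReal ?_
        simpa [hv] using (fderiv ℝ ψ ((y : E d) + t • v)).le_opNorm v
      · rw [image_eq_zero_of_notMem_tsupport hs, enorm_zero, zero_mul]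
        exact zero_le
    · rw [indicator_of_notMem ht]
      exact zero_le
  calc ∫⁻ y, ‖ψ (graphMap v γ y)‖ₑ ^ 2 ≤ ∫⁻ y, ∫⁻ t, 2 * F (graphCoord hv (y, t)) :=
        lintegral_mono hpt
    _ = ∫⁻ q, 2 * F (graphCoord hv q) := by
        rw [Measure.volume_eq_prod, lintegral_prod _ (by
          exact ((hFm.comp (graphCoord hv).continuous.measurable).const_mul 2).aemeasurable)]
    _ = 2 * c * ∫⁻ x in Ω, ‖ψ x‖ₑ * ‖fderiv ℝ ψ x‖ₑ := by
        rw [lintegral_const_mul (f := fun q => F (graphCoord hv q)) _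
            (hFm.comp (graphCoord hv).continuous.measurable),
          ← lintegral_map hFm (graphCoord hv).continuous.measurable, hmap,
          lintegral_smul_measure, hF, lintegral_indicator hΩ.measurableSet, ENNReal.smul_def,
          smul_eq_mul, mul_assoc]

end Graph

/-! ### The trace inequality for smooth functions -/

section TraceEstimate

variable {d : ℕ} {Ω : Set (E d)}

lemma IsLipschitzDomain.exists_graph (hΩ : IsLipschitzDomain Ω) {p : E d} (hp : p ∈ frontier Ω) :
    ∃ v : E d, ‖v‖ = 1 ∧ ∃ (γ : ↥((ℝ ∙ v)ᗮ) → ℝ) (K : NNReal), LipschitzWith K γ ∧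
      ∃ ρ > (0 : ℝ), ∀ x ∈ Metric.ball p ρ,
        (x ∈ Ω ↔ γ ((ℝ ∙ v)ᗮ.orthogonalProjectionOnto x) < ⟪v, x⟫_ℝ) := by
  obtain ⟨v, hv, γ, K, hγ, U, hU, h⟩ := hΩ.lipschitz p hp
  obtain ⟨ρ, hρ, hball⟩ := Metric.mem_nhds_iff.1 hU
  exact ⟨v, hv, γ, K, hγ, ρ, hρ, fun x hx => h x (hball hx)⟩

lemma surfaceMeasure_ball_pos (hΩ : IsLipschitzDomain Ω) {p : E d} (hp : p ∈ frontier Ω) {r : ℝ}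
    (hr : 0 < r) : 0 < surfaceMeasure Ω (Metric.ball p r) := by
  obtain ⟨v, hv, γ, K, hγ, ρ, hρ, hU⟩ := hΩ.exists_graph hp
  refine (surfaceMeasure_ball_pos_of_graph hv hΩ.isOpen hγ (lt_min hρ hr) hp fun x hx =>
    hU x (Metric.ball_subset_ball (min_le_left _ _) hx)).trans_le
    (measure_mono (Metric.ball_subset_ball (min_le_right _ _)))

/-- Apply the graph estimate to `χ φ`, with `χ` equal to 1 on the smaller ball; the bound `B` on the
derivative of `χ` enters through the product rule. Keeping the product of `φ` with its derivative,
instead of a sum of squares, is what later makes the trace compact. -/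
lemma exists_local_trace_le (hΩ : IsLipschitzDomain Ω) {p : E d} (hp : p ∈ frontier Ω) :
    ∃ r > (0 : ℝ), ∃ C : ENNReal, C ≠ ⊤ ∧ ∀ φ : E d → ℝ, ContDiff ℝ 1 φ →
      ∫⁻ x in Metric.ball p r, ‖φ x‖ₑ ^ 2 ∂(surfaceMeasure Ω) ≤
        C * ∫⁻ x in Ω, ‖φ x‖ₑ * (‖φ x‖ₑ + ‖fderiv ℝ φ x‖ₑ) := by
  obtain ⟨v, hv, γ, K, hγ, ρ, hρ, hU⟩ := hΩ.exists_graph hp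
  obtain ⟨C, hC, htr⟩ := lintegral_graphMap_le hv hΩ.isOpen hU
  let χ : ContDiffBump p := ⟨ρ / 4, ρ / 2, by positivity, by linarith⟩
  have hχ : ContDiff ℝ 1 χ := χ.contDiff
  obtain ⟨B, hB⟩ := (χ.hasCompactSupport.fderiv (𝕜 := ℝ)).exists_bound_of_continuous
    (hχ.continuous_fderiv one_ne_zero)
  have hB0 : 0 ≤ B := (norm_nonneg _).trans (hB p)
  set A : ENNReal := ((1 + K : NNReal) : ENNReal) ^ (d - 1) with hA
  refine ⟨ρ / 4, by positivity, A * (C * ENNReal.ofReal (B + 1)), by finiteness, fun φ hφ => ?_⟩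
  set ψ : E d → ℝ := fun x => χ x * φ x with hψ
  have hψc : ContDiff ℝ 1 ψ := hχ.mul hφ
  have hψs : tsupport ψ ⊆ tsupport χ := closure_mono (Function.support_mul_subset_left _ _)
  have hψcs : HasCompactSupport ψ := χ.hasCompactSupport.mul_right
  have hsub : tsupport ψ ⊆ Metric.ball p ρ := by
    refine hψs.trans ?_
    rw [χ.tsupport_eq]
    exact Metric.closedBall_subset_ball (by change ρ / 2 < ρ; linarith)
  have hψm : Measurable fun x => ‖ψ x‖ₑ ^ 2 := (hψc.continuous.enorm.measurable).pow_const 2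
  have hd : ∀ x, ‖ψ x‖ₑ * ‖fderiv ℝ ψ x‖ₑ ≤
      ENNReal.ofReal (B + 1) * (‖φ x‖ₑ * (‖φ x‖ₑ + ‖fderiv ℝ φ x‖ₑ)) := by
    intro x
    have h1 : fderiv ℝ ψ x = χ x • fderiv ℝ φ x + φ x • fderiv ℝ χ x :=
      fderiv_fun_mul (hχ.differentiable one_ne_zero x) (hφ.differentiable one_ne_zero x)
    have h2 : ‖fderiv ℝ ψ x‖ ≤ (B + 1) * (‖φ x‖ + ‖fderiv ℝ φ x‖) := by
      rw [h1]
      refine (norm_add_le _ _).trans ?_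
      rw [norm_smul, norm_smul, Real.norm_of_nonneg χ.nonneg]
      nlinarith [χ.le_one (x := x), χ.nonneg (x := x), hB x, norm_nonneg (φ x),
        norm_nonneg (fderiv ℝ φ x), mul_le_mul_of_nonneg_left (hB x) (norm_nonneg (φ x)),
        mul_le_mul_of_nonneg_right (χ.le_one (x := x)) (norm_nonneg (fderiv ℝ φ x)),
        mul_nonneg hB0 (norm_nonneg (fderiv ℝ φ x))]
    have h3 : ‖ψ x‖ ≤ ‖φ x‖ := by
      rw [hψ, norm_mul, Real.norm_of_nonneg χ.nonneg]
      exact mul_le_of_le_one_left (norm_nonneg _) χ.le_one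
    rw [← ofReal_norm, ← ofReal_norm, ← ofReal_norm, ← ofReal_norm,
      ← ENNReal.ofReal_add (by positivity) (by positivity), ← ENNReal.ofReal_mul (by positivity),
      ← ENNReal.ofReal_mul (by positivity), ← ENNReal.ofReal_mul (by positivity)]
    refine ENNReal.ofReal_le_ofReal ?_
    calc ‖ψ x‖ * ‖fderiv ℝ ψ x‖ ≤ ‖φ x‖ * ((B + 1) * (‖φ x‖ + ‖fderiv ℝ φ x‖)) := by gcongr
      _ = _ := by ring
  calc ∫⁻ x in Metric.ball p (ρ / 4), ‖φ x‖ₑ ^ 2 ∂(surfaceMeasure Ω)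
      ≤ ∫⁻ x in Metric.ball p ρ, ‖ψ x‖ₑ ^ 2 ∂(surfaceMeasure Ω) := by
        refine le_trans (le_of_eq ?_) (lintegral_mono_set
          (Metric.ball_subset_ball (show ρ / 4 ≤ ρ by linarith)))
        refine setLIntegral_congr_fun measurableSet_ball fun x hx => ?_
        have : χ x = 1 := χ.one_of_mem_closedBall (Metric.ball_subset_closedBall hx)
        simp only [hψ, this, one_mul]
    _ ≤ ∫⁻ x, ‖ψ x‖ₑ ^ 2 ∂(A • (volume.map (graphMap v γ))) :=
        lintegral_mono' (surfaceMeasure_restrict_ball_le hΩ.isOpen hv hγ hU) le_rfl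
    _ = A * ∫⁻ y, ‖ψ (graphMap v γ y)‖ₑ ^ 2 := by
        rw [lintegral_smul_measure, smul_eq_mul,
          lintegral_map hψm (lipschitzWith_graphMap hv hγ).continuous.measurable]
    _ ≤ A * (C * ∫⁻ x in Ω, ‖ψ x‖ₑ * ‖fderiv ℝ ψ x‖ₑ) := by
        gcongr
        exact htr ψ hψc hψcs hsub
    _ ≤ A * (C * ∫⁻ x in Ω,
          ENNReal.ofReal (B + 1) * (‖φ x‖ₑ * (‖φ x‖ₑ + ‖fderiv ℝ φ x‖ₑ))) := by
        refine mul_le_mul_right (mul_le_mul_right (lintegral_mono fun x => hd x) _) _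
    _ = _ := by
        rw [lintegral_const_mul' _ _ ENNReal.ofReal_ne_top]
        ring

lemma surfaceMeasure_compl_frontier : surfaceMeasure Ω (frontier Ω)ᶜ = 0 := by
  rw [surfaceMeasure, Measure.restrict_apply isClosed_frontier.measurableSet.compl,
    compl_inter_self, measure_empty]

lemma exists_trace_le (hΩ : IsLipschitzDomain Ω) :
    ∃ C : ENNReal, C ≠ ⊤ ∧ ∀ φ : E d → ℝ, ContDiff ℝ 1 φ →
      ∫⁻ x, ‖φ x‖ₑ ^ 2 ∂(surfaceMeasure Ω) ≤
        C * ∫⁻ x in Ω, ‖φ x‖ₑ * (‖φ x‖ₑ + ‖fderiv ℝ φ x‖ₑ) := by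
  have hloc := fun p : frontier Ω => exists_local_trace_le hΩ p.2
  choose r hr C hC hloc using hloc
  have hcomp : IsCompact (frontier Ω) :=
    hΩ.isBounded.isCompact_closure.of_isClosed_subset isClosed_frontier frontier_subset_closure
  obtain ⟨s, hs⟩ := hcomp.elim_finite_subcover
    (fun p : frontier Ω => Metric.ball (p : E d) (r p)) (fun _ => Metric.isOpen_ball)
    (fun p hp => mem_iUnion.2 ⟨⟨p, hp⟩, Metric.mem_ball_self (hr ⟨p, hp⟩)⟩)
  refine ⟨∑ p ∈ s, C p, ENNReal.sum_ne_top.2 fun p _ => hC p, fun φ hφ => ?_⟩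
  have hae : (univ : Set (E d)) =ᵐ[surfaceMeasure Ω] frontier Ω :=
    (eventuallyEq_univ.2 (mem_ae_iff.2 surfaceMeasure_compl_frontier)).symm
  calc ∫⁻ x, ‖φ x‖ₑ ^ 2 ∂(surfaceMeasure Ω)
      = ∫⁻ x in frontier Ω, ‖φ x‖ₑ ^ 2 ∂(surfaceMeasure Ω) := by
        rw [← setLIntegral_congr hae, setLIntegral_univ]
    _ ≤ ∫⁻ x in ⋃ p ∈ s, Metric.ball (p : E d) (r p), ‖φ x‖ₑ ^ 2 ∂(surfaceMeasure Ω) :=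
        lintegral_mono_set hs
    _ ≤ ∑ p ∈ s, ∫⁻ x in Metric.ball (p : E d) (r p), ‖φ x‖ₑ ^ 2 ∂(surfaceMeasure Ω) :=
        setLIntegral_biUnion_finset_le _ _ _
    _ ≤ ∑ p ∈ s, C p * ∫⁻ x in Ω, ‖φ x‖ₑ * (‖φ x‖ₑ + ‖fderiv ℝ φ x‖ₑ) :=
        Finset.sum_le_sum fun p _ => hloc p φ hφ
    _ = _ := by rw [Finset.sum_mul]

lemma lintegral_enorm_mul_le {X F : Type*} [MeasurableSpace X] [NormedAddCommGroup F]
    {μ : Measure X} {f : X → ℝ} {g : X → F} (hf : AEStronglyMeasurable f μ)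
    (hg : AEStronglyMeasurable g μ) :
    ∫⁻ x, ‖f x‖ₑ * ‖g x‖ₑ ∂μ ≤ eLpNorm f 2 μ * eLpNorm g 2 μ := by
  have h := ENNReal.lintegral_mul_le_Lp_mul_Lq μ Real.HolderConjugate.two_two hf.enorm hg.enorm
  refine h.trans (le_of_eq ?_)
  rw [eLpNorm_eq_lintegral_rpow_enorm_toReal two_ne_zero (by simp),
    eLpNorm_eq_lintegral_rpow_enorm_toReal two_ne_zero (by simp)]
  simp

/-- Boundary values of smooth functions are controlled by the `H¹` norm. -/
lemma exists_lintegral_surface_le (hΩ : IsLipschitzDomain Ω) :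
    ∃ C : ℝ, 0 ≤ C ∧ ∀ (u : H1 Ω) (φ : E d → ℝ), ContDiff ℝ ∞ φ →
      H1.val u =ᵐ[volume.restrict Ω] φ → ∫⁻ x, ‖φ x‖ₑ ^ 2 ∂(surfaceMeasure Ω) ≤
        ENNReal.ofReal (C * (‖H1.val u‖ * ‖u‖)) := by
  obtain ⟨C, hC, h⟩ := exists_trace_le hΩ
  refine ⟨C.toReal * 2, by positivity, fun u φ hφ hu => ?_⟩
  refine (h φ (hφ.of_le (by simp))).trans ?_
  have hg := H1.grad_ae_eq_gradient hΩ.isOpen hΩ.isBounded hφ hu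
  have h1 : ∫⁻ x in Ω, ‖φ x‖ₑ * (‖φ x‖ₑ + ‖fderiv ℝ φ x‖ₑ) =
      (∫⁻ x in Ω, ‖H1.val u x‖ₑ * ‖H1.val u x‖ₑ) + ∫⁻ x in Ω, ‖H1.val u x‖ₑ * ‖H1.grad u x‖ₑ := by
    have hm : AEMeasurable (fun x => ‖H1.val u x‖ₑ * ‖H1.val u x‖ₑ) (volume.restrict Ω) :=
      (Lp.aestronglyMeasurable _).enorm.mul (Lp.aestronglyMeasurable _).enorm
    rw [← lintegral_add_left' hm]
    refine lintegral_congr_ae ?_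
    filter_upwards [hu, hg] with x hx hx'
    rw [hx, hx', ← mul_add, ← ofReal_norm (gradient φ x), norm_gradient, ofReal_norm]
  rw [h1]
  have h2 := lintegral_enorm_mul_le (Lp.aestronglyMeasurable (H1.val u))
    (Lp.aestronglyMeasurable (H1.val u))
  have h3 := lintegral_enorm_mul_le (Lp.aestronglyMeasurable (H1.val u))
    (Lp.aestronglyMeasurable (H1.grad u))
  rw [← Lp.enorm_def, ← ofReal_norm, ← ENNReal.ofReal_mul (norm_nonneg _)] at h2
  rw [← Lp.enorm_def, ← Lp.enorm_def, ← ofReal_norm, ← ofReal_norm,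
    ← ENNReal.ofReal_mul (norm_nonneg _)] at h3
  calc C * _ ≤ C * (ENNReal.ofReal (‖H1.val u‖ * ‖H1.val u‖) +
        ENNReal.ofReal (‖H1.val u‖ * ‖H1.grad u‖)) := by gcongr
    _ = ENNReal.ofReal (C.toReal * (‖H1.val u‖ * ‖H1.val u‖ + ‖H1.val u‖ * ‖H1.grad u‖)) := by
        rw [← ENNReal.ofReal_add (by positivity) (by positivity),
          ENNReal.ofReal_mul ENNReal.toReal_nonneg, ENNReal.ofReal_toReal hC]
    _ ≤ _ := by
        refine ENNReal.ofReal_le_ofReal ?_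
        have h4 := H1.norm_sq u
        have h5 : ‖H1.val u‖ ≤ ‖u‖ :=
          le_of_sq_le_sq (by nlinarith [sq_nonneg ‖H1.grad u‖]) (norm_nonneg _)
        have h6 : ‖H1.grad u‖ ≤ ‖u‖ :=
          le_of_sq_le_sq (by nlinarith [sq_nonneg ‖H1.val u‖]) (norm_nonneg _)
        rw [mul_assoc]
        gcongr
        nlinarith [norm_nonneg (H1.val u)]

end TraceEstimate

/-! ### Construction of the trace operator -/

section TraceOperator

variable {d : ℕ} {Ω : Set (E d)}

lemma memLp_surface (hΩ : IsLipschitzDomain Ω) {u : H1 Ω} {φ : E d → ℝ} (hφ : ContDiff ℝ ∞ φ)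
    (hu : H1.val u =ᵐ[volume.restrict Ω] φ) : MemLp φ 2 (surfaceMeasure Ω) := by
  obtain ⟨C, -, h⟩ := exists_lintegral_surface_le hΩ
  exact memLp_two_of_lintegral_lt_top hφ.continuous.aestronglyMeasurable
    ((h u φ hφ hu).trans_lt ENNReal.ofReal_lt_top)

/-- `φ - ψ` is a smooth representative of `0` in `H¹(Ω)`, so the boundary estimate makes its
boundary values vanish. Boundary values are thus independent of the representative. -/
lemma ae_eq_surface_of_ae_eq (hΩ : IsLipschitzDomain Ω) {φ ψ : E d → ℝ} (hφ : ContDiff ℝ ∞ φ)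
    (hψ : ContDiff ℝ ∞ ψ) (h : φ =ᵐ[volume.restrict Ω] ψ) : φ =ᵐ[surfaceMeasure Ω] ψ := by
  obtain ⟨C, -, hC⟩ := exists_lintegral_surface_le hΩ
  have h0 : H1.val (0 : H1 Ω) =ᵐ[volume.restrict Ω] fun x => φ x - ψ x := by
    have h1 : (H1.val (0 : H1 Ω) : E d → ℝ) =ᵐ[volume.restrict Ω] 0 := Lp.coeFn_zero _ _ _
    filter_upwards [h1, h] with x hx hx'
    rw [hx, hx', sub_self, Pi.zero_apply]
  have h1 := hC 0 _ (hφ.sub hψ) h0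
  rw [norm_zero, mul_zero, mul_zero, ENNReal.ofReal_zero, nonpos_iff_eq_zero,
    lintegral_eq_zero_iff (((hφ.sub hψ).continuous.enorm.measurable).pow_const 2)] at h1
  filter_upwards [h1] with x hx
  simpa [sub_eq_zero] using hx

/-- A smooth representative. -/
noncomputable def smoothRep (w : smoothElements Ω) : E d → ℝ := w.2.choose

lemma contDiff_smoothRep (w : smoothElements Ω) : ContDiff ℝ ∞ (smoothRep w) :=
  w.2.choose_spec.1

lemma val_ae_eq_smoothRep (w : smoothElements Ω) :
    H1.val (w : H1 Ω) =ᵐ[volume.restrict Ω] smoothRep w := w.2.choose_spec.2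

/-- Boundary values of functions smooth up to the boundary. -/
noncomputable def boundaryValue (hΩ : IsLipschitzDomain Ω) (w : smoothElements Ω) :
    Lp ℝ 2 (surfaceMeasure Ω) :=
  (memLp_surface hΩ (contDiff_smoothRep w) (val_ae_eq_smoothRep w)).toLp

lemma boundaryValue_ae_eq (hΩ : IsLipschitzDomain Ω) (w : smoothElements Ω) {φ : E d → ℝ}
    (hφ : ContDiff ℝ ∞ φ) (hw : H1.val (w : H1 Ω) =ᵐ[volume.restrict Ω] φ) :
    boundaryValue hΩ w =ᵐ[surfaceMeasure Ω] φ :=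
  (MemLp.coeFn_toLp _).trans (ae_eq_surface_of_ae_eq hΩ (contDiff_smoothRep w) hφ
    ((val_ae_eq_smoothRep w).symm.trans hw))

lemma boundaryValue_add (hΩ : IsLipschitzDomain Ω) (u w : smoothElements Ω) :
    boundaryValue hΩ (u + w) = boundaryValue hΩ u + boundaryValue hΩ w := by
  have h : H1.val ((u + w : smoothElements Ω) : H1 Ω) = H1.val (u : H1 Ω) + H1.val (w : H1 Ω) :=
    map_add (valL Ω) (u : H1 Ω) w
  have h0 := boundaryValue_ae_eq hΩ (u + w)
    ((contDiff_smoothRep u).add (contDiff_smoothRep w)) (by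
      rw [h]
      exact (Lp.coeFn_add _ _).trans ((val_ae_eq_smoothRep u).add (val_ae_eq_smoothRep w)))
  refine Lp.ext (h0.trans (((Lp.coeFn_add _ _).trans ?_).symm))
  exact (boundaryValue_ae_eq hΩ u (contDiff_smoothRep u) (val_ae_eq_smoothRep u)).add
    (boundaryValue_ae_eq hΩ w (contDiff_smoothRep w) (val_ae_eq_smoothRep w))

lemma boundaryValue_smul (hΩ : IsLipschitzDomain Ω) (c : ℝ) (w : smoothElements Ω) :
    boundaryValue hΩ (c • w) = c • boundaryValue hΩ w := by
  have h : H1.val ((c • w : smoothElements Ω) : H1 Ω) = c • H1.val (w : H1 Ω) :=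
    map_smul (valL Ω) c (w : H1 Ω)
  have h0 := boundaryValue_ae_eq hΩ (c • w) ((contDiff_smoothRep w).const_smul c) (by
      rw [h]
      exact (Lp.coeFn_smul _ _).trans ((val_ae_eq_smoothRep w).const_smul c))
  refine Lp.ext (h0.trans (((Lp.coeFn_smul _ _).trans ?_).symm))
  exact (boundaryValue_ae_eq hΩ w (contDiff_smoothRep w) (val_ae_eq_smoothRep w)).const_smul c

/-- Boundary values of functions smooth up to the boundary, as a linear map. -/
noncomputable def smoothTrace (hΩ : IsLipschitzDomain Ω) :
    smoothElements Ω →ₗ[ℝ] Lp ℝ 2 (surfaceMeasure Ω) where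
  toFun := boundaryValue hΩ
  map_add' := boundaryValue_add hΩ
  map_smul' := boundaryValue_smul hΩ

lemma smoothTrace_ae_eq (hΩ : IsLipschitzDomain Ω) (w : smoothElements Ω) {φ : E d → ℝ}
    (hφ : ContDiff ℝ ∞ φ) (hw : H1.val (w : H1 Ω) =ᵐ[volume.restrict Ω] φ) :
    smoothTrace hΩ w =ᵐ[surfaceMeasure Ω] φ := boundaryValue_ae_eq hΩ w hφ hw

lemma exists_norm_smoothTrace_le (hΩ : IsLipschitzDomain Ω) : ∃ C : ℝ, 0 ≤ C ∧
    ∀ w : smoothElements Ω, ‖smoothTrace hΩ w‖ ^ 2 ≤ C * (‖H1.val (w : H1 Ω)‖ * ‖(w : H1 Ω)‖) := by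
  obtain ⟨C, hC0, hC⟩ := exists_lintegral_surface_le hΩ
  refine ⟨C, hC0, fun w => norm_sq_le_of_lintegral_le
    (smoothTrace_ae_eq hΩ w (contDiff_smoothRep w) (val_ae_eq_smoothRep w)) (by positivity)
    (hC _ _ (contDiff_smoothRep w) (val_ae_eq_smoothRep w))⟩

lemma H1.norm_val_le (u : H1 Ω) : ‖H1.val u‖ ≤ ‖u‖ :=
  le_of_sq_le_sq (by nlinarith [sq_nonneg ‖H1.grad u‖, H1.norm_sq u]) (norm_nonneg _)

lemma exists_extension {V F : Type*} [NormedAddCommGroup V] [NormedSpace ℝ V]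
    [NormedAddCommGroup F] [NormedSpace ℝ F] [CompleteSpace F] {S : Submodule ℝ V}
    (hS : Dense (S : Set V)) (f : S →ₗ[ℝ] F) {C : ℝ} (hf : ∀ x : S, ‖f x‖ ≤ C * ‖(x : V)‖) :
    ∃ T : V →L[ℝ] F, ∀ x : S, T x = f x :=
  ⟨f.extendOfNorm S.subtype, fun x => LinearMap.extendOfNorm_eq (e := S.subtype)
    (by rw [DenseRange, Submodule.coe_subtype, Subtype.range_coe]; exact hS) ⟨C, hf⟩ x⟩

/-- Boundary values are bounded on a dense subspace and extend by continuity. Consequently `trace`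
is not the default value 0 by definition. -/
lemma exists_isTraceOperator (hΩ : IsLipschitzDomain Ω) : ∃ T, IsTraceOperator Ω T := by
  obtain ⟨C, hC0, hC⟩ := exists_norm_smoothTrace_le hΩ
  have hb : ∀ w : smoothElements Ω, ‖smoothTrace hΩ w‖ ≤ Real.sqrt C * ‖(w : H1 Ω)‖ := by
    intro w
    refine le_of_sq_le_sq ?_ (by positivity)
    rw [mul_pow, Real.sq_sqrt hC0, sq ‖(w : H1 Ω)‖]
    refine (hC w).trans ?_
    gcongr
    exact H1.norm_val_le _
  obtain ⟨T, hT⟩ := exists_extension (dense_smoothElements hΩ) (smoothTrace hΩ) hb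
  refine ⟨T, fun u φ hφ hu => ?_⟩
  have h := hT ⟨u, φ, hφ, hu⟩
  rw [show T u = _ from h]
  exact smoothTrace_ae_eq hΩ _ hφ hu

theorem isTraceOperator_trace (hΩ : IsLipschitzDomain Ω) : IsTraceOperator Ω (trace Ω) := by
  have h := exists_isTraceOperator hΩ
  rw [trace, dif_pos h]
  exact h.choose_spec

/-- The multiplicative trace inequality. -/
theorem exists_norm_trace_sq_le (hΩ : IsLipschitzDomain Ω) : ∃ C : ℝ, 0 ≤ C ∧
    ∀ u : H1 Ω, ‖trace Ω u‖ ^ 2 ≤ C * (‖H1.val u‖ * ‖u‖) := by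
  obtain ⟨C, hC0, hC⟩ := exists_lintegral_surface_le hΩ
  refine ⟨C, hC0, fun u => ?_⟩
  refine (dense_smoothElements hΩ).induction
    (P := fun u => ‖trace Ω u‖ ^ 2 ≤ C * (‖H1.val u‖ * ‖u‖)) ?_ ?_ u
  · rintro w ⟨φ, hφ, hw⟩
    exact norm_sq_le_of_lintegral_le (isTraceOperator_trace hΩ w φ hφ hw) (by positivity)
      (hC _ _ hφ hw)
  · have h : Continuous fun u : H1 Ω => H1.val u := (valL Ω).continuous
    exact isClosed_le (by fun_prop) (by fun_prop)

end TraceOperator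

/-! ### Infinite rank of the forms, by disjoint bumps on the boundary -/

section Forms

variable {d : ℕ} {Ω : Set (E d)}

lemma frontier_nonempty (hd : 2 ≤ d) (hΩ : IsLipschitzDomain Ω) : (frontier Ω).Nonempty := by
  have hnt : Nontrivial (E d) := by
    have : Nonempty (Fin d) := ⟨⟨0, by omega⟩⟩
    infer_instance
  rw [nonempty_iff_ne_empty]
  intro h
  rcases isClopen_iff.1 (isClopen_iff_frontier_eq_empty.2 h) with h | h
  · exact hΩ.isConnected.nonempty.ne_empty h
  · exact NormedSpace.unbounded_univ ℝ (E d) (h ▸ hΩ.isBounded)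

/-- A finite set is null for Hausdorff measure of dimension `d - 1 > 0`, whereas boundary balls have
positive surface measure. -/
lemma infinite_frontier (hd : 2 ≤ d) (hΩ : IsLipschitzDomain Ω) : (frontier Ω).Infinite := by
  intro hfin
  obtain ⟨p, hp⟩ := frontier_nonempty hd hΩ
  have h1 := surfaceMeasure_ball_pos hΩ hp one_pos
  have h2 : surfaceMeasure Ω (Metric.ball p 1) = 0 := by
    rw [surfaceMeasure, Measure.restrict_apply measurableSet_ball,
      Measure.euclideanHausdorffMeasure_def, Measure.smul_apply]
    have hna : NullSingletonClass (Measure.hausdorffMeasure ((d - 1 : ℕ) : ℝ) : Measure (E d)) :=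
      Measure.nullSingletonClass_hausdorff _ (by
        have : 0 < d - 1 := by omega
        exact_mod_cast this)
    rw [measure_mono_null inter_subset_right (hfin.measure_zero _), smul_zero]
  exact h1.ne' h2

/-- Bump functions with disjoint supports centred at boundary points. -/
lemma exists_disjoint_bumps (hd : 2 ≤ d) (hΩ : IsLipschitzDomain Ω) (n : ℕ) :
    ∃ (q : Fin n → E d) (χ : ∀ i, ContDiffBump (q i)), (∀ i, q i ∈ frontier Ω) ∧
      ∀ i j, i ≠ j → ∀ x, χ i x * χ j x = 0 := by
  obtain ⟨s, hs, hcard⟩ := (infinite_frontier hd hΩ).exists_subset_card_eq n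
  let e := s.equivFinOfCardEq hcard
  obtain ⟨U, hU, hdisj⟩ := s.finite_toSet.t2_separation
  have hball : ∀ i : Fin n, ∃ r > (0 : ℝ), Metric.ball (e.symm i : E d) r ⊆ U (e.symm i) :=
    fun i => Metric.isOpen_iff.1 (hU _).2 _ (hU _).1
  choose r hr hrU using hball
  let χ : ∀ i, ContDiffBump (e.symm i : E d) := fun i =>
    ⟨r i / 2, r i, by have := hr i; positivity, by have := hr i; linarith⟩
  refine ⟨fun i => e.symm i, χ, fun i => hs (e.symm i).2, fun i j hij x => ?_⟩
  by_contra h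
  have hi : x ∈ Function.support (χ i) := left_ne_zero_of_mul h
  have hj : x ∈ Function.support (χ j) := right_ne_zero_of_mul h
  rw [(χ i).support_eq] at hi
  rw [(χ j).support_eq] at hj
  refine (disjoint_left.1 (hdisj (e.symm i).2 (e.symm j).2 fun h => hij ?_)) (hrU i hi) (hrU j hj)
  exact e.symm.injective (Subtype.ext h)

lemma Lp_inner_eq_zero_of_mul {X : Type*} [MeasurableSpace X] {μ : Measure X} {f g : Lp ℝ 2 μ}
    {φ ψ : X → ℝ} (hf : f =ᵐ[μ] φ) (hg : g =ᵐ[μ] ψ) (h : ∀ x, φ x * ψ x = 0) : ⟪f, g⟫_ℝ = 0 := by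
  rw [L2.inner_def]
  refine integral_eq_zero_of_ae ?_
  filter_upwards [hf, hg] with x hx hx'
  rw [hx, hx', real_inner_eq_mul, h, Pi.zero_apply]

lemma Lp_ne_zero_of_ae_eq {X : Type*} [MeasurableSpace X] {μ : Measure X} {f : Lp ℝ 2 μ}
    {φ : X → ℝ} (hf : f =ᵐ[μ] φ) {s : Set X} (hs : μ s ≠ 0) (hφ : ∀ x ∈ s, φ x ≠ 0) : f ≠ 0 := by
  rintro rfl
  exact hs (measure_mono_null (fun x hx => hφ x hx) (hf.symm.trans (Lp.coeFn_zero _ _ _)))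

/-- A smooth function as an element of `H¹`, with its trace. -/
lemma exists_val_trace_ae_eq (hΩ : IsLipschitzDomain Ω) {φ : E d → ℝ} (hφ : ContDiff ℝ ∞ φ) :
    ∃ w : H1 Ω, H1.val w =ᵐ[volume.restrict Ω] φ ∧ trace Ω w =ᵐ[surfaceMeasure Ω] φ :=
  ⟨H1.ofSmooth hΩ.isBounded hφ, H1.val_ofSmooth hΩ.isBounded hφ,
    isTraceOperator_trace hΩ _ _ hφ (H1.val_ofSmooth hΩ.isBounded hφ)⟩

/-- Infinitely many elements of `H¹` with disjoint supports and non-zero traces. -/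
lemma exists_orthogonal_system (hd : 2 ≤ d) (hΩ : IsLipschitzDomain Ω) (n : ℕ) :
    ∃ w : Fin n → H1 Ω, (∀ i, H1.val (w i) ≠ 0 ∧ trace Ω (w i) ≠ 0) ∧ ∀ i j, i ≠ j →
      ⟪H1.val (w i), H1.val (w j)⟫_ℝ = 0 ∧ ⟪trace Ω (w i), trace Ω (w j)⟫_ℝ = 0 := by
  obtain ⟨q, χ, hq, hdisj⟩ := exists_disjoint_bumps hd hΩ n
  have hχ : ∀ i, ContDiff ℝ ∞ (χ i) := fun i => (χ i).contDiff
  have hw := fun i => exists_val_trace_ae_eq hΩ (hχ i)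
  choose w hv ht using hw
  have hone : ∀ i, ∀ x ∈ Metric.ball (q i) (χ i).rIn, χ i x ≠ 0 := fun i x hx => by
    rw [(χ i).one_of_mem_closedBall (Metric.ball_subset_closedBall hx)]
    exact one_ne_zero
  refine ⟨w, fun i => ⟨Lp_ne_zero_of_ae_eq (hv i) ?_ (hone i), Lp_ne_zero_of_ae_eq (ht i)
    (surfaceMeasure_ball_pos hΩ (hq i) (χ i).rIn_pos).ne' (hone i)⟩, fun i j hij =>
    ⟨Lp_inner_eq_zero_of_mul (hv i) (hv j) (hdisj i j hij),
      Lp_inner_eq_zero_of_mul (ht i) (ht j) (hdisj i j hij)⟩⟩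
  rw [Measure.restrict_apply measurableSet_ball]
  obtain ⟨x, hx, hx'⟩ := mem_closure_iff.1 (frontier_subset_closure (hq i)) _ Metric.isOpen_ball
    (Metric.mem_ball_self (χ i).rIn_pos)
  exact ((Metric.isOpen_ball.inter hΩ.isOpen).measure_pos volume ⟨x, hx, hx'⟩).ne'

end Forms

/-! ### The bottom of the spectrum -/

section Abstract

variable {H : Type*} [NormedAddCommGroup H] [NormedSpace ℝ H]
  {D b : H →L[ℝ] H →L[ℝ] ℝ} {u : ℕ → H} {ev : ℕ → ℝ}

lemma IsSpectralPair.form_pos_of_kernel (h : IsSpectralPair D b) {e : H} (he : e ≠ 0)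
    (hD : D e e = 0) : 0 < b e e := by
  by_contra hb
  exact he (h.eq_zero_of_le (by linarith))

lemma IsMinSystem.zero_eq (h : IsSpectralPair D b) (hm : IsMinSystem D b u ev) : ev 0 = 0 := by
  obtain ⟨e, he, hDe, -⟩ := h.kernel
  have h1 := hm.min 0 e (by simp)
  have h2 := h.form_pos_of_kernel he hDe
  rw [hDe] at h1
  exact le_antisymm (nonpos_of_mul_nonpos_left h1 h2) (hm.nonneg h 0)

/-- If `ev 1 = 0`, then `u 0` and `u 1` are multiples of one kernel vector and cannot be
`b`-orthonormal. -/
lemma IsMinSystem.one_pos (h : IsSpectralPair D b) (hm : IsMinSystem D b u ev) : 0 < ev 1 := by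
  refine lt_of_le_of_ne (hm.nonneg h 1) fun h1 => ?_
  obtain ⟨e, he, hDe, hker⟩ := h.kernel
  obtain ⟨c₀, h0⟩ := hker (u 0) (by rw [hm.eigen_self, hm.zero_eq h])
  obtain ⟨c₁, h1⟩ := hker (u 1) (by rw [hm.eigen_self, ← h1])
  have h00 := hm.orthonormal 0 0
  have h11 := hm.orthonormal 1 1
  have h01 := hm.orthonormal 0 1
  rw [h0] at h00 h01
  rw [h1] at h11 h01
  simp only [map_smul, smul_apply, smul_eq_mul, if_true, zero_ne_one, if_false] at h00 h11 h01
  have h3 : (c₀ * (c₀ * b e e)) * (c₁ * (c₁ * b e e)) = (c₀ * (c₁ * b e e)) ^ 2 := by ring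
  rw [h00, h11] at h3
  have h4 : c₀ * (c₁ * b e e) = 0 := by linarith
  rw [h4] at h3
  norm_num at h3

end Abstract

/-! ### Coercivity and compactness from abstract trace data -/

section TraceTriple

variable {H K₁ K₂ K₃ : Type*} [NormedAddCommGroup H] [NormedSpace ℝ H]
  [NormedAddCommGroup K₁] [InnerProductSpace ℝ K₁] [NormedAddCommGroup K₂] [InnerProductSpace ℝ K₂]
  [NormedAddCommGroup K₃] [InnerProductSpace ℝ K₃]

/-- Operators with the functional analytic properties of the inclusion into `L²`, the gradient and
the trace on a Lipschitz domain. -/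
structure IsTraceTriple (V : H →L[ℝ] K₁) (G : H →L[ℝ] K₂) (T : H →L[ℝ] K₃) : Prop where
  norm_sq : ∀ u, ‖u‖ ^ 2 = ‖V u‖ ^ 2 + ‖G u‖ ^ 2
  norm_trace : ∃ C : ℝ, 0 ≤ C ∧ ∀ u, ‖T u‖ ^ 2 ≤ C * (‖V u‖ * ‖u‖)
  compact : ∀ (u : ℕ → H) (C : ℝ), (∀ n, ‖u n‖ ≤ C) → ∃ φ : ℕ → ℕ, StrictMono φ ∧
    ∀ ε > 0, ∃ N, ∀ m ≥ N, ∀ n ≥ N, ‖V (u (φ m) - u (φ n))‖ < ε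
  rank : ∀ n : ℕ, ∃ w : Fin n → H, (∀ i, V (w i) ≠ 0 ∧ T (w i) ≠ 0) ∧ ∀ i j, i ≠ j →
    ⟪V (w i), V (w j)⟫_ℝ = 0 ∧ ⟪T (w i), T (w j)⟫_ℝ = 0
  kernel : ∃ e, e ≠ 0 ∧ G e = 0 ∧ T e ≠ 0 ∧ ∀ u, G u = 0 → ∃ c : ℝ, u = c • e

variable {V : H →L[ℝ] K₁} {G : H →L[ℝ] K₂} {T : H →L[ℝ] K₃}

lemma IsTraceTriple.norm_val_le (ht : IsTraceTriple V G T) (u : H) : ‖V u‖ ≤ ‖u‖ :=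
  le_of_sq_le_sq (by nlinarith [sq_nonneg ‖G u‖, ht.norm_sq u]) (norm_nonneg _)

/-- Otherwise there are unit vectors with both forms tending to zero. A subsequence is Cauchy for
`V`, and `G` tends to zero on it, so it converges in norm to a unit vector in the kernel of `G` with
vanishing trace; kernel vectors are multiples of `e` and `T e ≠ 0`. -/
lemma exists_coercive_trace [CompleteSpace H] (ht : IsTraceTriple V G T) : ∃ c > (0 : ℝ), ∀ u : H,
    c * ‖u‖ ^ 2 ≤ operatorForm G u u + operatorForm T u u := by
  by_contra! hcon
  have h1 : ∀ k : ℕ, ∃ u : H, ‖u‖ = 1 ∧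
      operatorForm G u u + operatorForm T u u < 1 / ((k : ℝ) + 1) := by
    intro k
    obtain ⟨u, hu⟩ := hcon (1 / ((k : ℝ) + 1)) (by positivity)
    have hu0 : u ≠ 0 := by
      rintro rfl
      simp at hu
    have hn : 0 < ‖u‖ := norm_pos_iff.2 hu0
    refine ⟨‖u‖⁻¹ • u, by rw [norm_smul, norm_inv, norm_norm, inv_mul_cancel₀ hn.ne'], ?_⟩
    rw [form_smul_self, form_smul_self, ← mul_add]
    calc ‖u‖⁻¹ ^ 2 * _ < ‖u‖⁻¹ ^ 2 * (1 / ((k : ℝ) + 1) * ‖u‖ ^ 2) := by gcongr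
      _ = 1 / ((k : ℝ) + 1) := by field_simp
  choose u hu1 hu2 using h1
  obtain ⟨φ, hφ, hval⟩ := ht.compact u 1 fun n => (hu1 n).le
  have hD0 : ∀ w : H, 0 ≤ operatorForm G w w := fun w => by
    rw [operatorForm_self]; positivity
  have hs0 : ∀ w : H, 0 ≤ operatorForm T w w := fun w => by
    rw [operatorForm_self]; positivity
  have hlim : Tendsto (fun n : ℕ => 1 / (((φ n : ℕ) : ℝ) + 1)) atTop (𝓝 0) :=
    tendsto_one_div_add_atTop_nhds_zero_nat.comp hφ.tendsto_atTop
  have hD : Tendsto (fun n => operatorForm G (u (φ n)) (u (φ n))) atTop (𝓝 0) :=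
    squeeze_zero (fun n => hD0 _) (fun n => by linarith [hu2 (φ n), hs0 (u (φ n))]) hlim
  have hs : Tendsto (fun n => operatorForm T (u (φ n)) (u (φ n))) atTop (𝓝 0) :=
    squeeze_zero (fun n => hs0 _) (fun n => by linarith [hu2 (φ n), hD0 (u (φ n))]) hlim
  have hgrad : Tendsto (fun n => ‖G (u (φ n))‖) atTop (𝓝 0) := by
    have := hD.sqrt
    simpa only [operatorForm_self, Real.sqrt_sq (norm_nonneg _), Real.sqrt_zero] using this
  have hcauchy : CauchySeq fun n => u (φ n) := by
    refine Metric.cauchySeq_iff.2 fun ε hε => ?_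
    obtain ⟨N₁, hN₁⟩ := hval (ε / 2) (by positivity)
    obtain ⟨N₂, hN₂⟩ := eventually_atTop.1 (hgrad.eventually_lt_const
      (show (0 : ℝ) < ε / 4 by positivity))
    refine ⟨max N₁ N₂, fun m hm n hn => ?_⟩
    have h1 := hN₁ m (le_of_max_le_left hm) n (le_of_max_le_left hn)
    have h2 : ‖G (u (φ m) - u (φ n))‖ < ε / 2 := by
      rw [map_sub]
      refine (norm_sub_le _ _).trans_lt ?_
      linarith [hN₂ m (le_of_max_le_right hm), hN₂ n (le_of_max_le_right hn)]
    rw [dist_eq_norm]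
    refine lt_of_pow_lt_pow_left₀ 2 hε.le ?_
    rw [ht.norm_sq]
    nlinarith [norm_nonneg (V (u (φ m) - u (φ n))),
      norm_nonneg (G (u (φ m) - u (φ n)))]
  obtain ⟨w, hw⟩ := cauchySeq_tendsto_of_complete hcauchy
  have hw1 : ‖w‖ = 1 := tendsto_nhds_unique hw.norm (by simp [hu1])
  have hwD : operatorForm G w w = 0 :=
    tendsto_nhds_unique (((continuous_form_self _).tendsto w).comp hw) hD
  have hws : operatorForm T w w = 0 :=
    tendsto_nhds_unique (((continuous_form_self _).tendsto w).comp hw) hs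
  obtain ⟨e, -, -, heT, hker⟩ := ht.kernel
  obtain ⟨c, rfl⟩ := hker w (by
    rw [operatorForm_self] at hwD
    simpa using hwD)
  rw [form_smul_self, operatorForm_self] at hws
  have hc : c = 0 := by simpa [heT] using hws
  rw [hc, zero_smul, norm_zero] at hw1
  exact zero_ne_one hw1

/-- On bounded sets the multiplicative trace inequality bounds both forms by a multiple of `‖V w‖`,
so compactness of `V` is enough. -/
lemma exists_subseq_cauchy_forms (ht : IsTraceTriple V G T) {α β : ℝ} (hα : 0 ≤ α) (hβ : 0 ≤ β)
    {u : ℕ → H} {C : ℝ} (hu : ∀ n, ‖u n‖ ≤ C) : ∃ φ : ℕ → ℕ, StrictMono φ ∧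
    ∀ ε > 0, ∃ N, ∀ m ≥ N, ∀ n ≥ N,
      (α • operatorForm V + β • operatorForm T) (u (φ m) - u (φ n))
        (u (φ m) - u (φ n)) < ε := by
  obtain ⟨B, hB0, hB⟩ := ht.norm_trace
  obtain ⟨φ, hφ, h⟩ := ht.compact u C hu
  have hC : 0 ≤ C := (norm_nonneg _).trans (hu 0)
  refine ⟨φ, hφ, fun ε hε => ?_⟩
  set q : ℝ := (α + β * B) * (2 * C) + 1 with hq
  have hq0 : 0 < q := by positivity
  obtain ⟨N, hN⟩ := h (ε / q) (by positivity)
  refine ⟨N, fun m hm n hn => ?_⟩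
  set w := u (φ m) - u (φ n) with hw
  have h1 := hN m hm n hn
  have h2 : ‖w‖ ≤ 2 * C := (norm_sub_le _ _).trans (by linarith [hu (φ m), hu (φ n)])
  have h3 := ht.norm_val_le w
  simp only [add_apply, smul_apply, smul_eq_mul, operatorForm_self]
  have hv := norm_nonneg (V w)
  calc α * ‖V w‖ ^ 2 + β * ‖T w‖ ^ 2
      ≤ α * (‖V w‖ * (2 * C)) + β * (B * (‖V w‖ * (2 * C))) := by
        gcongr
        · rw [sq]; gcongr; exact h3.trans h2
        · refine (hB w).trans ?_
          gcongr
    _ = ((α + β * B) * (2 * C)) * ‖V w‖ := by ring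
    _ ≤ q * ‖V w‖ := by gcongr; linarith
    _ < q * (ε / q) := by gcongr
    _ = ε := by field_simp

/-- The Dirichlet form and a combination of the `L²(Ω)` and `L²(∂Ω)` forms have a discrete
spectrum. -/
theorem IsTraceTriple.isSpectralPair [CompleteSpace H] (ht : IsTraceTriple V G T) {α β : ℝ}
    (hα : 0 ≤ α) (hβ : 0 ≤ β) (hpos : 0 < α ∨ 0 < β) : IsSpectralPair (operatorForm G)
      (α • operatorForm V + β • operatorForm T) where
  symm_left u w := by rw [operatorForm_apply, operatorForm_apply, real_inner_comm]
  symm_right u w := by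
    simp only [add_apply, smul_apply, operatorForm_apply]
    rw [real_inner_comm, real_inner_comm (T w)]
  nonneg_left u := by rw [operatorForm_self]; positivity
  nonneg_right u := by
    simp only [add_apply, smul_apply, operatorForm_self, smul_eq_mul]
    positivity
  coercive := by
    -- For `α > 0` the form dominates the norm directly; `α = 0` is the pure boundary problem, where
    -- coercivity comes from the trace.
    rcases hpos with h | h
    · refine ⟨min 1 α, by positivity, fun u => ?_⟩
      rw [ht.norm_sq]
      simp only [add_apply, smul_apply, operatorForm_self, smul_eq_mul]
      have h1 : min 1 α * ‖G u‖ ^ 2 ≤ 1 * ‖G u‖ ^ 2 := by gcongr; exact min_le_left _ _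
      have h2 : min 1 α * ‖V u‖ ^ 2 ≤ α * ‖V u‖ ^ 2 := by gcongr; exact min_le_right _ _
      have h3 : 0 ≤ β * ‖T u‖ ^ 2 := by positivity
      linarith
    · obtain ⟨c, hc, hcoer⟩ := exists_coercive_trace ht
      refine ⟨min 1 β * c, by positivity, fun u => ?_⟩
      have h0 := mul_le_mul_of_nonneg_left (hcoer u) (show 0 ≤ min 1 β by positivity)
      simp only [add_apply, smul_apply, operatorForm_self, smul_eq_mul] at h0 ⊢
      have h1 : min 1 β * ‖G u‖ ^ 2 ≤ 1 * ‖G u‖ ^ 2 := by gcongr; exact min_le_left _ _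
      have h2 : min 1 β * ‖T u‖ ^ 2 ≤ β * ‖T u‖ ^ 2 := by gcongr; exact min_le_right _ _
      have h3 : 0 ≤ α * ‖V u‖ ^ 2 := by positivity
      linarith
  compact u hu := by
    obtain ⟨C, hC⟩ := hu
    exact exists_subseq_cauchy_forms ht hα hβ hC
  rank n := by
    obtain ⟨w, hw, horth⟩ := ht.rank n
    refine ⟨w, fun i => ?_, fun i j hij => ?_⟩
    · simp only [add_apply, smul_apply, smul_eq_mul, operatorForm_self]
      have h1 := norm_pos_iff.2 (hw i).1
      have h2 := norm_pos_iff.2 (hw i).2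
      rcases hpos with h | h <;> positivity
    · simp only [add_apply, smul_apply, smul_eq_mul, operatorForm_apply]
      rw [(horth i j hij).1, (horth i j hij).2, mul_zero, mul_zero, add_zero]
  kernel := by
    obtain ⟨e, he0, heG, -, hker⟩ := ht.kernel
    refine ⟨e, he0, by rw [operatorForm_self, heG, norm_zero]; norm_num, fun u hu => hker u ?_⟩
    rw [operatorForm_self] at hu
    simpa using hu

end TraceTriple

/-! ### Constants, and the trace data of a Lipschitz domain -/

section Pairs

variable {d : ℕ} {Ω : Set (E d)}

lemma exists_constant_element (hΩ : IsLipschitzDomain Ω) : ∃ e : H1 Ω,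
    H1.val e =ᵐ[volume.restrict Ω] (fun _ => 1) ∧ H1.grad e = 0 ∧ e ≠ 0 := by
  have h1 : ContDiff ℝ ∞ fun _ : E d => (1 : ℝ) := contDiff_const
  have hval := H1.val_ofSmooth hΩ.isBounded h1
  refine ⟨H1.ofSmooth hΩ.isBounded h1, hval, ?_, fun h0 => ?_⟩
  · refine Lp.ext (((H1.grad_ofSmooth hΩ.isBounded h1).trans ?_).trans (Lp.coeFn_zero _ _ _).symm)
    refine Eventually.of_forall fun x => ?_
    simp [gradient]
  · refine Lp_ne_zero_of_ae_eq hval (s := Ω) ?_ (fun _ _ => one_ne_zero) ?_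
    · rw [Measure.restrict_apply_self]
      exact (hΩ.isOpen.measure_pos volume hΩ.isConnected.nonempty).ne'
    · rw [h0]
      exact map_zero (valL Ω)

lemma eq_smul_of_grad_eq_zero (hΩ : IsLipschitzDomain Ω) {e : H1 Ω}
    (he : H1.val e =ᵐ[volume.restrict Ω] (fun _ => 1)) (he' : H1.grad e = 0) {u : H1 Ω}
    (hu : H1.grad u = 0) : ∃ c : ℝ, u = c • e := by
  obtain ⟨c, hc⟩ := exists_val_ae_eq_const hΩ hu
  refine ⟨c, H1.ext (Lp.ext ?_) ?_⟩
  · have h1 : H1.val (c • e) = c • H1.val e := map_smul (valL Ω) c e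
    rw [h1]
    filter_upwards [hc, he, Lp.coeFn_smul c (H1.val e)] with x hx hx' hx''
    rw [hx, hx'', Pi.smul_apply, hx', smul_eq_mul, mul_one]
  · have h1 : H1.grad (c • e) = c • H1.grad e := map_smul (gradL Ω) c e
    rw [h1, hu, he', smul_zero]

lemma trace_constant_ne_zero (hd : 2 ≤ d) (hΩ : IsLipschitzDomain Ω) {e : H1 Ω}
    (he : H1.val e =ᵐ[volume.restrict Ω] (fun _ => 1)) : trace Ω e ≠ 0 := by
  obtain ⟨p, hp⟩ := frontier_nonempty hd hΩ
  exact Lp_ne_zero_of_ae_eq (isTraceOperator_trace hΩ e _ contDiff_const he)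
    (surfaceMeasure_ball_pos hΩ hp one_pos).ne' fun _ _ => one_ne_zero

lemma isTraceTriple (hd : 2 ≤ d) (hΩ : IsLipschitzDomain Ω) :
    IsTraceTriple (valL Ω) (gradL Ω) (trace Ω) where
  norm_sq := H1.norm_sq
  norm_trace := exists_norm_trace_sq_le hΩ
  compact u C hu := by
    obtain ⟨φ, hφ, h⟩ := exists_subseq_cauchy_val hΩ hu
    refine ⟨φ, hφ, fun ε hε => ?_⟩
    obtain ⟨N, hN⟩ := h ε hε
    exact ⟨N, fun m hm n hn => hN m hm n hn⟩
  rank := exists_orthogonal_system hd hΩ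
  kernel := by
    obtain ⟨e, he1, he2, he0⟩ := exists_constant_element hΩ
    exact ⟨e, he0, he2, trace_constant_ne_zero hd hΩ he1, fun u hu =>
      eq_smul_of_grad_eq_zero hΩ he1 he2 hu⟩

end Pairs

/-! ### From a large parameter to a small one -/

section LargeParameter

variable {H : Type*} [NormedAddCommGroup H] [NormedSpace ℝ H]
  {D b n s : H →L[ℝ] H →L[ℝ] ℝ}

lemma IsSpectralPair.discrete [CompleteSpace H] (h : IsSpectralPair D b) :
    formEigenvalue (fun x y => D x y) (fun x y => b x y) 0 = 0 ∧
    0 < formEigenvalue (fun x y => D x y) (fun x y => b x y) 1 ∧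
    Monotone (formEigenvalue (fun x y => D x y) (fun x y => b x y)) ∧
    Tendsto (formEigenvalue (fun x y => D x y) (fun x y => b x y)) atTop atTop ∧
    ∃ u, IsEigenSystem D b u := by
  obtain ⟨u, ev, hm⟩ := h.exists_isMinSystem
  have hev : formEigenvalue (fun x y => D x y) (fun x y => b x y) = ev :=
    funext (hm.formEigenvalue_eq h)
  rw [hev]
  refine ⟨hm.zero_eq h, hm.one_pos h, hm.monotone, hm.tendsto_atTop h, u, hm.orthonormal, ?_⟩
  intro k w
  rw [hev]
  exact hm.eigen k w

/-- The pencil of forms `α n + β s` has discrete spectrum relative to `D`. -/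
def IsSpectralPencil (D n s : H →L[ℝ] H →L[ℝ] ℝ) : Prop :=
  ∀ α β : ℝ, 0 ≤ α → 0 ≤ β → 0 < α ∨ 0 < β → IsSpectralPair D (α • n + β • s)

lemma IsSpectralPencil.left (h : IsSpectralPencil D n s) {ε : ℝ} (hε : 0 ≤ ε) :
    IsSpectralPair D (n + ε • s) := by
  have h1 := h 1 ε zero_le_one hε (Or.inl one_pos)
  rwa [one_smul] at h1

lemma IsSpectralPencil.base (h : IsSpectralPencil D n s) : IsSpectralPair D n := by
  have h1 := h.left le_rfl
  rwa [show n + (0 : ℝ) • s = n by ext; simp] at h1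

lemma IsSpectralPencil.right (h : IsSpectralPencil D n s) {t : ℝ} (ht : 0 ≤ t) :
    IsSpectralPair D (s + t • n) := by
  have h1 := h t 1 ht zero_le_one (Or.inr one_pos)
  rwa [one_smul, show t • n + s = s + t • n by ext; simp [add_comm]] at h1

lemma mul_add_form (t : ℝ) (x y : H) : t * n x y + s x y = (s + t • n) x y := by
  simp [add_comm]

/-- The change of parameter that turns `t → ∞` for `s + t n` into a vanishing perturbation of `n`.
-/
lemma smul_left_form {t : ℝ} (ht : 0 < t) (x y : H) :
    t * (n + t⁻¹ • s) x y = (s + t • n) x y := by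
  simp only [add_apply, smul_apply, smul_eq_mul]
  field_simp
  ring

lemma formEigenvalue_left {t : ℝ} (ht : 0 < t) (k : ℕ) :
    formEigenvalue (fun x y => D x y) (fun x y => (n + t⁻¹ • s) x y) k =
      t * formEigenvalue (fun x y => D x y) (fun x y => (s + t • n) x y) k := by
  rw [formEigenvalue_smul _ _ ht]
  simp only [smul_left_form ht]

lemma IsSpectralPencil.continuousOn [CompleteSpace H] (h : IsSpectralPencil D n s)
    (hn : ∀ u, 0 ≤ n u u) {A : ℝ} (hA : 0 < A) (k : ℕ) :
    ContinuousOn (fun β : ℝ => formEigenvalue (fun x y => D x y)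
      (fun x y => (s + (A * β) • n) x y) k) (Ici 0) := by
  have h1 := continuousOn_formEigenvalue (D := D) (b := s) hn (fun ε hε => h.right hε) k
  exact h1.comp (f := fun β => A * β) (by fun_prop) fun β (hβ : 0 ≤ β) =>
    mul_nonneg hA.le hβ

lemma IsSpectralPencil.tendsto_left [CompleteSpace H] (h : IsSpectralPencil D n s)
    (hs : ∀ u, 0 ≤ s u u) {A : ℝ} (hA : 0 < A) (k : ℕ) :
    Tendsto (fun β : ℝ => formEigenvalue (fun x y => D x y)
      (fun x y => (n + (A * β)⁻¹ • s) x y) k) atTop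
      (𝓝 (formEigenvalue (fun x y => D x y) (fun x y => n x y) k)) := by
  have h1 := continuousOn_formEigenvalue (D := D) (b := n) hs (fun ε hε => h.left hε) k
  have h2 := (h1 0 (mem_Ici.2 le_rfl)).tendsto
  rw [show n + (0 : ℝ) • s = n by ext; simp] at h2
  refine h2.comp (tendsto_nhdsWithin_iff.2 ⟨?_, ?_⟩)
  · exact tendsto_inv_atTop_zero.comp (tendsto_id.const_mul_atTop hA)
  · filter_upwards [eventually_ge_atTop 0] with β hβ
    exact inv_nonneg.2 (mul_nonneg hA.le hβ)

lemma IsSpectralPencil.tendsto_right [CompleteSpace H] (h : IsSpectralPencil D n s)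
    (hs : ∀ u, 0 ≤ s u u) {A : ℝ} (hA : 0 < A) (k : ℕ) :
    Tendsto (fun β : ℝ => A * β * formEigenvalue (fun x y => D x y)
      (fun x y => (s + (A * β) • n) x y) k) atTop
      (𝓝 (formEigenvalue (fun x y => D x y) (fun x y => n x y) k)) := by
  refine (h.tendsto_left hs hA k).congr' ?_
  filter_upwards [eventually_gt_atTop 0] with β hβ
  exact formEigenvalue_left (mul_pos hA hβ) k

/-- Orthonormality for `t (n + t⁻¹ s)` becomes orthonormality for `n + t⁻¹ s` after multiplication
by `√t`. This is the origin of the factor `β^{1/2}`. -/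
lemma IsEigenSystem.sqrt_smul {t : ℝ} (ht : 0 < t) {u : ℕ → H}
    (hu : IsEigenSystem D (s + t • n) u) :
    IsEigenSystem D (n + t⁻¹ • s) fun j => Real.sqrt t • u j where
  orthonormal i j := by
    rw [← hu.orthonormal i j, ← smul_left_form ht]
    simp only [map_smul, smul_apply, smul_eq_mul]
    rw [← mul_assoc, Real.mul_self_sqrt ht.le]
  eigen k w := by
    have h1 := hu.eigen k w
    rw [← smul_left_form ht] at h1
    rw [formEigenvalue_left ht]
    simp only [map_smul, smul_apply, smul_eq_mul]
    rw [h1]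
    ring

/-- Rescaled eigenvectors of `s + A β n` converge to those of `n` as `β → ∞`. -/
theorem IsSpectralPencil.exists_orthogonal_tendsto [CompleteSpace H] (h : IsSpectralPencil D n s)
    (hs : ∀ u, 0 ≤ s u u) {A : ℝ} (hA : 0 < A) {f : ℕ → H} (hf : IsEigenSystem D n f)
    {U : ℝ → ℕ → H} (hU : ∀ β, 0 < β → IsEigenSystem D (s + (A * β) • n) (U β)) {k m : ℕ}
    (hlt : ∀ j < k, formEigenvalue (fun x y => D x y) (fun x y => n x y) j <
      formEigenvalue (fun x y => D x y) (fun x y => n x y) k)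
    (heq : ∀ i < m, formEigenvalue (fun x y => D x y) (fun x y => n x y) (k + i) =
      formEigenvalue (fun x y => D x y) (fun x y => n x y) k)
    (hgt : formEigenvalue (fun x y => D x y) (fun x y => n x y) k <
      formEigenvalue (fun x y => D x y) (fun x y => n x y) (k + m)) :
    ∃ M : ℝ → Matrix (Fin m) (Fin m) ℝ, (∀ β, M β ∈ Matrix.orthogonalGroup (Fin m) ℝ) ∧
      ∀ i : Fin m, Tendsto (fun β => ∑ j : Fin m, M β i j • (Real.sqrt β • U β (k + j))) atTop
        (𝓝 ((Real.sqrt A)⁻¹ • f (k + i))) := by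
  have hε : Tendsto (fun β : ℝ => (A * β)⁻¹) atTop (𝓝 0) :=
    tendsto_inv_atTop_zero.comp (tendsto_id.const_mul_atTop hA)
  have hε0 : ∀ᶠ β : ℝ in atTop, 0 ≤ (A * β)⁻¹ := by
    filter_upwards [eventually_ge_atTop 0] with β hβ
    exact inv_nonneg.2 (mul_nonneg hA.le hβ)
  have hV : ∀ᶠ β : ℝ in atTop, IsEigenSystem D (n + (A * β)⁻¹ • s)
      fun j => Real.sqrt (A * β) • U β j := by
    filter_upwards [eventually_gt_atTop 0] with β hβ
    exact (hU β hβ).sqrt_smul (mul_pos hA hβ)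
  obtain ⟨M, hM, hlim⟩ := exists_orthogonal_tendsto_eigenvectors h.base hs hε hε0 hf hV
    (h.tendsto_left hs hA) hlt heq hgt
  refine ⟨M, hM, fun i => ?_⟩
  refine ((hlim i).const_smul (Real.sqrt A)⁻¹).congr fun β => ?_
  rw [Finset.smul_sum]
  refine Finset.sum_congr rfl fun j _ => ?_
  -- `√(A β) = √A √β`; the constant `√A` moves to the limit.
  rw [Real.sqrt_mul hA.le, smul_comm, mul_smul, inv_smul_smul₀ (Real.sqrt_pos.2 hA).ne']

end LargeParameter

/-! ### Identification with the concrete eigenvalue problems -/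

section Assembly

variable {d : ℕ} {Ω : Set (E d)}

lemma sphereArea_pos (hd : 2 ≤ d) : 0 < sphereArea d := by
  have : Nonempty (Fin d) := ⟨⟨0, by omega⟩⟩
  rw [sphereArea, Measure.toSphere_real_apply_univ, finrank_euclideanSpace_fin]
  have h1 : (0 : ℝ) < d := by positivity
  refine mul_pos h1 (ENNReal.toReal_pos (Metric.measure_ball_pos volume _ one_pos).ne' ?_)
  exact measure_ball_lt_top.ne

lemma isSpectralPencil (hd : 2 ≤ d) (hΩ : IsLipschitzDomain Ω) :
    IsSpectralPencil (operatorForm (gradL Ω)) (operatorForm (valL Ω)) (operatorForm (trace Ω)) :=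
  fun _ _ hα hβ hpos => (isTraceTriple hd hΩ).isSpectralPair hα hβ hpos

lemma neumannForm_eq_operatorForm :
    neumannForm (Ω := Ω) = fun u w => operatorForm (valL Ω) u w :=
  funext fun u => funext fun w => neumannForm_eq u w

lemma dynamicalForm_eq_operatorForm (β : ℝ) : dynamicalForm (Ω := Ω) β = fun u w =>
    (operatorForm (trace Ω) + (sphereArea d * β) • operatorForm (valL Ω)) u w :=
  funext fun u => funext fun w => (dynamicalForm_eq β u w).trans (mul_add_form _ _ _)

lemma eigenvalue_eq (b : H1 Ω → H1 Ω → ℝ) (k : ℕ) :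
    eigenvalue b k = formEigenvalue (fun u w => operatorForm (gradL Ω) u w) b k := rfl

lemma IsEigenbasis.isEigenSystem {b : H1 Ω →L[ℝ] H1 Ω →L[ℝ] ℝ} {u : ℕ → H1 Ω}
    (hu : IsEigenbasis (fun x y => b x y) u) : IsEigenSystem (operatorForm (gradL Ω)) b u :=
  ⟨hu.2, fun k => (hu.1 k).2⟩

lemma hasDiscreteSpectrum {b : H1 Ω →L[ℝ] H1 Ω →L[ℝ] ℝ}
    (h : IsSpectralPair (operatorForm (gradL Ω)) b) :
    HasDiscreteSpectrum (fun x y => b x y) := by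
  obtain ⟨h0, h1, h2, h3, u, hu⟩ := h.discrete
  refine ⟨h0, h1, h2, h3, u, fun k => ⟨?_, hu.eigen k⟩, hu.orthonormal⟩
  intro h0
  have := hu.orthonormal k k
  rw [h0, map_zero] at this
  simp at this

end Assembly

end DynamicalSpectrum

theorem theorem1p2 {d : ℕ} (hd : 2 ≤ d) (Ω : Set (E d))
    (hΩ : IsLipschitzDomain Ω) :
    -- both problems have discrete spectrum, so that eigenvalues and eigenfunctions make sense
    HasDiscreteSpectrum (neumannForm (Ω := Ω)) ∧
    (∀ β : ℝ, 0 ≤ β →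
      HasDiscreteSpectrum (dynamicalForm (Ω := Ω) β)) ∧
    -- continuity of the eigenvalues in `β ∈ [0, ∞)`
    (∀ k : ℕ, ContinuousOn (fun β : ℝ => dynamicalEigenvalue Ω k β) (Ici 0)) ∧
    -- convergence of the eigenvalues as `β → ∞`
    (∀ k : ℕ, Tendsto
      (fun β : ℝ => sphereArea d * β * dynamicalEigenvalue Ω k β)
      atTop (𝓝 (neumannEigenvalue Ω k))) ∧
    -- weak convergence in `H¹(Ω)` of the eigenfunctions, for a Neumann eigenvalue
    -- `μ_{k-1} < μ_k = ⋯ = μ_{k+m-1} < μ_{k+m}` of multiplicity `m`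
    (∀ (f : ℕ → H1 Ω) (U : ℝ → ℕ → H1 Ω),
      IsEigenbasis (neumannForm (Ω := Ω)) f →
      (∀ β : ℝ, 0 < β →
        IsEigenbasis (dynamicalForm (Ω := Ω) β) (U β)) →
      ∀ k m : ℕ,
        (∀ j < k, neumannEigenvalue Ω j
          < neumannEigenvalue Ω k) →
        (∀ i < m, neumannEigenvalue Ω (k + i)
          = neumannEigenvalue Ω k) →
        neumannEigenvalue Ω k
          < neumannEigenvalue Ω (k + m) →
        ∃ M : ℝ → Matrix (Fin m) (Fin m) ℝ,
          (∀ β, M β ∈ Matrix.orthogonalGroup (Fin m) ℝ) ∧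
          ∀ i : Fin m, WeakTendsto
            (fun β : ℝ => ∑ j : Fin m, M β i j • (Real.sqrt β • U β (k + j)))
            atTop ((Real.sqrt (sphereArea d))⁻¹ • f (k + i))) := by
  have hp := isSpectralPencil hd hΩ
  have hA := sphereArea_pos hd
  have hn : ∀ u, 0 ≤ operatorForm (valL Ω) u u := hp.base.nonneg_right
  have hs : ∀ u, 0 ≤ operatorForm (trace Ω) u u := fun u => by
    rw [operatorForm_self]
    positivity
  refine ⟨?_, fun β hβ => ?_, fun k => ?_, fun k => ?_, fun f U hf hU k m hlt heq hgt => ?_⟩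
  · rw [neumannForm_eq_operatorForm]
    exact hasDiscreteSpectrum hp.base
  · rw [dynamicalForm_eq_operatorForm]
    exact hasDiscreteSpectrum (hp.right (mul_nonneg hA.le hβ))
  · simp only [dynamicalEigenvalue, dynamicalForm_eq_operatorForm, eigenvalue_eq]
    exact hp.continuousOn hn hA k
  · simp only [dynamicalEigenvalue, neumannEigenvalue, dynamicalForm_eq_operatorForm,
      neumannForm_eq_operatorForm, eigenvalue_eq]
    exact hp.tendsto_right hs hA k
  · simp only [neumannEigenvalue, neumannForm_eq_operatorForm, eigenvalue_eq] at hlt heq hgt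
    rw [neumannForm_eq_operatorForm] at hf
    simp only [dynamicalForm_eq_operatorForm] at hU
    obtain ⟨M, hM, hlim⟩ := hp.exists_orthogonal_tendsto hs hA hf.isEigenSystem
      (fun β hβ => (hU β hβ).isEigenSystem) hlt heq hgt
    -- The convergence in `hlim` is strong, so every continuous functional passes to the limit.
    exact ⟨M, hM, fun i ℓ => (ℓ.continuous.tendsto _).comp (hlim i)⟩
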